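/- Let $K$ be a number field of degree $k$ and $B=(\omega_1,\dots,\omega_k)$ a basis of $K$ over $\mathbb{Q}$. For $q\in K$ let $A_{K,B}(q)$ be the matrix, in the basis $B$, of multiplication by $q$ on $K$; let $A^*:\mathbb{R}^k\to M_{k\times k}(\mathbb{R})$ be $A^*(x)=\sum_j x_jA_{K,B}(\omega_j)$, and let $(\mathbb{R}\otimes_{\mathbb{Q}}K)_B$ be its image, a commutative ring. For an embedding $\sigma:K\to\mathbb{C}$ let $\sigma^*:(\mathbb{R}\otimes_{\mathbb{Q}}K)_B\to\mathbb{C}$ be the ring homomorphism that extends $\sigma$ by continuity, so that $\sigma^*(A^*(x))=\sum_j x_j\sigma(\omega_j)$. Let $f$ be a polynomial in $n$ variables over $(\mathbb{R}\otimes_{\mathbb{Q}}K)_B$ and let $P_{f,\sigma}\in\mathbb{C}[z_1,\dots,z_n]$ be obtained by applying $\sigma^*$ to its coefficients. For $x=(x_1,\dots,x_n)\in(\mathbb{R}^k)^n=\mathbb{R}^{kn}$ put $\phi_f(x)=\operatorname{tr} f(A^*(x_1),\dots,A^*(x_n))$, $\vec\sigma(x)=(\sigma^*(A^*(x_1)),\dots,\sigma^*(A^*(x_n)))$,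 and $$H_{f,\sigma}(x)=\max_{|\alpha|\ge 1}\left|\frac{1}{\alpha!}\partial^\alpha P_{f,\sigma}(\vec\sigma(x))\right|^{1/|\alpha|},\qquad J_{f,\sigma}(x)=\max_{|\alpha|\ge 2}\left|\frac{1}{\alpha!}\partial^\alpha P_{f,\sigma}(\vec\sigma(x))\right|^{1/|\alpha|}.$$ For a nonempty set $S$ of embeddings $K\to\mathbb{C}$ and a smooth compactly supported $\psi:\mathbb{R}^{kn}\to\mathbb{C}$ put $$H_{f,S,\psi}=\prod_{\sigma\in S}\ \inf_{x\in\operatorname{supp}\psi}H_{f,\sigma}(x).$$ Let $n,d\ge 0$ be integers and let $R>0$. There is a constant $C>0$ depending only on $K,B,n,d,R$ such that the following holds. Let $f$ be a polynomial in $n$ variables of degree at most $d$ over $(\mathbb{R}\otimes_{\mathbb{Q}}K)_B$, let $S$ be a nonempty set of embeddings $K\to\mathbb{C}$ closed under complex conjugation, and let $\psi:\mathbb{R}^{kn}\to\mathbb{C}$ be smooth and supported in the closed unit ball. Suppose that for some integer $N\ge 4$, $$J_{f,\sigma}(x)^t\ \ge\ R\,\|\psi\|_{C^t}\qquad\text{for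 all integers }0\le t\le kN,\ \text{all }\sigma\in S\text{ and all }x\in\operatorname{supp}\psi,$$ where $\|\psi\|_{C^t}$ is the largest of the supremum norms of the derivatives of $\psi$ of order at most $t$. Then $$\left|\int_{\mathbb{R}^{kn}}e^{2\pi i\phi_f(x)}\psi(x)\,dx\right|\ \le\ C\,H_{f,S,\psi}^{-1},$$ where the right side is read as $\infty$ if $H_{f,S,\psi}=0$ and as $0$ if $\psi=0$. -/

import Mathlib

open scoped ENNReal NNReal ContDiff

noncomputable section

namespace NFOsc

variable {K : Type*} [Field K] [NumberField K] {k : ℕ}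

/-! ### The algebra `(ℝ ⊗ K)_B` of real matrices -/

/-- `A_{K,B}^* : ℝ^k → M_k(ℝ)`, the real-linear extension of `q ↦` (matrix, in the basis `B`,
of multiplication by `q₁ω₁ + ⋯ + q_kω_k` on `K`). -/
def AStar (B : Module.Basis (Fin k) ℚ K) (x : Fin k → ℝ) : Matrix (Fin k) (Fin k) ℝ :=
  ∑ j, x j • (Algebra.leftMulMatrix B (B j)).map (algebraMap ℚ ℝ)

/-- On rational vectors `AStar` is the multiplication matrix `A_{K,B}`. -/
theorem AStar_rat (B : Module.Basis (Fin k) ℚ K) (q : Fin k → ℚ) :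
    AStar B (fun j => (q j : ℝ)) =
      (Algebra.leftMulMatrix B (∑ j, q j • B j)).map (algebraMap ℚ ℝ) := by
  ext a b
  simp [AStar, Matrix.sum_apply, map_sum]

theorem leftMulMatrix_baseChange (B : Module.Basis (Fin k) ℚ K) (q : K) :
    Algebra.leftMulMatrix (B.baseChange ℝ) (1 ⊗ₜ[ℚ] q) =
      (Algebra.leftMulMatrix B q).map (algebraMap ℚ ℝ) := by
  ext a b
  simp [Algebra.leftMulMatrix_eq_repr_mul, Algebra.smul_def]

theorem AStar_eq_leftMulMatrix (B : Module.Basis (Fin k) ℚ K) (x : Fin k → ℝ) :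
    AStar B x = Algebra.leftMulMatrix (B.baseChange ℝ) (∑ j, x j • (1 ⊗ₜ[ℚ] B j)) := by
  simp only [AStar, map_sum, map_smul, leftMulMatrix_baseChange]

theorem range_AStar (B : Module.Basis (Fin k) ℚ K) :
    Set.range (AStar B) = (Algebra.leftMulMatrix (B.baseChange ℝ)).range := by
  ext M
  constructor
  · rintro ⟨x, rfl⟩
    exact ⟨_, (AStar_eq_leftMulMatrix B x).symm⟩
  · rintro ⟨z, rfl⟩
    refine ⟨(B.baseChange ℝ).repr z, ?_⟩
    rw [AStar_eq_leftMulMatrix]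
    have h := (B.baseChange ℝ).sum_repr z
    simp only [Module.Basis.baseChange_apply] at h
    rw [h]
    rfl

/-- `(ℝ ⊗_ℚ K)_B`: the image of `A_{K,B}^*`, a real algebra of `k × k` matrices. -/
def realAlg (B : Module.Basis (Fin k) ℚ K) : Subalgebra ℝ (Matrix (Fin k) (Fin k) ℝ) :=
  (Algebra.leftMulMatrix (B.baseChange ℝ)).range.copy (Set.range (AStar B)) (range_AStar B)

/-- The isomorphism of `ℝ ⊗_ℚ K` with its matrix model. -/
def tensorEquiv (B : Module.Basis (Fin k) ℚ K) : TensorProduct ℚ ℝ K ≃ₐ[ℝ] realAlg B :=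
  (AlgEquiv.ofInjective (Algebra.leftMulMatrix (B.baseChange ℝ))
    (Algebra.leftMulMatrix_injective _)).trans
    (Subalgebra.equivOfEq _ _ (Subalgebra.copy_eq _ _ (range_AStar B)).symm)

/-- The matrices in `(ℝ ⊗_ℚ K)_B` commute, so that polynomials over it make sense. -/
instance instCommRingRealAlg (B : Module.Basis (Fin k) ℚ K) : CommRing (realAlg B) :=
  { (realAlg B).toRing with
    mul_comm := fun a b => by
      apply (tensorEquiv B).symm.injective
      rw [map_mul, map_mul, mul_comm] }

/-- `A_{K,B}^*(x)` as an element of `(ℝ ⊗_ℚ K)_B`. -/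
def AStarMem (B : Module.Basis (Fin k) ℚ K) (x : Fin k → ℝ) : realAlg B :=
  ⟨AStar B x, x, rfl⟩

/-- `σ^* : (ℝ ⊗_ℚ K)_B → ℂ`, the real-linear ring morphism extending the embedding `σ`. -/
def sigmaStar (B : Module.Basis (Fin k) ℚ K) (σ : K →+* ℂ) : realAlg B →+* ℂ :=
  ((Algebra.TensorProduct.lift (Algebra.ofId ℝ ℂ) σ.toRatAlgHom
    (fun _ _ => Commute.all _ _) : TensorProduct ℚ ℝ K →ₐ[ℝ] ℂ) : TensorProduct ℚ ℝ K →+* ℂ).comp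
    ((tensorEquiv B).symm : realAlg B →+* TensorProduct ℚ ℝ K)

/-- `σ^{**} = σ^* ∘ A_{K,B}^* : ℝ^k → ℂ`. -/
def sigmaStarStar (B : Module.Basis (Fin k) ℚ K) (σ : K →+* ℂ) (x : Fin k → ℝ) : ℂ :=
  sigmaStar B σ (AStarMem B x)

/-- `σ^{**}(x) = x₁ σ(ω₁) + ⋯ + x_k σ(ω_k)`. -/
theorem sigmaStarStar_eq (B : Module.Basis (Fin k) ℚ K) (σ : K →+* ℂ) (x : Fin k → ℝ) :
    sigmaStarStar B σ x = ∑ j, (x j : ℂ) * σ (B j) := by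
  have h : AStarMem B x = tensorEquiv B (∑ j, x j • (1 ⊗ₜ[ℚ] B j)) :=
    Subtype.ext (AStar_eq_leftMulMatrix B x)
  simp [sigmaStarStar, sigmaStar, h, map_sum]

/-! ### The phase and the oscillatory integral -/

variable {n : ℕ}

/-- The `l`-th block `x_l ∈ ℝ^k` of `x ∈ ℝ^{kn}`. -/
def block (x : EuclideanSpace ℝ (Fin n × Fin k)) (l : Fin n) : Fin k → ℝ := fun j => x (l, j)

/-- `f^*(x) = f(A^*(x_1), …, A^*(x_n))`. -/
def fStar (B : Module.Basis (Fin k) ℚ K) (f : MvPolynomial (Fin n) (realAlg B))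
    (x : EuclideanSpace ℝ (Fin n × Fin k)) : realAlg B :=
  MvPolynomial.eval (fun l => AStarMem B (block x l)) f

/-- The real phase `φ_f(x) = tr^*(f^*(x))`. -/
def phase (B : Module.Basis (Fin k) ℚ K) (f : MvPolynomial (Fin n) (realAlg B))
    (x : EuclideanSpace ℝ (Fin n × Fin k)) : ℝ :=
  Matrix.trace (fStar B f x : Matrix (Fin k) (Fin k) ℝ)

/-- `I_{K,B,ψ}(f) = ∫ e^{2πi φ_f(x)} ψ(x) dx` over `ℝ^{kn}`. -/
def oscIntegral (B : Module.Basis (Fin k) ℚ K) (f : MvPolynomial (Fin n) (realAlg B))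
    (ψ : EuclideanSpace ℝ (Fin n × Fin k) → ℂ) : ℂ :=
  ∫ x, Complex.exp (2 * Real.pi * Complex.I * (phase B f x : ℂ)) * ψ x

/-! ### The `H`- and `J`-functionals -/

/-- `P_{f,σ}`: apply `σ^*` to each coefficient of `f`. -/
def embPoly (B : Module.Basis (Fin k) ℚ K) (f : MvPolynomial (Fin n) (realAlg B))
    (σ : K →+* ℂ) : MvPolynomial (Fin n) ℂ :=
  MvPolynomial.map (sigmaStar B σ) f

/-- The vector `(σ^{**}(x_1), …, σ^{**}(x_n)) ∈ ℂ^n`. -/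
def sigmaVec (B : Module.Basis (Fin k) ℚ K) (σ : K →+* ℂ)
    (x : EuclideanSpace ℝ (Fin n × Fin k)) : Fin n → ℂ :=
  fun l => sigmaStarStar B σ (block x l)

/-- The iterated partial derivative `∂^α P` of a polynomial. -/
def multiDeriv (α : Fin n → ℕ) (P : MvPolynomial (Fin n) ℂ) : MvPolynomial (Fin n) ℂ :=
  (List.finRange n).foldr (fun i Q => (MvPolynomial.pderiv i)^[α i] Q) P

/-- `max_{|α| ≥ m} |∂^α P(z) / α!|^{1/|α|}`; only finitely many `α` contribute. -/
def derivSize (m : ℕ) (P : MvPolynomial (Fin n) ℂ) (z : Fin n → ℂ) : ℝ≥0∞ :=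
  ⨆ (α : Fin n → ℕ) (_ : m ≤ ∑ i, α i),
    ‖((∏ i, (α i).factorial : ℕ) : ℂ)⁻¹ * MvPolynomial.eval z (multiDeriv α P)‖ₑ ^
      (1 / ((∑ i, α i : ℕ) : ℝ))

/-- The pointwise `H`-functional `H_{f,K,B,σ}(x)`. -/
def HPoint (B : Module.Basis (Fin k) ℚ K) (f : MvPolynomial (Fin n) (realAlg B))
    (σ : K →+* ℂ) (x : EuclideanSpace ℝ (Fin n × Fin k)) : ℝ≥0∞ :=
  derivSize 1 (embPoly B f σ) (sigmaVec B σ x)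

/-- The pointwise `J`-functional `J_{f,K,B,σ}(x)`. -/
def JPoint (B : Module.Basis (Fin k) ℚ K) (f : MvPolynomial (Fin n) (realAlg B))
    (σ : K →+* ℂ) (x : EuclideanSpace ℝ (Fin n × Fin k)) : ℝ≥0∞ :=
  derivSize 2 (embPoly B f σ) (sigmaVec B σ x)

/-- The uniform `H`-functional `H_{f,K,B,σ,ψ}`, the infimum of `H_{f,K,B,σ}` over `supp ψ`. -/
def HUnif (B : Module.Basis (Fin k) ℚ K) (f : MvPolynomial (Fin n) (realAlg B))
    (σ : K →+* ℂ) (ψ : EuclideanSpace ℝ (Fin n × Fin k) → ℂ) : ℝ≥0∞ :=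
  ⨅ x ∈ tsupport ψ, HPoint B f σ x

/-- The uniform `H`-functional `H_{f,K,B,S,ψ}` of a collection `S` of embeddings. -/
def HSet (B : Module.Basis (Fin k) ℚ K) (f : MvPolynomial (Fin n) (realAlg B))
    (S : Finset (K →+* ℂ)) (ψ : EuclideanSpace ℝ (Fin n × Fin k) → ℂ) : ℝ≥0∞ :=
  ∏ σ ∈ S, HUnif B f σ ψ

/-- The `C^t` norm: the largest supremum norm of the derivatives of order at most `t`. -/
def cNorm (t : ℕ) (ψ : EuclideanSpace ℝ (Fin n × Fin k) → ℂ) : ℝ≥0∞ :=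
  ⨆ (j : ℕ) (_ : j ≤ t) (x : EuclideanSpace ℝ (Fin n × Fin k)), ‖iteratedFDeriv ℝ j ψ x‖ₑ

end NFOsc

end

noncomputable section

namespace NFOsc

/-! ### Taylor coefficients of multivariate polynomials -/

section Taylor

open MvPolynomial

variable {n : ℕ}

/-! Write H and J for `scale B 1` and `scale B 2`, so J ≤ H. The trace is the sum of all embeddings,
hence the phase is φ(x) = ∑ P_{f,σ}(σ-coordinates of x). Linear independence of the embeddings gives
complex constant directions D_{σ,l} dual to these coordinates. Thus D_{σ,l} φ = ∂_l P_{f,σ}, and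
D_{σ,l} annihilates the Taylor coefficients at every embedding other than σ.

Integration by parts. For σ in S let Q = Q_J + Q_∇, where Q_J is the sum of |∂^α P_{f,σ}/α!|^{2
d!/|α|} over 2 ≤ |α| ≤ d and Q_∇ is the sum of |∂_l P_{f,σ}|^{2 d!}. This is a smooth function of
size H^{2 d!}. Split the amplitude by 1 = Q_J/Q + Q_∇/Q. In the second part a factor ∂_l P_{f,σ}
times the exponential is D_{σ,l} of the exponential up to 2πi, and is integrated by parts. The first
part has size (J/H)^{2 d!} ≤ J/H. In the second part the coefficient has size 1/H, and a derivative
costs only J, since it raises the order of a Taylor coefficient to at least 2, and since the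
hypothesis bounds the derivatives of ψ by powers of every J. So each step gains J/H (`sym_ibpStep`),
and four steps for each σ in S bound the integral by a constant times the integral of ∏ (J/H)^4 over
the support (`exists_oscIntegral_le_lintegral`). This uses at most 4k derivatives of ψ, which is
where N ≥ 4 enters.

Geometry of the set where J/H is not small. By compactness, finitely many real directions v suffice
for the following: at each point, along one of them, every one-variable polynomial t ↦ P_{f,σ}(z + t
v), σ in S, has a coefficient of some index j ≥ 2 of size at least c J^j (`exists_goodDir`). Its
derivative has constant term O(H), hence a root ξ with (J/H)^2 H |ξ| = O(1)
(`exists_root_of_goodDir`). Therefore (J/H)^4 is at most a constant times (1 + m|ξ|)^{-2}, with m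
the infimum of H.

Integration along v. Moving x by y ⊗ v with y in ℝ^k translates these roots by σ(y), so that |ξ|
becomes the distance of σ(y) to one of at most d fixed points. Under ℝ^k ≅ ℝ^{r₁} × ℂ^{r₂} the
product of kernels separates. A real place contributes O(1/m); a complex place, where both conjugate
embeddings lie in S, has exponent 4 and contributes O(1/m²) (`exists_lintegral_places_le`). The
product over the places is the reciprocal of `HSet`, and averaging over x finishes the proof. -/

theorem pderiv_comm {R ι : Type*} [CommSemiring R] (i j : ι) (P : MvPolynomial ι R) :
    pderiv i (pderiv j P) = pderiv j (pderiv i P) := by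
  ext m
  simp only [coeff_pderiv]
  rcases eq_or_ne i j with rfl | h
  · rfl
  · rw [add_right_comm]
    simp [h, h.symm, mul_right_comm]

theorem pderiv_iterate_comm (i j : Fin n) (r : ℕ) (P : MvPolynomial (Fin n) ℂ) :
    pderiv i ((pderiv j)^[r] P) = (pderiv j)^[r] (pderiv i P) := by
  induction r generalizing P with
  | zero => rfl
  | succ r ih => rw [Function.iterate_succ_apply, Function.iterate_succ_apply, ih, pderiv_comm]

theorem pderiv_foldr_comm (α : Fin n → ℕ) (l : Fin n) (L : List (Fin n))
    (P : MvPolynomial (Fin n) ℂ) :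
    pderiv l (L.foldr (fun i Q => (pderiv i)^[α i] Q) P) =
      L.foldr (fun i Q => (pderiv i)^[α i] Q) (pderiv l P) := by
  induction L with
  | nil => rfl
  | cons a L ih => simp only [List.foldr_cons]; rw [pderiv_iterate_comm, ih]

theorem pderiv_multiDeriv_comm (α : Fin n → ℕ) (l : Fin n) (P : MvPolynomial (Fin n) ℂ) :
    pderiv l (multiDeriv α P) = multiDeriv α (pderiv l P) :=
  pderiv_foldr_comm α l _ P

theorem foldr_add_single (α : Fin n → ℕ) (l : Fin n) (L : List (Fin n)) (hL : L.Nodup)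
    (P : MvPolynomial (Fin n) ℂ) :
    L.foldr (fun i Q => (pderiv i)^[(α + Pi.single l 1 : Fin n → ℕ) i] Q) P =
      if l ∈ L then pderiv l (L.foldr (fun i Q => (pderiv i)^[α i] Q) P)
      else L.foldr (fun i Q => (pderiv i)^[α i] Q) P := by
  induction L with
  | nil => simp
  | cons a L ih =>
    have hn := List.nodup_cons.1 hL
    simp only [List.foldr_cons]
    rw [ih hn.2]
    rcases eq_or_ne a l with rfl | h
    · simp only [hn.1, if_false, List.mem_cons, true_or, if_true, Pi.add_apply, Pi.single_eq_same]
      rw [Function.iterate_succ_apply']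
    · by_cases hl : l ∈ L
      · simp [hl, h, pderiv_iterate_comm]
      · simp [hl, h, h.symm]

theorem pderiv_multiDeriv (α : Fin n → ℕ) (l : Fin n) (P : MvPolynomial (Fin n) ℂ) :
    pderiv l (multiDeriv α P) = multiDeriv (α + Pi.single l 1) P := by
  have := foldr_add_single α l (List.finRange n) (List.nodup_finRange n) P
  simp only [List.mem_finRange, if_true] at this
  exact this.symm

theorem multiDeriv_zero (P : MvPolynomial (Fin n) ℂ) : multiDeriv 0 P = P := by
  unfold multiDeriv
  induction List.finRange n with
  | nil => rfl
  | cons a L ih => simp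

theorem multiDeriv_zero_right (α : Fin n → ℕ) :
    multiDeriv α (0 : MvPolynomial (Fin n) ℂ) = 0 := by
  unfold multiDeriv
  induction List.finRange n with
  | nil => rfl
  | cons a L ih =>
    rw [List.foldr_cons, ih]
    exact Function.iterate_fixed (map_zero _) _

theorem multiDeriv_map (φ : ℂ →+* ℂ) (α : Fin n → ℕ) (P : MvPolynomial (Fin n) ℂ) :
    multiDeriv α (map φ P) = map φ (multiDeriv α P) := by
  unfold multiDeriv
  induction List.finRange n with
  | nil => rfl
  | cons a L ih =>
    rw [List.foldr_cons, List.foldr_cons, ih]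
    generalize List.foldr (fun i Q => (pderiv i)^[α i] Q) P L = Q
    induction α a generalizing Q with
    | zero => rfl
    | succ r ih => rw [Function.iterate_succ_apply, Function.iterate_succ_apply, pderiv_map, ih]

/-- Induction on multi-indices by adding one unit vector at a time. -/
theorem multiIndex_induction {p : (Fin n → ℕ) → Prop} (h0 : p 0)
    (h1 : ∀ α l, p α → p (α + Pi.single l 1)) (α : Fin n → ℕ) : p α := by
  induction hs : ∑ i, α i generalizing α with
  | zero =>
    have : α = 0 := by
      ext i
      exact (Finset.sum_eq_zero_iff.1 hs) i (Finset.mem_univ i)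
    rwa [this]
  | succ s ih =>
    obtain ⟨l, hl⟩ : ∃ l, α l ≠ 0 := by
      by_contra! h
      simp [h] at hs
    have hα : α = (α - Pi.single l 1) + Pi.single l 1 := by
      ext i
      rcases eq_or_ne i l with rfl | h
      · simp; omega
      · simp [h]
    rw [hα]
    apply h1
    apply ih
    have := congrArg (fun β : Fin n → ℕ => ∑ i, β i) hα
    simp only [Pi.add_apply, Finset.sum_add_distrib, Finset.sum_pi_single', Finset.mem_univ,
      if_true] at this
    simp only [hs] at this
    omega

theorem sum_add_single (α : Fin n → ℕ) (l : Fin n) :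
    ∑ i, (α + Pi.single l 1 : Fin n → ℕ) i = ∑ i, α i + 1 := by
  simp [Finset.sum_add_distrib]

/-- Degree is measured by vanishing of the coefficients from a threshold `j` on, because this passes
to `pderiv l P` with threshold `j - 1` and so survives the induction on `α`. -/
theorem multiDeriv_eq_zero_of_coeff (α : Fin n → ℕ) :
    ∀ (P : MvPolynomial (Fin n) ℂ) (j : ℕ), (∀ m : Fin n →₀ ℕ, j ≤ m.degree → coeff m P = 0) →
      j ≤ ∑ i, α i → multiDeriv α P = 0 := by
  induction α using multiIndex_induction with
  | h0 =>
    intro P j hP hj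
    have : P = 0 := by
      ext m
      rw [hP m (hj.trans (by simp)), coeff_zero]
    rw [this, multiDeriv_zero_right]
  | h1 α l ih =>
    intro P j hP hj
    rw [← pderiv_multiDeriv, pderiv_multiDeriv_comm]
    refine ih _ (j - 1) (fun m hm => ?_) ?_
    · rw [coeff_pderiv, hP, zero_mul]
      rw [map_add, Finsupp.degree_single]
      omega
    · rw [sum_add_single] at hj
      omega

theorem multiDeriv_eq_zero (α : Fin n → ℕ) (P : MvPolynomial (Fin n) ℂ)
    (h : P.totalDegree < ∑ i, α i) : multiDeriv α P = 0 := by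
  refine multiDeriv_eq_zero_of_coeff α P (P.totalDegree + 1) (fun m hm => ?_) h
  apply coeff_eq_zero_of_totalDegree_lt
  exact hm

/-- The Taylor coefficient `∂^α P(z) / α!`. -/
def taylorCoeff (α : Fin n → ℕ) (P : MvPolynomial (Fin n) ℂ) (z : Fin n → ℂ) : ℂ :=
  ((∏ i, (α i).factorial : ℕ) : ℂ)⁻¹ * eval z (multiDeriv α P)

theorem taylorCoeff_zero (P : MvPolynomial (Fin n) ℂ) (z : Fin n → ℂ) :
    taylorCoeff 0 P z = eval z P := by
  simp [taylorCoeff, multiDeriv_zero]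

theorem prod_factorial_add_single (α : Fin n → ℕ) (l : Fin n) :
    ∏ i, ((α + Pi.single l 1 : Fin n → ℕ) i).factorial =
      (α l + 1) * ∏ i, (α i).factorial := by
  rw [← Finset.mul_prod_erase _ _ (Finset.mem_univ l),
    ← Finset.mul_prod_erase _ (fun i => (α i).factorial) (Finset.mem_univ l), ← mul_assoc]
  congr 1
  · simp [Nat.factorial_succ]
  · refine Finset.prod_congr rfl fun i hi => ?_
    simp [Finset.ne_of_mem_erase hi]

theorem taylorCoeff_add_single (α : Fin n → ℕ) (l : Fin n) (P : MvPolynomial (Fin n) ℂ)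
    (z : Fin n → ℂ) :
    ((α l + 1 : ℕ) : ℂ) * taylorCoeff (α + Pi.single l 1) P z =
      ((∏ i, (α i).factorial : ℕ) : ℂ)⁻¹ * eval z (pderiv l (multiDeriv α P)) := by
  rw [taylorCoeff, prod_factorial_add_single, ← pderiv_multiDeriv]
  have h1 : ((α l + 1 : ℕ) : ℂ) ≠ 0 := Nat.cast_ne_zero.2 (Nat.succ_ne_zero _)
  rw [Nat.cast_mul, mul_inv, ← mul_assoc, ← mul_assoc, mul_inv_cancel₀ h1, one_mul]

theorem taylorCoeff_pderiv (α : Fin n → ℕ) (l : Fin n) (P : MvPolynomial (Fin n) ℂ)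
    (z : Fin n → ℂ) :
    taylorCoeff α (pderiv l P) z = ((α l + 1 : ℕ) : ℂ) * taylorCoeff (α + Pi.single l 1) P z := by
  rw [taylorCoeff_add_single, taylorCoeff, pderiv_multiDeriv_comm]

theorem taylorCoeff_eq_zero (α : Fin n → ℕ) (P : MvPolynomial (Fin n) ℂ) (z : Fin n → ℂ)
    (h : P.totalDegree < ∑ i, α i) : taylorCoeff α P z = 0 := by
  rw [taylorCoeff, multiDeriv_eq_zero α P h, map_zero, mul_zero]

theorem taylorCoeff_conj (α : Fin n → ℕ) (P : MvPolynomial (Fin n) ℂ) (z : Fin n → ℂ) :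
    taylorCoeff α (map (starRingEnd ℂ) P) (fun l => starRingEnd ℂ (z l)) =
      starRingEnd ℂ (taylorCoeff α P z) := by
  rw [taylorCoeff, taylorCoeff, multiDeriv_map, map_mul, map_inv₀, map_natCast, eval_map,
    eval₂_comp]
  rfl

/-- The translate `P(X + z)`. -/
def translate (z : Fin n → ℂ) : MvPolynomial (Fin n) ℂ →ₐ[ℂ] MvPolynomial (Fin n) ℂ :=
  bind₁ fun i => X i + C (z i)

theorem pderiv_translate (z : Fin n → ℂ) (l : Fin n) (P : MvPolynomial (Fin n) ℂ) :
    pderiv l (translate z P) = translate z (pderiv l P) := by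
  induction P using MvPolynomial.induction_on with
  | C a => simp [translate]
  | add p q hp hq => simp [hp, hq]
  | mul_X p i hp =>
    rw [map_mul, Derivation.leibniz, hp, Derivation.leibniz, map_add]
    simp only [smul_eq_mul, map_mul]
    congr 2
    rcases eq_or_ne i l with rfl | h
    · simp [translate]
    · simp [translate, pderiv_X_of_ne h]

/-- Translation commutes with partial derivatives, so the identity climbs from `α` to `α + Pi.single
l 1`. It turns statements about Taylor coefficients at a point into statements about coefficients of
one polynomial. -/
theorem coeff_translate (α : Fin n → ℕ) :
    ∀ (P : MvPolynomial (Fin n) ℂ) (z : Fin n → ℂ),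
      coeff (Finsupp.equivFunOnFinite.symm α) (translate z P) = taylorCoeff α P z := by
  induction α using multiIndex_induction with
  | h0 =>
    intro P z
    rw [taylorCoeff_zero]
    have h0 : Finsupp.equivFunOnFinite.symm (0 : Fin n → ℕ) = 0 := by ext; simp
    rw [h0, ← constantCoeff_eq, translate]
    induction P using MvPolynomial.induction_on with
    | C a => simp
    | add p q hp hq => simp [hp, hq]
    | mul_X p i hp => simp [hp]
  | h1 α l ih =>
    intro P z
    have h := ih (pderiv l P) z
    rw [taylorCoeff_pderiv, ← pderiv_translate, coeff_pderiv] at h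
    have h1 : ((α l + 1 : ℕ) : ℂ) ≠ 0 := Nat.cast_ne_zero.2 (Nat.succ_ne_zero _)
    have h2 : Finsupp.equivFunOnFinite.symm (α + Pi.single l 1) =
        Finsupp.equivFunOnFinite.symm α + Finsupp.single l 1 := by
      ext i
      simp [Finsupp.single_apply, Pi.single_apply, eq_comm]
    rw [h2]
    apply mul_left_cancel₀ h1
    rw [← h, mul_comm]
    simp

/-- The restriction `t ↦ P(z + t v)` of a polynomial to a line. -/
def linePoly (P : MvPolynomial (Fin n) ℂ) (z v : Fin n → ℂ) : Polynomial ℂ :=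
  aeval (fun l => Polynomial.C (z l) + Polynomial.C (v l) * Polynomial.X) P

/-- Moving the base point along the line only translates the variable; this is why the roots along a
line are translated rigidly. -/
theorem linePoly_comp (P : MvPolynomial (Fin n) ℂ) (z v : Fin n → ℂ) (t : ℂ) :
    linePoly P (fun l => z l + t * v l) v =
      (linePoly P z v).comp (Polynomial.X + Polynomial.C t) := by
  unfold linePoly
  induction P using MvPolynomial.induction_on with
  | C a => simp
  | add p q hp hq => rw [map_add, map_add, hp, hq, Polynomial.add_comp]
  | mul_X p i hp =>
    rw [map_mul, hp, map_mul, Polynomial.mul_comp]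
    simp
    left; ring

theorem linePoly_eq_aeval_translate (P : MvPolynomial (Fin n) ℂ) (z v : Fin n → ℂ) :
    linePoly P z v =
      aeval (fun l => Polynomial.C (v l) * Polynomial.X) (translate z P) := by
  unfold linePoly translate
  induction P using MvPolynomial.induction_on with
  | C a => simp
  | add p q hp hq => simp only [map_add, hp, hq]
  | mul_X p i hp => rw [map_mul, hp, map_mul, map_mul]; simp; left; ring

theorem coeff_aeval_line (G : MvPolynomial (Fin n) ℂ) (v : Fin n → ℂ) (j : ℕ) :
    (aeval (fun l => Polynomial.C (v l) * Polynomial.X) G : Polynomial ℂ).coeff j =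
      eval v (homogeneousComponent j G) := by
  induction G using MvPolynomial.induction_on' with
  | add p q hp hq => rw [map_add, Polynomial.coeff_add, hp, hq, map_add, map_add]
  | monomial m a =>
    rw [aeval_monomial]
    have : (m.prod fun i k => (Polynomial.C (v i) * Polynomial.X) ^ k) =
        Polynomial.C (m.prod fun i k => v i ^ k) * Polynomial.X ^ m.degree := by
      simp only [Finsupp.prod, mul_pow, Finset.prod_mul_distrib, Finset.prod_pow_eq_pow_sum,
        Finsupp.degree, map_prod, map_pow]
      rfl
    rw [this, ← Polynomial.C_eq_algebraMap, ← mul_assoc, ← Polynomial.C_mul,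
      Polynomial.coeff_C_mul_X_pow]
    split_ifs with h
    · rw [homogeneousComponent_of_mem (n := m.degree) (isHomogeneous_monomial _ rfl), if_pos h,
        eval_monomial]
    · rw [homogeneousComponent_of_mem (n := m.degree) (isHomogeneous_monomial _ rfl), if_neg h,
        map_zero]

theorem coeff_linePoly (P : MvPolynomial (Fin n) ℂ) (z v : Fin n → ℂ) (j : ℕ) :
    (linePoly P z v).coeff j = eval v (homogeneousComponent j (translate z P)) := by
  rw [linePoly_eq_aeval_translate, coeff_aeval_line]

theorem coeff_translate_eq_zero (P : MvPolynomial (Fin n) ℂ) (z : Fin n → ℂ) (m : Fin n →₀ ℕ)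
    (h : P.totalDegree < m.degree) : coeff m (translate z P) = 0 := by
  have := coeff_translate (Finsupp.equivFunOnFinite m) P z
  rw [Equiv.symm_apply_apply] at this
  rw [this, taylorCoeff_eq_zero]
  simpa [Finsupp.degree_eq_sum] using h

theorem totalDegree_translate_le (P : MvPolynomial (Fin n) ℂ) (z : Fin n → ℂ) :
    (translate z P).totalDegree ≤ P.totalDegree := by
  refine Finset.sup_le fun m hm => ?_
  by_contra h
  push Not at h
  exact (mem_support_iff.1 hm) (coeff_translate_eq_zero P z m
    (by simpa [Finsupp.degree_eq_sum, Finsupp.sum_fintype] using h))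

theorem natDegree_linePoly_le (P : MvPolynomial (Fin n) ℂ) (z v : Fin n → ℂ) :
    (linePoly P z v).natDegree ≤ P.totalDegree := by
  rw [Polynomial.natDegree_le_iff_coeff_eq_zero]
  intro j hj
  rw [coeff_linePoly, homogeneousComponent_eq_zero, map_zero]
  exact (totalDegree_translate_le P z).trans_lt hj

/-- The chain rule at the base point. It bounds the constant term of the derivative along a line by
the gradient, hence by H. -/
theorem coeff_one_linePoly (P : MvPolynomial (Fin n) ℂ) (z v : Fin n → ℂ) :
    (linePoly P z v).coeff 1 = ∑ l, v l * taylorCoeff (Pi.single l 1) P z := by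
  have h : Polynomial.derivative (linePoly P z v) =
      ∑ l, Polynomial.C (v l) * linePoly (pderiv l P) z v := by
    unfold linePoly
    induction P using MvPolynomial.induction_on with
    | C a => simp
    | add p q hp hq => simp only [map_add, hp, hq, mul_add, Finset.sum_add_distrib]
    | mul_X p i hp =>
      rw [map_mul, Polynomial.derivative_mul, hp]
      simp only [Derivation.leibniz, map_add, smul_eq_mul, map_mul, aeval_X, mul_add,
        Finset.sum_add_distrib]
      rw [add_comm]
      congr 1
      · rw [Finset.sum_eq_single i]
        · simp; ring
        · intro l _ hl
          simp [pderiv_X_of_ne hl.symm]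
        · simp
      · rw [Finset.sum_mul, Finset.sum_mul, ← Finset.sum_add_distrib]
        refine Finset.sum_congr rfl fun l _ => ?_
        ring
  have h2 := congrArg (fun q => Polynomial.coeff q 0) h
  simp only [Polynomial.coeff_derivative, Polynomial.finsetSum_coeff, Polynomial.coeff_C_mul,
    zero_add, Nat.cast_zero, mul_one] at h2
  rw [h2]
  refine Finset.sum_congr rfl fun l _ => ?_
  congr 1
  have h3 := taylorCoeff_add_single 0 l P z
  rw [zero_add, multiDeriv_zero] at h3
  simp only [Pi.zero_apply, zero_add, Nat.cast_one, one_mul, Nat.factorial_zero,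
    Finset.prod_const_one, inv_one] at h3
  rw [h3, Polynomial.coeff_zero_eq_eval_zero, linePoly]
  induction pderiv l P using MvPolynomial.induction_on with
  | C a => simp
  | add p q hp hq => rw [map_add, Polynomial.eval_add, hp, hq, map_add]
  | mul_X p i hp => rw [map_mul, Polynomial.eval_mul, hp, map_mul]; simp

end Taylor

/-! ### Small roots of polynomials -/

section Roots

open Polynomial

/-- Split off a linear factor, q = r (X - ξ). The two terms of each coefficient of q are controlled
by the bound for r, using ρ ≤ ‖ξ‖ in one of them, and both are at most 2^D ‖r(0)‖ ‖ξ‖ = 2^D ‖q(0)‖.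
Hence one factor 2 per root. -/
theorem norm_coeff_mul_pow_le (D : ℕ) : ∀ (q : ℂ[X]), q.natDegree ≤ D → ∀ ρ : ℝ, 0 ≤ ρ →
    (∀ ξ, q.IsRoot ξ → ρ ≤ ‖ξ‖) → ∀ j, ‖q.coeff j‖ * ρ ^ j ≤ 2 ^ D * ‖q.coeff 0‖ := by
  induction D with
  | zero =>
    intro q hq ρ hρ _ j
    rcases j with _ | j
    · simp
    · rw [coeff_eq_zero_of_natDegree_lt (by omega)]
      simp
  | succ D ih =>
    intro q hq ρ hρ hroot j
    by_cases h0 : q.natDegree = 0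
    · rcases j with _ | j
      · simp only [pow_zero, mul_one]
        exact le_mul_of_one_le_left (norm_nonneg _) (one_le_pow₀ (by norm_num))
      · rw [coeff_eq_zero_of_natDegree_lt (by omega)]
        simp only [norm_zero, zero_mul]
        positivity
    · obtain ⟨ξ, hξ⟩ := IsAlgClosed.exists_root q
        (fun h => h0 (natDegree_eq_of_degree_eq_some h))
      obtain ⟨r, hr⟩ := dvd_iff_isRoot.2 hξ
      rw [mul_comm] at hr
      have hq0 : q ≠ 0 := by
        rintro rfl
        simp at h0
      have hr0 : r ≠ 0 := by
        rintro rfl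
        simp at hr
        exact hq0 hr
      have hdeg : r.natDegree ≤ D := by
        have : q.natDegree = r.natDegree + 1 := by
          rw [hr, natDegree_mul hr0 (X_sub_C_ne_zero ξ), natDegree_X_sub_C]
        omega
      have IH := ih r hdeg ρ hρ (fun ζ hζ => hroot ζ (by
        rw [hr, IsRoot.def, eval_mul, hζ.eq_zero, zero_mul]))
      have hξρ := hroot ξ hξ
      have hc0 : ‖q.coeff 0‖ = ‖r.coeff 0‖ * ‖ξ‖ := by
        rw [hr, mul_coeff_zero]
        simp
      rcases j with _ | j
      · simp only [pow_zero, mul_one]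
        exact le_mul_of_one_le_left (norm_nonneg _) (one_le_pow₀ (by norm_num))
      · have hc : q.coeff (j + 1) = r.coeff j - r.coeff (j + 1) * ξ := by
          rw [hr, coeff_mul_X_sub_C]
        have h1 : ‖q.coeff (j + 1)‖ ≤ ‖r.coeff j‖ + ‖r.coeff (j + 1)‖ * ‖ξ‖ := by
          rw [hc, ← norm_mul]
          exact norm_sub_le _ _
        have h2 := IH j
        have h3 := IH (j + 1)
        calc ‖q.coeff (j + 1)‖ * ρ ^ (j + 1)
            ≤ (‖r.coeff j‖ + ‖r.coeff (j + 1)‖ * ‖ξ‖) * ρ ^ (j + 1) := by gcongr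
          _ = (‖r.coeff j‖ * ρ ^ j) * ρ + (‖r.coeff (j + 1)‖ * ρ ^ (j + 1)) * ‖ξ‖ := by ring
          _ ≤ (2 ^ D * ‖r.coeff 0‖) * ‖ξ‖ + (2 ^ D * ‖r.coeff 0‖) * ‖ξ‖ := by gcongr
          _ = 2 ^ (D + 1) * ‖q.coeff 0‖ := by rw [hc0]; ring

/-- If the coefficient of `X ^ j` is large compared with the constant coefficient, there is a
small root. -/
theorem exists_root_norm_pow_le (D : ℕ) (q : ℂ[X]) (hq : q.natDegree ≤ D) (j : ℕ) (hj : 1 ≤ j)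
    (hc : q.coeff j ≠ 0) :
    ∃ ξ ∈ q.roots, ‖ξ‖ ^ j * ‖q.coeff j‖ ≤ 2 ^ D * ‖q.coeff 0‖ := by
  have hq0 : q ≠ 0 := by
    rintro rfl
    simp at hc
  have hd : q.natDegree ≠ 0 := by
    intro h
    exact hc (coeff_eq_zero_of_natDegree_lt (by omega))
  obtain ⟨ξ, hξ⟩ := IsAlgClosed.exists_root q (fun h => hd (natDegree_eq_of_degree_eq_some h))
  -- A root of least modulus: its modulus is an admissible ρ in `norm_coeff_mul_pow_le`.
  obtain ⟨ζ, hζ, hmin⟩ := q.roots.toFinset.exists_min_image (fun ξ => ‖ξ‖)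
    ⟨ξ, by simpa [hq0] using hξ⟩
  refine ⟨ζ, by simpa using hζ, ?_⟩
  have := norm_coeff_mul_pow_le D q hq ‖ζ‖ (norm_nonneg _)
    (fun x hx => hmin x (by simpa [hq0] using hx)) j
  linarith [mul_comm ‖q.coeff j‖ (‖ζ‖ ^ j)]

end Roots

/-! ### Directions along which finitely many polynomials are simultaneously large -/

section Directions

open MvPolynomial

/-- Real points are Zariski dense in ℂ^n. The directions must be real so that one displacement of
ℝ^{kn} moves along the same v in every embedding. -/
theorem exists_real_eval_ne_zero {n : ℕ} (P : MvPolynomial (Fin n) ℂ) (hP : P ≠ 0) :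
    ∃ v : Fin n → ℝ, eval (fun l => (v l : ℂ)) P ≠ 0 := by
  by_contra! h
  apply hP
  apply funext_set (fun _ : Fin n => Set.range ((↑) : ℝ → ℂ))
  · intro _
    exact Set.infinite_range_of_injective Complex.ofReal_injective
  · intro x hx
    choose v hv using fun l => hx l (Set.mem_univ l)
    have : x = fun l => (v l : ℂ) := by
      ext l
      exact (hv l).symm
    rw [this, h v, map_zero]

/-- The polynomial with given coefficients on the box `{0, …, d}ⁿ`. -/
def boxPoly {n d : ℕ} (c : (Fin n → Fin (d + 1)) → ℂ) : MvPolynomial (Fin n) ℂ :=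
  ∑ a, monomial (Finsupp.equivFunOnFinite.symm fun l => (a l : ℕ)) (c a)

theorem box_injective {n d : ℕ} : Function.Injective fun a : Fin n → Fin (d + 1) =>
    (Finsupp.equivFunOnFinite.symm fun l => (a l : ℕ) : Fin n →₀ ℕ) := by
  intro a b h
  ext l
  simpa using DFunLike.congr_fun h l

theorem coeff_boxPoly {n d : ℕ} (c : (Fin n → Fin (d + 1)) → ℂ) (a : Fin n → Fin (d + 1)) :
    coeff (Finsupp.equivFunOnFinite.symm fun l => (a l : ℕ)) (boxPoly c) = c a := by
  classical
  rw [boxPoly, coeff_sum, Finset.sum_eq_single a]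
  · simp
  · intro b _ hb
    rw [coeff_monomial, if_neg fun h => hb (box_injective h)]
  · simp

theorem eval_boxPoly {n d : ℕ} (c : (Fin n → Fin (d + 1)) → ℂ) (v : Fin n → ℂ) :
    eval v (boxPoly c) = ∑ a, c a * ∏ l, v l ^ (a l : ℕ) := by
  simp [boxPoly, eval_monomial, Finsupp.prod_fintype]

theorem exists_box_of_coeff_ne_zero {n d : ℕ} (P : MvPolynomial (Fin n) ℂ)
    (hP : P.totalDegree ≤ d) (m : Fin n →₀ ℕ) (hm : coeff m P ≠ 0) :
    ∃ a : Fin n → Fin (d + 1), (Finsupp.equivFunOnFinite.symm fun l => (a l : ℕ)) = m := by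
  have h1 : ∀ l, m l < d + 1 := by
    intro l
    have h2 := le_totalDegree (mem_support_iff.2 hm)
    have h3 : m l ≤ m.sum fun _ e => e := by
      rw [Finsupp.sum_fintype _ _ (fun _ => rfl)]
      exact Finset.single_le_sum (f := fun i => m i) (fun _ _ => Nat.zero_le _)
        (Finset.mem_univ l)
    omega
  exact ⟨fun l => ⟨m l, h1 l⟩, by ext l; simp⟩

theorem eq_boxPoly {n d : ℕ} (P : MvPolynomial (Fin n) ℂ) (hP : P.totalDegree ≤ d) :
    P = boxPoly fun a : Fin n → Fin (d + 1) =>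
      coeff (Finsupp.equivFunOnFinite.symm fun l => (a l : ℕ)) P := by
  classical
  ext m
  by_cases h : ∃ a : Fin n → Fin (d + 1), (Finsupp.equivFunOnFinite.symm fun l => (a l : ℕ)) = m
  · obtain ⟨a, rfl⟩ := h
    rw [coeff_boxPoly]
  · have h0 : coeff m P = 0 := by
      by_contra hm
      exact h (exists_box_of_coeff_ne_zero P hP m hm)
    rw [h0, boxPoly, coeff_sum, Finset.sum_eq_zero]
    intro b _
    rw [coeff_monomial, if_neg fun hb => h ⟨b, hb⟩]

theorem boxPoly_smul {n d : ℕ} (r : ℂ) (c : (Fin n → Fin (d + 1)) → ℂ) (v : Fin n → ℂ) :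
    eval v (boxPoly (r • c)) = r * eval v (boxPoly c) := by
  simp [eval_boxPoly, Finset.mul_sum, mul_assoc]

/-- Compactness of a product of unit spheres of coefficient vectors. The product of the nonzero
polynomials in a family is nonzero, so some real v makes all of them nonzero at once; this persists
on an open neighbourhood, and finitely many neighbourhoods cover. -/
theorem exists_directions_boxPoly (ι : Type*) [Fintype ι] (n d : ℕ) :
    ∃ (V : Finset (Fin n → ℝ)) (c : ℝ), 0 < c ∧
      ∀ q : ι → (Fin n → Fin (d + 1)) → ℂ, (∀ i, ‖q i‖ = 1) →
        ∃ v ∈ V, ∀ i, c ≤ ‖eval (fun l => (v l : ℂ)) (boxPoly (q i))‖ := by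
  classical
  have hcomp : IsCompact (Set.univ.pi fun _ : ι =>
      Metric.sphere (0 : (Fin n → Fin (d + 1)) → ℂ) 1) :=
    isCompact_univ_pi fun _ => isCompact_sphere _ _
  obtain ⟨t, ht⟩ := hcomp.elim_finite_subcover
    (fun p : (Fin n → ℝ) × ℕ => {q : ι → (Fin n → Fin (d + 1)) → ℂ |
      ∀ i, 1 / ((p.2 : ℝ) + 1) < ‖eval (fun l => (p.1 l : ℂ)) (boxPoly (q i))‖})
    (by
      intro p
      simp only [Set.ofPred_forall]
      refine isOpen_iInter_of_finite fun i => ?_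
      simp only [eval_boxPoly]
      exact isOpen_lt continuous_const (by fun_prop))
    (by
      intro q hq
      have hne : ∀ i, boxPoly (q i) ≠ 0 := by
        intro i h
        have h1 : q i = 0 := by
          ext a
          rw [← coeff_boxPoly (q i) a, h, coeff_zero, Pi.zero_apply]
        have := hq i (Set.mem_univ i)
        rw [h1] at this
        simp at this
      obtain ⟨v, hv⟩ := exists_real_eval_ne_zero _
        (Finset.prod_ne_zero_iff.2 fun i (_ : i ∈ Finset.univ) => hne i)
      rw [map_prod, Finset.prod_ne_zero_iff] at hv
      have : ∀ i, ∃ N : ℕ, 1 / ((N : ℝ) + 1) <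
          ‖eval (fun l => (v l : ℂ)) (boxPoly (q i))‖ :=
        fun i => exists_nat_one_div_lt (norm_pos_iff.2 (hv i (Finset.mem_univ i)))
      choose N hN using this
      -- The sum of the `N i` is one integer that works for every `i`; the sum over `t` below plays
      -- the same role for the finite subcover.
      refine Set.mem_iUnion.2 ⟨(v, ∑ i, N i), fun i => lt_of_le_of_lt ?_ (hN i)⟩
      apply one_div_le_one_div_of_le (by positivity)
      have : N i ≤ ∑ i, N i :=
        Finset.single_le_sum (fun _ _ => Nat.zero_le _) (Finset.mem_univ i)
      simp only [add_le_add_iff_right]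
      exact_mod_cast this)
  refine ⟨t.image Prod.fst, 1 / (((∑ p ∈ t, p.2 : ℕ) : ℝ) + 1), by positivity, fun q hq => ?_⟩
  have hq' : q ∈ Set.univ.pi fun _ : ι => Metric.sphere (0 : (Fin n → Fin (d + 1)) → ℂ) 1 := by
    intro i _
    simpa using hq i
  obtain ⟨p, hp, hqp⟩ := Set.mem_iUnion₂.1 (ht hq')
  refine ⟨p.1, Finset.mem_image_of_mem _ hp, fun i => le_trans ?_ (hqp i).le⟩
  apply one_div_le_one_div_of_le (by positivity)
  have : p.2 ≤ ∑ p ∈ t, p.2 := Finset.single_le_sum (f := Prod.snd) (fun _ _ => Nat.zero_le _) hp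
  simp only [add_le_add_iff_right]
  exact_mod_cast this

theorem exists_directions (ι : Type*) [Fintype ι] (n d : ℕ) :
    ∃ (V : Finset (Fin n → ℝ)) (c : ℝ), 0 < c ∧
      ∀ Q : ι → MvPolynomial (Fin n) ℂ, (∀ i, (Q i).totalDegree ≤ d) →
        ∃ v ∈ V, ∀ i m, c * ‖coeff m (Q i)‖ ≤ ‖eval (fun l => (v l : ℂ)) (Q i)‖ := by
  classical
  obtain ⟨V, c, hc, hV⟩ := exists_directions_boxPoly ι n d
  refine ⟨V, c, hc, fun Q hQ => ?_⟩
  set q : ι → (Fin n → Fin (d + 1)) → ℂ := fun i a =>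
    coeff (Finsupp.equivFunOnFinite.symm fun l => (a l : ℕ)) (Q i) with hq
  have hQq : ∀ i, Q i = boxPoly (q i) := fun i => eq_boxPoly (Q i) (hQ i)
  obtain ⟨v, hv, h⟩ := hV
    -- Zero polynomials cannot be normalised; an arbitrary unit vector stands in, and the claim for
    -- them is trivial.
    (fun i => if q i = 0 then (fun _ => 1) else ((‖q i‖⁻¹ : ℝ) : ℂ) • q i) (by
      intro i
      split_ifs with h0
      · simp
      · rw [norm_smul, Complex.norm_real, norm_inv, norm_norm]
        exact inv_mul_cancel₀ (norm_ne_zero_iff.2 h0))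
  refine ⟨v, hv, fun i m => ?_⟩
  have h1 : ‖coeff m (Q i)‖ ≤ ‖q i‖ := by
    by_cases hm : coeff m (Q i) = 0
    · rw [hm, norm_zero]
      exact norm_nonneg _
    · obtain ⟨a, rfl⟩ := exists_box_of_coeff_ne_zero (Q i) (hQ i) m hm
      exact norm_le_pi_norm (q i) a
  have h2 := h i
  split_ifs at h2 with h0
  · rw [h0, norm_zero] at h1
    have : ‖coeff m (Q i)‖ = 0 := le_antisymm h1 (norm_nonneg _)
    rw [this, mul_zero]
    exact norm_nonneg _
  · have hpos : 0 < ‖q i‖ := norm_pos_iff.2 h0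
    rw [boxPoly_smul, norm_mul, Complex.norm_real, norm_inv, norm_norm, ← hQq i,
      inv_mul_eq_div, le_div_iff₀ hpos] at h2
    exact (mul_le_mul_of_nonneg_left h1 hc.le).trans h2

end Directions

/-! ### Constant complex vector fields -/

section CDeriv

variable {E : Type*} [NormedAddCommGroup E] [NormedSpace ℝ E]

/-- The derivative of `g` along the complex vector `p.1 + i p.2`. -/
def cDeriv (p : E × E) (g : E → ℂ) (x : E) : ℂ :=
  fderiv ℝ g x p.1 + Complex.I * fderiv ℝ g x p.2

variable {p : E × E} {g h : E → ℂ} {x : E} {U : Set E}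

theorem cDeriv_congr (hU : IsOpen U) (hgh : Set.EqOn g h U) :
    Set.EqOn (cDeriv p g) (cDeriv p h) U := by
  intro x hx
  have : g =ᶠ[nhds x] h := Filter.eventually_of_mem (hU.mem_nhds hx) hgh
  simp only [cDeriv, this.fderiv_eq]

theorem cDeriv_add (hg : DifferentiableAt ℝ g x) (hh : DifferentiableAt ℝ h x) :
    cDeriv p (fun y => g y + h y) x = cDeriv p g x + cDeriv p h x := by
  simp only [cDeriv, fderiv_fun_add hg hh, add_apply]
  ring

theorem cDeriv_mul (hg : DifferentiableAt ℝ g x) (hh : DifferentiableAt ℝ h x) :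
    cDeriv p (fun y => g y * h y) x = cDeriv p g x * h x + g x * cDeriv p h x := by
  simp only [cDeriv, fderiv_fun_mul hg hh, add_apply,
    smul_apply, smul_eq_mul]
  ring

theorem cDeriv_const (c : ℂ) : cDeriv p (fun _ => c) x = 0 := by
  simp [cDeriv]

theorem cDeriv_inv (hg : DifferentiableAt ℝ g x) (h0 : g x ≠ 0) :
    cDeriv p (fun y => (g y)⁻¹) x = -1 * (cDeriv p g x * ((g x)⁻¹ * (g x)⁻¹)) := by
  have h1 : HasFDerivAt (fun y => (g y)⁻¹) (-(g x ^ 2)⁻¹ • fderiv ℝ g x) x :=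
    (hasDerivAt_inv h0).comp_hasFDerivAt_of_eq x hg.hasFDerivAt rfl
  simp only [cDeriv, h1.fderiv, smul_apply, smul_eq_mul]
  field_simp
  ring

theorem cDeriv_exp (hg : DifferentiableAt ℝ g x) :
    cDeriv p (fun y => Complex.exp (g y)) x = cDeriv p g x * Complex.exp (g x) := by
  simp only [cDeriv, (hg.hasFDerivAt.cexp).fderiv, smul_apply, smul_eq_mul]
  ring

theorem contDiffOn_cDeriv (hU : IsOpen U) (hg : ContDiffOn ℝ ∞ g U) :
    ContDiffOn ℝ ∞ (cDeriv p g) U := by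
  have h1 : ContDiffOn ℝ ∞ (fderiv ℝ g) U := hg.fderiv_of_isOpen hU (by simp)
  exact (h1.clm_apply contDiffOn_const).add
    (contDiffOn_const.mul (h1.clm_apply contDiffOn_const))

theorem contDiff_cDeriv (hg : ContDiff ℝ ∞ g) : ContDiff ℝ ∞ (cDeriv p g) :=
  contDiffOn_univ.1 (contDiffOn_cDeriv isOpen_univ hg.contDiffOn)

theorem tsupport_cDeriv_subset : tsupport (cDeriv p g) ⊆ tsupport g := by
  refine closure_minimal (fun x hx => ?_) (isClosed_tsupport _)
  by_contra h
  apply hx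
  have : fderiv ℝ g x = 0 := by
    by_contra h1
    exact h (support_fderiv_subset ℝ h1)
  simp [cDeriv, this]

theorem integral_mul_cDeriv [FiniteDimensional ℝ E] [MeasurableSpace E] [BorelSpace E]
    (μ : MeasureTheory.Measure E) [μ.IsAddHaarMeasure]
    (hg : ContDiff ℝ ∞ g) (hh : ContDiff ℝ ∞ h) (hc : HasCompactSupport h) :
    ∫ x, cDeriv p g x * h x ∂μ = -∫ x, g x * cDeriv p h x ∂μ := by
  have hdg : ∀ u, Continuous fun x => fderiv ℝ g x u := fun u =>
    (hg.continuous_fderiv (by simp)).clm_apply continuous_const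
  have hdh : ∀ u, Continuous fun x => fderiv ℝ h x u := fun u =>
    (hh.continuous_fderiv (by simp)).clm_apply continuous_const
  have hcd : ∀ u, HasCompactSupport fun x => fderiv ℝ h x u := fun u =>
    hc.fderiv_apply ℝ u
  have i1 : ∀ u, MeasureTheory.Integrable (fun x => fderiv ℝ g x u * h x) μ := fun u =>
    ((hdg u).mul hh.continuous).integrable_of_hasCompactSupport hc.mul_left
  have i2 : ∀ u, MeasureTheory.Integrable (fun x => g x * fderiv ℝ h x u) μ := fun u =>
    (hg.continuous.mul (hdh u)).integrable_of_hasCompactSupport (hcd u).mul_left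
  have i3 : MeasureTheory.Integrable (fun x => g x * h x) μ :=
    (hg.continuous.mul hh.continuous).integrable_of_hasCompactSupport hc.mul_left
  have key : ∀ u, ∫ x, g x * fderiv ℝ h x u ∂μ = -∫ x, fderiv ℝ g x u * h x ∂μ := fun u =>
    integral_mul_fderiv_eq_neg_fderiv_mul_of_integrable (i1 u) (i2 u) i3
      (fun x _ => (hg.differentiable (by simp)).differentiableAt)
      (fun x _ => (hh.differentiable (by simp)).differentiableAt)
  have e1 : ∀ x, cDeriv p g x * h x =
      fderiv ℝ g x p.1 * h x + Complex.I * (fderiv ℝ g x p.2 * h x) := fun x => by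
    simp only [cDeriv]
    ring
  have e2 : ∀ x, g x * cDeriv p h x =
      g x * fderiv ℝ h x p.1 + Complex.I * (g x * fderiv ℝ h x p.2) := fun x => by
    simp only [cDeriv]
    ring
  simp only [e1, e2]
  rw [MeasureTheory.integral_add (i1 _) ((i1 _).const_mul _),
    MeasureTheory.integral_add (i2 _) ((i2 _).const_mul _),
    MeasureTheory.integral_const_mul, MeasureTheory.integral_const_mul, key, key]
  ring

theorem norm_iteratedFDeriv_cDeriv_le (hg : ContDiff ℝ ∞ g) (t : ℕ) (x : E) :
    ‖iteratedFDeriv ℝ t (cDeriv p g) x‖ ≤ (‖p.1‖ + ‖p.2‖) * ‖iteratedFDeriv ℝ (t + 1) g x‖ := by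
  set ℓ : (E →L[ℝ] ℂ) →L[ℝ] ℂ :=
    ContinuousLinearMap.apply ℝ ℂ p.1 +
      (ContinuousLinearMap.mul ℝ ℂ Complex.I).comp (ContinuousLinearMap.apply ℝ ℂ p.2) with hℓ
  have hcomp : cDeriv p g = ℓ ∘ fderiv ℝ g := by
    ext y
    simp [cDeriv, hℓ]
  have hnorm : ‖ℓ‖ ≤ ‖p.1‖ + ‖p.2‖ := by
    refine ContinuousLinearMap.opNorm_le_bound _ (by positivity) fun T => ?_
    have h1 : ℓ T = T p.1 + Complex.I * T p.2 := by simp [hℓ]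
    rw [h1]
    calc ‖T p.1 + Complex.I * T p.2‖ ≤ ‖T p.1‖ + ‖Complex.I * T p.2‖ := norm_add_le _ _
      _ = ‖T p.1‖ + ‖T p.2‖ := by simp
      _ ≤ ‖T‖ * ‖p.1‖ + ‖T‖ * ‖p.2‖ := add_le_add (T.le_opNorm _) (T.le_opNorm _)
      _ = (‖p.1‖ + ‖p.2‖) * ‖T‖ := by ring
  have hfd : ContDiff ℝ ∞ (fderiv ℝ g) := hg.fderiv_right (by simp)
  rw [hcomp, ← norm_iteratedFDeriv_fderiv]
  exact (ContinuousLinearMap.norm_iteratedFDeriv_comp_left ℓ hfd.contDiffAt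
    (by exact_mod_cast le_top)).trans (by gcongr)

end CDeriv

/-! ### Symbol classes -/

section Symbols

/-- Data for a calculus of symbols: complex directions `dir i`, with a length scale
`1 / J i p x` for each of them, over a family of sets `X p` indexed by a parameter `p`. -/
structure SymbolSetting (E P ι : Type*) [NormedAddCommGroup E] [NormedSpace ℝ E] where
  X : P → Set E
  U : P → Set E
  isOpen_U : ∀ p, IsOpen (U p)
  X_subset : ∀ p, X p ⊆ U p
  dir : ι → E × E
  J : ι → P → E → ℝ
  J_nonneg : ∀ i p, ∀ x ∈ X p, 0 ≤ J i p x

namespace SymbolSetting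

variable {E P ι : Type*} [NormedAddCommGroup E] [NormedSpace ℝ E] (s : SymbolSetting E P ι)

/-- `g` is a symbol of weight `m`, up to `r` derivatives, uniformly in the parameter. -/
def Sym : ℕ → (P → E → ℂ) → (P → E → ℝ) → Prop
  | 0, g, m => ∃ C : ℝ, ∀ p, ∀ x ∈ s.X p, ‖g p x‖ ≤ C * m p x
  | r + 1, g, m => (∃ C : ℝ, ∀ p, ∀ x ∈ s.X p, ‖g p x‖ ≤ C * m p x) ∧
      ∀ i, Sym r (fun p => cDeriv (s.dir i) (g p)) (fun p x => m p x * s.J i p x)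

/-- Families of functions smooth on the sets `U p`. -/
def Smooth (g : P → E → ℂ) : Prop := ∀ p, ContDiffOn ℝ ∞ (g p) (s.U p)

variable {s} {g h : P → E → ℂ} {m m' : P → E → ℝ} {r : ℕ}

theorem Smooth.differentiableAt (hg : s.Smooth g) {p : P} {x : E} (hx : x ∈ s.U p) :
    DifferentiableAt ℝ (g p) x :=
  ((hg p).differentiableOn (by simp)).differentiableAt ((s.isOpen_U p).mem_nhds hx)

theorem Smooth.cDeriv (hg : s.Smooth g) (v : E × E) :
    s.Smooth fun p => NFOsc.cDeriv v (g p) :=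
  fun p => contDiffOn_cDeriv (s.isOpen_U p) (hg p)

theorem Smooth.add (hg : s.Smooth g) (hh : s.Smooth h) :
    s.Smooth fun p x => g p x + h p x :=
  fun p => (hg p).add (hh p)

theorem Smooth.mul (hg : s.Smooth g) (hh : s.Smooth h) :
    s.Smooth fun p x => g p x * h p x :=
  fun p => (hg p).mul (hh p)

theorem Smooth.const (c : ℂ) : s.Smooth fun _ _ => c :=
  fun _ => contDiffOn_const

theorem Smooth.pow (hg : s.Smooth g) (j : ℕ) : s.Smooth fun p x => g p x ^ j :=
  fun p => (hg p).pow j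

theorem Smooth.sum {κ : Type*} (t : Finset κ) {g : κ → P → E → ℂ}
    (hg : ∀ a ∈ t, s.Smooth (g a)) : s.Smooth fun p x => ∑ a ∈ t, g a p x :=
  fun p => ContDiffOn.sum fun a ha => hg a ha p

theorem Smooth.inv (hg : s.Smooth g) (h0 : ∀ p, ∀ x ∈ s.U p, g p x ≠ 0) :
    s.Smooth fun p x => (g p x)⁻¹ :=
  fun p => (hg p).inv (h0 p)

theorem Sym.bound (hg : s.Sym r g m) : ∃ C : ℝ, ∀ p, ∀ x ∈ s.X p, ‖g p x‖ ≤ C * m p x := by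
  cases r with
  | zero => exact hg
  | succ r => exact hg.1

/-- Equality is required on the open sets `U p`, and not merely on `X p`, so that it is inherited by
derivatives. -/
theorem Sym.congr (hgh : ∀ p, Set.EqOn (g p) (h p) (s.U p)) (hg : s.Sym r g m) :
    s.Sym r h m := by
  induction r generalizing g h m with
  | zero =>
    obtain ⟨C, hC⟩ := hg
    exact ⟨C, fun p x hx => by rw [← hgh p (s.X_subset p hx)]; exact hC p x hx⟩
  | succ r ih =>
    obtain ⟨⟨C, hC⟩, hd⟩ := hg
    exact ⟨⟨C, fun p x hx => by rw [← hgh p (s.X_subset p hx)]; exact hC p x hx⟩,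
      fun i => ih (fun p => cDeriv_congr (s.isOpen_U p) (hgh p)) (hd i)⟩

theorem Sym.of_succ (hg : s.Sym (r + 1) g m) : s.Sym r g m := by
  induction r generalizing g m with
  | zero => exact hg.1
  | succ r ih => exact ⟨hg.1, fun i => ih (hg.2 i)⟩

theorem Sym.mono (hm : ∀ p, ∀ x ∈ s.X p, 0 ≤ m p x ∧ m p x ≤ m' p x) (hg : s.Sym r g m) :
    s.Sym r g m' := by
  have key : ∀ {g : P → E → ℂ} {m m' : P → E → ℝ},
      (∀ p, ∀ x ∈ s.X p, 0 ≤ m p x ∧ m p x ≤ m' p x) →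
      (∃ C : ℝ, ∀ p, ∀ x ∈ s.X p, ‖g p x‖ ≤ C * m p x) →
      ∃ C : ℝ, ∀ p, ∀ x ∈ s.X p, ‖g p x‖ ≤ C * m' p x := by
    rintro g m m' hm ⟨C, hC⟩
    refine ⟨|C|, fun p x hx => (hC p x hx).trans ?_⟩
    obtain ⟨h0, h1⟩ := hm p x hx
    calc C * m p x ≤ |C| * m p x := mul_le_mul_of_nonneg_right (le_abs_self C) h0
      _ ≤ |C| * m' p x := mul_le_mul_of_nonneg_left h1 (abs_nonneg C)
  induction r generalizing g m m' with
  | zero => exact key hm hg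
  | succ r ih =>
    refine ⟨key hm hg.1, fun i => ih (fun p x hx => ?_) (hg.2 i)⟩
    have hJ := s.J_nonneg i p x hx
    exact ⟨mul_nonneg (hm p x hx).1 hJ, mul_le_mul_of_nonneg_right (hm p x hx).2 hJ⟩

theorem Sym.add (hgs : s.Smooth g) (hhs : s.Smooth h) (hg : s.Sym r g m) (hh : s.Sym r h m) :
    s.Sym r (fun p x => g p x + h p x) m := by
  induction r generalizing g h m with
  | zero =>
    obtain ⟨C, hC⟩ := hg
    obtain ⟨C', hC'⟩ := hh
    refine ⟨C + C', fun p x hx => (norm_add_le _ _).trans ?_⟩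
    rw [add_mul]
    exact add_le_add (hC p x hx) (hC' p x hx)
  | succ r ih =>
    refine ⟨?_, fun i => ?_⟩
    · obtain ⟨C, hC⟩ := hg.1
      obtain ⟨C', hC'⟩ := hh.1
      refine ⟨C + C', fun p x hx => (norm_add_le _ _).trans ?_⟩
      rw [add_mul]
      exact add_le_add (hC p x hx) (hC' p x hx)
    · refine (ih (hgs.cDeriv _) (hhs.cDeriv _) (hg.2 i) (hh.2 i)).congr fun p x hx => ?_
      exact (cDeriv_add (hgs.differentiableAt hx) (hhs.differentiableAt hx)).symm

theorem Sym.mul (hgs : s.Smooth g) (hhs : s.Smooth h) (hg : s.Sym r g m) (hh : s.Sym r h m') :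
    s.Sym r (fun p x => g p x * h p x) (fun p x => m p x * m' p x) := by
  have key : ∀ {g h : P → E → ℂ} {m m' : P → E → ℝ},
      (∃ C : ℝ, ∀ p, ∀ x ∈ s.X p, ‖g p x‖ ≤ C * m p x) →
      (∃ C : ℝ, ∀ p, ∀ x ∈ s.X p, ‖h p x‖ ≤ C * m' p x) →
      ∃ C : ℝ, ∀ p, ∀ x ∈ s.X p, ‖g p x * h p x‖ ≤ C * (m p x * m' p x) := by
    rintro g h m m' ⟨C, hC⟩ ⟨C', hC'⟩
    refine ⟨C * C', fun p x hx => ?_⟩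
    rw [norm_mul]
    calc ‖g p x‖ * ‖h p x‖ ≤ (C * m p x) * (C' * m' p x) :=
          mul_le_mul (hC p x hx) (hC' p x hx) (norm_nonneg _)
            ((norm_nonneg _).trans (hC p x hx))
      _ = C * C' * (m p x * m' p x) := by ring
  induction r generalizing g h m m' with
  | zero => exact key hg hh
  | succ r ih =>
    refine ⟨key hg.1 hh.1, fun i => ?_⟩
    have h1 := ih (hgs.cDeriv _) hhs (hg.2 i) hh.of_succ
    have h2 := ih hgs (hhs.cDeriv _) hg.of_succ (hh.2 i)
    have e1 : (fun p x => m p x * s.J i p x * m' p x) =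
        fun p x => m p x * m' p x * s.J i p x := by
      ext p x
      ring
    have e2 : (fun p x => m p x * (m' p x * s.J i p x)) =
        fun p x => m p x * m' p x * s.J i p x := by
      ext p x
      ring
    rw [e1] at h1
    rw [e2] at h2
    refine (h1.add ((hgs.cDeriv _).mul hhs) (hgs.mul (hhs.cDeriv _)) h2).congr
      fun p x hx => ?_
    exact (cDeriv_mul (hgs.differentiableAt hx) (hhs.differentiableAt hx)).symm

theorem Sym.zero : s.Sym r (fun _ _ => 0) m := by
  induction r generalizing m with
  | zero => exact ⟨0, fun p x _ => by simp⟩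
  | succ r ih =>
    refine ⟨⟨0, fun p x _ => by simp⟩, fun i => (ih (m := _)).congr fun p x _ => ?_⟩
    exact (cDeriv_const 0).symm

theorem Sym.const (c : ℂ) : s.Sym r (fun _ _ => c) (fun _ _ => 1) := by
  cases r with
  | zero => exact ⟨‖c‖, fun p x _ => by simp⟩
  | succ r =>
    refine ⟨⟨‖c‖, fun p x _ => by simp⟩, fun i => Sym.zero.congr fun p x _ => ?_⟩
    exact (cDeriv_const c).symm

theorem Sym.const_mul (c : ℂ) (hgs : s.Smooth g) (hg : s.Sym r g m) :
    s.Sym r (fun p x => c * g p x) m := by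
  have := (Sym.const (s := s) (r := r) c).mul (Smooth.const c) hgs hg
  simpa using this

theorem Sym.sum {κ : Type*} (t : Finset κ) {g : κ → P → E → ℂ} (hgs : ∀ a ∈ t, s.Smooth (g a))
    (hg : ∀ a ∈ t, s.Sym r (g a) m) : s.Sym r (fun p x => ∑ a ∈ t, g a p x) m := by
  classical
  induction t using Finset.induction_on with
  | empty => simpa using Sym.zero
  | insert a t ha ih =>
    simp only [Finset.sum_insert ha]
    refine Sym.add (hgs a (Finset.mem_insert_self _ _)) ?_ (hg a (Finset.mem_insert_self _ _)) ?_
    · exact Smooth.sum t fun b hb => hgs b (Finset.mem_insert_of_mem hb)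
    · exact ih (fun b hb => hgs b (Finset.mem_insert_of_mem hb))
        fun b hb => hg b (Finset.mem_insert_of_mem hb)

theorem Sym.pow (hgs : s.Smooth g) (hg : s.Sym r g m) (j : ℕ) :
    s.Sym r (fun p x => g p x ^ j) (fun p x => m p x ^ j) := by
  induction j with
  | zero => simpa using Sym.const (s := s) 1
  | succ j ih =>
    simp only [pow_succ]
    exact ih.mul (hgs.pow j) hgs hg

/-- The derivative of 1/g is -(Dg) g⁻¹ g⁻¹, of weight (m J) m⁻¹ m⁻¹ = m⁻¹ J. The bounds on g⁻¹ up to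
order `r` therefore give those of order `r + 1`; the lower bound on ‖g‖ enters only at order zero.
-/
theorem Sym.inv (hgs : s.Smooth g) (h0 : ∀ p, ∀ x ∈ s.U p, g p x ≠ 0)
    (hm : ∀ p, ∀ x ∈ s.X p, 0 < m p x)
    (hc : ∃ c : ℝ, 0 < c ∧ ∀ p, ∀ x ∈ s.X p, c * m p x ≤ ‖g p x‖)
    (hg : s.Sym r g m) : s.Sym r (fun p x => (g p x)⁻¹) (fun p x => (m p x)⁻¹) := by
  obtain ⟨c, hc0, hc⟩ := hc
  have base : ∃ C : ℝ, ∀ p, ∀ x ∈ s.X p, ‖(g p x)⁻¹‖ ≤ C * (m p x)⁻¹ := by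
    refine ⟨c⁻¹, fun p x hx => ?_⟩
    rw [norm_inv, ← mul_inv]
    exact inv_anti₀ (mul_pos hc0 (hm p x hx)) (hc p x hx)
  induction r with
  | zero => exact base
  | succ r ih =>
    refine ⟨base, fun i => ?_⟩
    have h1 := ih hg.of_succ
    have his := hgs.inv h0
    have h2 := (hg.2 i).mul (hgs.cDeriv _) (his.mul his) (h1.mul his his h1)
    have h3 := h2.const_mul (-1) ((hgs.cDeriv _).mul (his.mul his))
    refine Sym.mono (fun p x hx => ?_) (h3.congr fun p x hx =>
      (cDeriv_inv (hgs.differentiableAt hx) (h0 p x hx)).symm)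
    have hmx := hm p x hx
    have hJ := s.J_nonneg i p x hx
    refine ⟨by positivity, le_of_eq ?_⟩
    field_simp

/-- A smooth function all of whose derivatives are bounded by powers of a scale that is smaller
than all the `J i` is a symbol. -/
theorem Sym.of_iteratedFDeriv {J₀ : P → E → ℝ} (hJ₀ : ∀ p, ∀ x ∈ s.X p, 0 ≤ J₀ p x)
    (hJ : ∀ i p, ∀ x ∈ s.X p, J₀ p x ≤ s.J i p x) (r : ℕ) :
    ∀ (j : ℕ) (g : P → E → ℂ), (∀ p, ContDiff ℝ ∞ (g p)) →
      (∃ C : ℝ, ∀ p, ∀ x ∈ s.X p, ∀ t ≤ r, ‖iteratedFDeriv ℝ t (g p) x‖ ≤ C * J₀ p x ^ (j + t)) →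
      s.Sym r g (fun p x => J₀ p x ^ j) := by
  have base : ∀ (r j : ℕ) (g : P → E → ℂ),
      (∃ C : ℝ, ∀ p, ∀ x ∈ s.X p, ∀ t ≤ r,
        ‖iteratedFDeriv ℝ t (g p) x‖ ≤ C * J₀ p x ^ (j + t)) →
      ∃ C : ℝ, ∀ p, ∀ x ∈ s.X p, ‖g p x‖ ≤ C * J₀ p x ^ j := by
    rintro r j g ⟨C, hC⟩
    refine ⟨C, fun p x hx => ?_⟩
    have := hC p x hx 0 (Nat.zero_le _)
    rwa [norm_iteratedFDeriv_zero, add_zero] at this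
  induction r with
  | zero =>
    intro j g _ hC
    exact base 0 j g hC
  | succ r ih =>
    intro j g hg hC
    refine ⟨base _ j g hC, fun i => ?_⟩
    obtain ⟨C, hC⟩ := hC
    refine Sym.mono (fun p x hx => ?_) (ih (j + 1) _ (fun p => contDiff_cDeriv (hg p))
      ⟨(‖(s.dir i).1‖ + ‖(s.dir i).2‖) * C, fun p x hx t ht => ?_⟩)
    · have h0 := hJ₀ p x hx
      refine ⟨by positivity, ?_⟩
      rw [pow_succ]
      exact mul_le_mul_of_nonneg_left (hJ i p x hx) (by positivity)
    · refine (norm_iteratedFDeriv_cDeriv_le (hg p) t x).trans ?_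
      rw [mul_assoc]
      refine mul_le_mul_of_nonneg_left ?_ (by positivity)
      have := hC p x hx (t + 1) (by omega)
      rwa [show j + 1 + t = j + (t + 1) by ring]

end SymbolSetting

end Symbols

/-! ### Embeddings of the number field -/

section Embeddings

open scoped Classical

variable {K : Type*} [Field K] [NumberField K] {k n : ℕ} (B : Module.Basis (Fin k) ℚ K)

theorem card_embeddings (B : Module.Basis (Fin k) ℚ K) : Fintype.card (K →+* ℂ) = k := by
  rw [NumberField.Embeddings.card K ℂ, Module.finrank_eq_card_basis B, Fintype.card_fin]

/-- Dedekind's independence of characters: a relation on the basis vectors extends by ℚ-linearity to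
all of K. -/
theorem linearIndependent_embeddings :
    LinearIndependent ℂ fun (σ : K →+* ℂ) (j : Fin k) => σ (B j) := by
  rw [Fintype.linearIndependent_iff]
  intro g hg
  have h1 : ∀ j, ∑ σ, g σ * σ (B j) = 0 := fun j => by
    have := congrFun hg j
    simpa using this
  have h2 : ∀ q : K, ∑ σ : K →+* ℂ, g σ * σ q = 0 := by
    intro q
    rw [← B.sum_repr q]
    simp only [map_sum, Finset.mul_sum]
    rw [Finset.sum_comm]
    refine Finset.sum_eq_zero fun j _ => ?_
    have h3 : ∀ σ : K →+* ℂ, g σ * σ (B.repr q j • B j) = (B.repr q j : ℂ) * (g σ * σ (B j)) := by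
      intro σ
      rw [Algebra.smul_def, map_mul, eq_ratCast, map_ratCast]
      ring
    simp only [h3]
    rw [← Finset.mul_sum, h1, mul_zero]
  have hli := (linearIndependent_monoidHom K ℂ).comp
    (fun σ : K →+* ℂ => (σ : K →* ℂ)) (fun σ τ h => RingHom.ext fun x => DFunLike.congr_fun h x)
  rw [Fintype.linearIndependent_iff] at hli
  refine hli g ?_
  ext q
  simpa using h2 q

/-- Coefficients of the basis dual to the embeddings. -/
theorem exists_dual_coeff : ∃ c : (K →+* ℂ) → Fin k → ℂ,
    ∀ σ τ : K →+* ℂ, ∑ j, c σ j * τ (B j) = if σ = τ then 1 else 0 := by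
  classical
  have hli := linearIndependent_embeddings B
  obtain ⟨L, hL⟩ := LinearMap.exists_leftInverse_of_injective
    (Finsupp.linearCombination ℂ fun (σ : K →+* ℂ) (j : Fin k) => σ (B j))
    (LinearMap.ker_eq_bot.2 hli)
  have h1 : ∀ τ : K →+* ℂ, L (fun j => τ (B j)) = Finsupp.single τ 1 := by
    intro τ
    have := LinearMap.congr_fun hL (Finsupp.single τ 1)
    simpa using this
  refine ⟨fun σ j => L (Pi.single j 1) σ, fun σ τ => ?_⟩
  have h2 := congrArg (fun f => f σ) (h1 τ)
  have h3 : (fun j => τ (B j)) = ∑ j, τ (B j) • (Pi.single j 1 : Fin k → ℂ) := by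
    ext i
    simp [Finset.sum_apply, Pi.single_apply]
  rw [h3, map_sum] at h2
  simp only [map_smul, Finsupp.coe_finsetSum, Finset.sum_apply, Finsupp.smul_apply, smul_eq_mul,
    Finsupp.single_apply] at h2
  simp only [mul_comm _ (τ _)]
  rw [h2]
  simp only [eq_comm]

/-- There are k independent vectors (σ(ω_j))_j in ℂ^k, so they span, and a linear form vanishing on
them is zero. -/
theorem eq_zero_of_sigmaStarStar_eq_zero (y : Fin k → ℝ)
    (h : ∀ σ : K →+* ℂ, sigmaStarStar B σ y = 0) : y = 0 := by
  have hspan := (linearIndependent_embeddings B).span_eq_top_of_card_eq_finrank'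
    (by rw [card_embeddings B]; simp)
  set L : (Fin k → ℂ) →ₗ[ℂ] ℂ := ∑ j, (y j : ℂ) • LinearMap.proj j with hL
  have hL0 : L = 0 := by
    refine LinearMap.ext_on_range hspan fun σ => ?_
    have := h σ
    rw [sigmaStarStar_eq] at this
    simpa [hL] using this
  ext j
  have := LinearMap.congr_fun hL0 (Pi.single j 1)
  simpa [hL, Pi.single_apply] using this

theorem exists_AStarMem (M : realAlg B) : ∃ y, M = AStarMem B y := by
  obtain ⟨y, hy⟩ := M.2
  exact ⟨y, Subtype.ext hy.symm⟩

/-- Both sides are real-linear in M, so it is enough to compare them on the basis, where this is the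
formula for the trace of K over ℚ as a sum of embeddings. -/
theorem trace_eq_sum_sigmaStar (M : realAlg B) :
    ((Matrix.trace (M : Matrix (Fin k) (Fin k) ℝ) : ℝ) : ℂ) = ∑ σ, sigmaStar B σ M := by
  obtain ⟨y, rfl⟩ := exists_AStarMem B M
  have h1 : ∀ σ : K →+* ℂ, sigmaStar B σ (AStarMem B y) = ∑ j, (y j : ℂ) * σ (B j) :=
    fun σ => sigmaStarStar_eq B σ y
  simp only [h1]
  rw [Finset.sum_comm]
  have h2 : Matrix.trace ((AStarMem B y : realAlg B) : Matrix (Fin k) (Fin k) ℝ) =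
      ∑ j, y j * ((Algebra.trace ℚ K (B j) : ℚ) : ℝ) := by
    change Matrix.trace (AStar B y) = _
    rw [AStar, Matrix.trace_sum]
    refine Finset.sum_congr rfl fun j _ => ?_
    rw [Matrix.trace_smul, smul_eq_mul, Algebra.trace_eq_matrix_trace B (B j)]
    congr 1
    simp [Matrix.trace]
  rw [h2]
  push_cast
  refine Finset.sum_congr rfl fun j _ => ?_
  rw [← Finset.mul_sum]
  congr 1
  have h3 := trace_eq_sum_embeddings (K := ℚ) (L := K) ℂ (x := B j)
  rw [eq_ratCast] at h3
  rw [h3]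
  exact Fintype.sum_equiv (RingHom.equivRatAlgHom (R := K) (S := ℂ)).symm _ _ fun _ => rfl

theorem sigmaStarStar_conjugate (σ : K →+* ℂ) (y : Fin k → ℝ) :
    sigmaStarStar B (NumberField.ComplexEmbedding.conjugate σ) y =
      starRingEnd ℂ (sigmaStarStar B σ y) := by
  simp [sigmaStarStar_eq, NumberField.ComplexEmbedding.conjugate_coe_eq]

theorem embPoly_conjugate (σ : K →+* ℂ) (f : MvPolynomial (Fin n) (realAlg B)) :
    embPoly B f (NumberField.ComplexEmbedding.conjugate σ) =
      MvPolynomial.map (starRingEnd ℂ) (embPoly B f σ) := by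
  rw [embPoly, embPoly, MvPolynomial.map_map]
  have : sigmaStar B (NumberField.ComplexEmbedding.conjugate σ) =
      (starRingEnd ℂ).comp (sigmaStar B σ) := by
    refine RingHom.ext fun M => ?_
    obtain ⟨y, rfl⟩ := exists_AStarMem B M
    exact sigmaStarStar_conjugate B σ y
  rw [this]

theorem totalDegree_embPoly_le (σ : K →+* ℂ) (f : MvPolynomial (Fin n) (realAlg B)) :
    (embPoly B f σ).totalDegree ≤ f.totalDegree :=
  Finset.sup_mono (MvPolynomial.support_map_subset _ _)

theorem phase_eq (f : MvPolynomial (Fin n) (realAlg B)) (x : EuclideanSpace ℝ (Fin n × Fin k)) :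
    ((phase B f x : ℝ) : ℂ) = ∑ σ, MvPolynomial.eval (sigmaVec B σ x) (embPoly B f σ) := by
  rw [phase, trace_eq_sum_sigmaStar]
  refine Finset.sum_congr rfl fun σ _ => ?_
  rw [fStar, embPoly, MvPolynomial.eval_map, MvPolynomial.eval, MvPolynomial.coe_eval₂Hom,
    MvPolynomial.hom_eval₂]
  rfl

/-! ### The Taylor coefficients as functions on `ℝ^{kn}` -/

/-- The scaled derivative `∂^α P_{f,σ} / α!` at the point `x`. -/
def coeffAt (f : MvPolynomial (Fin n) (realAlg B)) (σ : K →+* ℂ) (α : Fin n → ℕ)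
    (x : EuclideanSpace ℝ (Fin n × Fin k)) : ℂ :=
  taylorCoeff α (embPoly B f σ) (sigmaVec B σ x)

theorem coeffAt_conjugate (f : MvPolynomial (Fin n) (realAlg B)) (σ : K →+* ℂ) (α : Fin n → ℕ)
    (x : EuclideanSpace ℝ (Fin n × Fin k)) :
    coeffAt B f (NumberField.ComplexEmbedding.conjugate σ) α x =
      starRingEnd ℂ (coeffAt B f σ α x) := by
  rw [coeffAt, coeffAt, embPoly_conjugate, ← taylorCoeff_conj]
  congr 1
  ext l
  exact sigmaStarStar_conjugate B σ _

/-- The `l`-th component of the embedding vector, as a continuous linear map. -/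
def sigmaCoord (σ : K →+* ℂ) (l : Fin n) : EuclideanSpace ℝ (Fin n × Fin k) →L[ℝ] ℂ :=
  ∑ j, (EuclideanSpace.proj (𝕜 := ℝ) (l, j)).smulRight (σ (B j))

theorem sigmaCoord_apply (σ : K →+* ℂ) (l : Fin n) (x : EuclideanSpace ℝ (Fin n × Fin k)) :
    sigmaCoord B σ l x = sigmaVec B σ x l := by
  simp [sigmaCoord, sigmaVec, sigmaStarStar_eq, block]

/-- The complex directions dual to the coordinates `sigmaCoord`. -/
def dualDir (c : (K →+* ℂ) → Fin k → ℂ) (i : (K →+* ℂ) × Fin n) :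
    EuclideanSpace ℝ (Fin n × Fin k) × EuclideanSpace ℝ (Fin n × Fin k) :=
  (WithLp.toLp 2 fun a => if a.1 = i.2 then (c i.1 a.2).re else 0,
    WithLp.toLp 2 fun a => if a.1 = i.2 then (c i.1 a.2).im else 0)

/-- At a complex embedding this is a Wirtinger derivative: the coordinate at σ has derivative 1 and
the one at the conjugate of σ has derivative 0. -/
theorem cDeriv_sigmaCoord {c : (K →+* ℂ) → Fin k → ℂ}
    (hc : ∀ σ τ : K →+* ℂ, ∑ j, c σ j * τ (B j) = if σ = τ then 1 else 0)
    (i : (K →+* ℂ) × Fin n) (τ : K →+* ℂ) (l : Fin n) (x : EuclideanSpace ℝ (Fin n × Fin k)) :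
    cDeriv (dualDir c i) (fun y => sigmaVec B τ y l) x =
      if i.1 = τ ∧ l = i.2 then 1 else 0 := by
  have h1 : (fun y => sigmaVec B τ y l) = sigmaCoord B τ l := by
    ext y
    rw [sigmaCoord_apply]
  rw [h1, cDeriv, ContinuousLinearMap.fderiv, sigmaCoord_apply, sigmaCoord_apply]
  simp only [sigmaVec, sigmaStarStar_eq, block, dualDir]
  by_cases hl : l = i.2
  · simp only [hl, if_true, and_true]
    rw [← hc, Finset.mul_sum, ← Finset.sum_add_distrib]
    refine Finset.sum_congr rfl fun j _ => ?_
    conv_rhs => rw [← Complex.re_add_im (c i.1 j)]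
    ring
  · simp [hl]

theorem contDiff_sigmaVec (σ : K →+* ℂ) (l : Fin n) :
    ContDiff ℝ ∞ fun x : EuclideanSpace ℝ (Fin n × Fin k) => sigmaVec B σ x l := by
  simp only [← sigmaCoord_apply]
  exact (sigmaCoord B σ l).contDiff

theorem contDiff_eval_sigmaVec (σ : K →+* ℂ) (P : MvPolynomial (Fin n) ℂ) :
    ContDiff ℝ ∞ fun x : EuclideanSpace ℝ (Fin n × Fin k) =>
      MvPolynomial.eval (sigmaVec B σ x) P := by
  induction P using MvPolynomial.induction_on with
  | C a => simpa using contDiff_const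
  | add p q hp hq => simpa using hp.add hq
  | mul_X p i hp => simpa using hp.mul (contDiff_sigmaVec B σ i)

theorem contDiff_coeffAt (f : MvPolynomial (Fin n) (realAlg B)) (σ : K →+* ℂ) (α : Fin n → ℕ) :
    ContDiff ℝ ∞ (coeffAt B f σ α) :=
  contDiff_const.mul (contDiff_eval_sigmaVec B σ _)

theorem cDeriv_eval_sigmaVec {c : (K →+* ℂ) → Fin k → ℂ}
    (hc : ∀ σ τ : K →+* ℂ, ∑ j, c σ j * τ (B j) = if σ = τ then 1 else 0)
    (i : (K →+* ℂ) × Fin n) (τ : K →+* ℂ) (P : MvPolynomial (Fin n) ℂ)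
    (x : EuclideanSpace ℝ (Fin n × Fin k)) :
    cDeriv (dualDir c i) (fun y => MvPolynomial.eval (sigmaVec B τ y) P) x =
      if i.1 = τ then MvPolynomial.eval (sigmaVec B τ x) (MvPolynomial.pderiv i.2 P) else 0 := by
  have hd : ∀ Q : MvPolynomial (Fin n) ℂ, DifferentiableAt ℝ
      (fun y : EuclideanSpace ℝ (Fin n × Fin k) => MvPolynomial.eval (sigmaVec B τ y) Q) x :=
    fun Q => ((contDiff_eval_sigmaVec B τ Q).differentiable (by simp)).differentiableAt
  induction P using MvPolynomial.induction_on with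
  | C a => simp [cDeriv_const]
  | add p q hp hq =>
    simp only [map_add]
    rw [cDeriv_add (hd p) (hd q), hp, hq]
    split_ifs <;> simp
  | mul_X p l hp =>
    simp only [map_mul, MvPolynomial.eval_X]
    rw [cDeriv_mul (hd p) (((contDiff_sigmaVec B τ l).differentiable (by simp)).differentiableAt),
      hp, cDeriv_sigmaCoord B hc]
    by_cases h1 : i.1 = τ
    · by_cases h2 : l = i.2
      · subst h2
        simp [h1, Derivation.leibniz]
        ring
      · simp [h1, h2, Derivation.leibniz, MvPolynomial.pderiv_X_of_ne h2]
        ring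
    · simp [h1]

/-- The mechanism behind the symbol estimates: a derivative sees a single embedding and raises |α|
by one, so from |α| ≥ 1 onwards the result is controlled by J. -/
theorem cDeriv_coeffAt {c : (K →+* ℂ) → Fin k → ℂ}
    (hc : ∀ σ τ : K →+* ℂ, ∑ j, c σ j * τ (B j) = if σ = τ then 1 else 0)
    (f : MvPolynomial (Fin n) (realAlg B)) (i : (K →+* ℂ) × Fin n) (τ : K →+* ℂ)
    (α : Fin n → ℕ) (x : EuclideanSpace ℝ (Fin n × Fin k)) :
    cDeriv (dualDir c i) (coeffAt B f τ α) x =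
      if i.1 = τ then ((α i.2 + 1 : ℕ) : ℂ) * coeffAt B f τ (α + Pi.single i.2 1) x else 0 := by
  have h1 : coeffAt B f τ α = fun y => ((∏ i, (α i).factorial : ℕ) : ℂ)⁻¹ *
      MvPolynomial.eval (sigmaVec B τ y) (multiDeriv α (embPoly B f τ)) := rfl
  rw [h1, cDeriv_mul (differentiableAt_const _)
    ((contDiff_eval_sigmaVec B τ _).differentiable (by simp)).differentiableAt, cDeriv_const,
    cDeriv_eval_sigmaVec B hc, zero_mul, zero_add]
  split_ifs
  · rw [coeffAt, taylorCoeff_add_single]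
  · rw [mul_zero]

theorem contDiff_phase (f : MvPolynomial (Fin n) (realAlg B)) :
    ContDiff ℝ ∞ fun x : EuclideanSpace ℝ (Fin n × Fin k) => ((phase B f x : ℝ) : ℂ) := by
  simp only [phase_eq]
  exact ContDiff.sum fun σ _ => contDiff_eval_sigmaVec B σ _

theorem cDeriv_phase {c : (K →+* ℂ) → Fin k → ℂ}
    (hc : ∀ σ τ : K →+* ℂ, ∑ j, c σ j * τ (B j) = if σ = τ then 1 else 0)
    (f : MvPolynomial (Fin n) (realAlg B)) (i : (K →+* ℂ) × Fin n)
    (x : EuclideanSpace ℝ (Fin n × Fin k)) :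
    cDeriv (dualDir c i) (fun y => ((phase B f y : ℝ) : ℂ)) x =
      coeffAt B f i.1 (Pi.single i.2 1) x := by
  classical
  have hsum : ∀ t : Finset (K →+* ℂ), cDeriv (dualDir c i)
      (fun y => ∑ σ ∈ t, MvPolynomial.eval (sigmaVec B σ y) (embPoly B f σ)) x =
      ∑ σ ∈ t, if i.1 = σ then coeffAt B f i.1 (Pi.single i.2 1) x else 0 := by
    intro t
    induction t using Finset.induction_on with
    | empty => simp [cDeriv_const]
    | insert a t ha ih =>
      simp only [Finset.sum_insert ha]
      rw [cDeriv_add ((contDiff_eval_sigmaVec B a _).differentiable (by simp)).differentiableAt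
        ((ContDiff.sum fun σ _ => contDiff_eval_sigmaVec B σ _).differentiable
          (by simp)).differentiableAt, ih, cDeriv_eval_sigmaVec B hc]
      congr 1
      split_ifs with h
      · subst h
        have := taylorCoeff_add_single 0 i.2 (embPoly B f i.1) (sigmaVec B i.1 x)
        rw [zero_add, multiDeriv_zero] at this
        simpa [coeffAt] using this.symm
      · rfl
  simp only [phase_eq]
  rw [hsum]
  simp

end Embeddings

/-! ### The functionals `H` and `J` as finite maxima -/

section Scale

variable {n : ℕ}

/-- Multi-indices of length between `m` and `d`. -/
def multiIndices (n m d : ℕ) : Finset (Fin n → ℕ) :=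
  (Fintype.piFinset fun _ => Finset.range (d + 1)).filter
    fun α => m ≤ ∑ i, α i ∧ ∑ i, α i ≤ d

theorem mem_multiIndices {m d : ℕ} {α : Fin n → ℕ} :
    α ∈ multiIndices n m d ↔ m ≤ ∑ i, α i ∧ ∑ i, α i ≤ d := by
  simp only [multiIndices, Finset.mem_filter, Fintype.mem_piFinset, Finset.mem_range,
    and_iff_right_iff_imp]
  rintro ⟨_, h⟩ i
  have := Finset.single_le_sum (f := α) (fun _ _ => Nat.zero_le _) (Finset.mem_univ i)
  omega

theorem derivSize_eq_sup {m d : ℕ} (hm : 1 ≤ m) {P : MvPolynomial (Fin n) ℂ}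
    (hP : P.totalDegree ≤ d) (z : Fin n → ℂ) :
    derivSize m P z = (multiIndices n m d).sup fun α =>
      ‖taylorCoeff α P z‖ₑ ^ (1 / ((∑ i, α i : ℕ) : ℝ)) := by
  apply le_antisymm
  · refine iSup₂_le fun α hα => ?_
    by_cases h : ∑ i, α i ≤ d
    · exact Finset.le_sup (f := fun α => ‖taylorCoeff α P z‖ₑ ^ (1 / ((∑ i, α i : ℕ) : ℝ)))
        (mem_multiIndices.2 ⟨hα, h⟩)
    · change ‖taylorCoeff α P z‖ₑ ^ (1 / ((∑ i, α i : ℕ) : ℝ)) ≤ _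
      rw [taylorCoeff_eq_zero α P z (by omega), enorm_zero, ENNReal.zero_rpow_of_pos]
      · exact zero_le
      · have : 0 < ∑ i, α i := by omega
        positivity
  · refine Finset.sup_le fun α hα => ?_
    exact le_iSup₂_of_le α (mem_multiIndices.1 hα).1 le_rfl

theorem derivSize_ne_top {m : ℕ} (hm : 1 ≤ m) (P : MvPolynomial (Fin n) ℂ) (z : Fin n → ℂ) :
    derivSize m P z ≠ ⊤ := by
  rw [derivSize_eq_sup hm le_rfl]
  refine ((Finset.sup_lt_iff ENNReal.zero_lt_top).2 fun α _ => ?_).ne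
  exact ENNReal.rpow_lt_top_of_nonneg (by positivity) enorm_ne_top

theorem derivSize_anti {m m' : ℕ} (h : m ≤ m') (P : MvPolynomial (Fin n) ℂ) (z : Fin n → ℂ) :
    derivSize m' P z ≤ derivSize m P z :=
  iSup₂_le fun α hα => le_iSup₂_of_le α (h.trans hα) le_rfl

theorem norm_taylorCoeff_le {m : ℕ} (hm : 1 ≤ m) (P : MvPolynomial (Fin n) ℂ) (z : Fin n → ℂ)
    {α : Fin n → ℕ} (hα : m ≤ ∑ i, α i) :
    ‖taylorCoeff α P z‖ ≤ (derivSize m P z).toReal ^ (∑ i, α i) := by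
  have h0 : 0 < ∑ i, α i := by omega
  have h1 : ‖taylorCoeff α P z‖ₑ ^ (1 / ((∑ i, α i : ℕ) : ℝ)) ≤ derivSize m P z :=
    le_iSup₂_of_le α hα le_rfl
  have h2 : ‖taylorCoeff α P z‖ₑ ≤ derivSize m P z ^ (∑ i, α i) := by
    rw [one_div, ENNReal.rpow_inv_le_iff (by positivity)] at h1
    rwa [ENNReal.rpow_natCast] at h1
  have h3 := ENNReal.toReal_mono (ENNReal.pow_ne_top (derivSize_ne_top hm P z)) h2
  rwa [ENNReal.toReal_pow, toReal_enorm] at h3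

theorem exists_norm_taylorCoeff_eq {m d : ℕ} (hm : 1 ≤ m) {P : MvPolynomial (Fin n) ℂ}
    (hP : P.totalDegree ≤ d) (z : Fin n → ℂ) (h0 : derivSize m P z ≠ 0) :
    ∃ α ∈ multiIndices n m d,
      ‖taylorCoeff α P z‖ = (derivSize m P z).toReal ^ (∑ i, α i) := by
  rw [derivSize_eq_sup hm hP] at h0 ⊢
  have hne : (multiIndices n m d).Nonempty := by
    by_contra h
    rw [Finset.not_nonempty_iff_eq_empty] at h
    simp [h] at h0
  obtain ⟨α, hα, h⟩ := Finset.exists_mem_eq_sup _ hne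
    (fun α => ‖taylorCoeff α P z‖ₑ ^ (1 / ((∑ i, α i : ℕ) : ℝ)))
  refine ⟨α, hα, ?_⟩
  have hpos : 0 < ∑ i, α i := hm.trans (mem_multiIndices.1 hα).1
  rw [h, ← ENNReal.toReal_pow, ← ENNReal.rpow_natCast, ← ENNReal.rpow_mul,
    one_div_mul_cancel (by positivity), ENNReal.rpow_one, toReal_enorm]

variable {K : Type*} [Field K] [NumberField K] {k : ℕ} (B : Module.Basis (Fin k) ℚ K)

/-- The real number `max_{|α| ≥ m} |∂^α P_{f,σ} / α!|^{1/|α|}` at the point `x`. -/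
def scale (m : ℕ) (f : MvPolynomial (Fin n) (realAlg B)) (σ : K →+* ℂ)
    (x : EuclideanSpace ℝ (Fin n × Fin k)) : ℝ :=
  (derivSize m (embPoly B f σ) (sigmaVec B σ x)).toReal

theorem scale_nonneg (m : ℕ) (f : MvPolynomial (Fin n) (realAlg B)) (σ : K →+* ℂ)
    (x : EuclideanSpace ℝ (Fin n × Fin k)) : 0 ≤ scale B m f σ x :=
  ENNReal.toReal_nonneg

theorem scale_two_le_one (f : MvPolynomial (Fin n) (realAlg B)) (σ : K →+* ℂ)
    (x : EuclideanSpace ℝ (Fin n × Fin k)) : scale B 2 f σ x ≤ scale B 1 f σ x :=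
  ENNReal.toReal_mono (derivSize_ne_top le_rfl _ _) (derivSize_anti (by norm_num) _ _)

theorem ofReal_scale {m : ℕ} (hm : 1 ≤ m) (f : MvPolynomial (Fin n) (realAlg B)) (σ : K →+* ℂ)
    (x : EuclideanSpace ℝ (Fin n × Fin k)) :
    ENNReal.ofReal (scale B m f σ x) = derivSize m (embPoly B f σ) (sigmaVec B σ x) :=
  ENNReal.ofReal_toReal (derivSize_ne_top hm _ _)

theorem norm_coeffAt_le {m : ℕ} (hm : 1 ≤ m) (f : MvPolynomial (Fin n) (realAlg B))
    (σ : K →+* ℂ) (x : EuclideanSpace ℝ (Fin n × Fin k)) {α : Fin n → ℕ}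
    (hα : m ≤ ∑ i, α i) : ‖coeffAt B f σ α x‖ ≤ scale B m f σ x ^ (∑ i, α i) :=
  norm_taylorCoeff_le hm _ _ hα

theorem exists_norm_coeffAt_eq {m d : ℕ} (hm : 1 ≤ m) {f : MvPolynomial (Fin n) (realAlg B)}
    (hf : f.totalDegree ≤ d) (σ : K →+* ℂ) (x : EuclideanSpace ℝ (Fin n × Fin k))
    (h0 : 0 < scale B m f σ x) :
    ∃ α ∈ multiIndices n m d, ‖coeffAt B f σ α x‖ = scale B m f σ x ^ (∑ i, α i) := by
  refine exists_norm_taylorCoeff_eq hm ((totalDegree_embPoly_le B σ f).trans hf) _ fun h => ?_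
  rw [scale, h] at h0
  simp at h0

theorem derivSize_conjugate (m : ℕ) (f : MvPolynomial (Fin n) (realAlg B)) (σ : K →+* ℂ)
    (x : EuclideanSpace ℝ (Fin n × Fin k)) :
    derivSize m (embPoly B f (NumberField.ComplexEmbedding.conjugate σ))
      (sigmaVec B (NumberField.ComplexEmbedding.conjugate σ) x) =
    derivSize m (embPoly B f σ) (sigmaVec B σ x) := by
  refine iSup_congr fun α => iSup_congr fun _ => ?_
  have h := congrArg (fun z => ‖z‖ₑ) (coeffAt_conjugate B f σ α x)
  have h2 : ‖starRingEnd ℂ (coeffAt B f σ α x)‖ₑ = ‖coeffAt B f σ α x‖ₑ := by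
    simp [enorm_eq_nnnorm]
  simp only [h2] at h
  exact congrArg (fun y => y ^ (1 / ((∑ i, α i : ℕ) : ℝ))) h

theorem scale_conjugate (m : ℕ) (f : MvPolynomial (Fin n) (realAlg B)) (σ : K →+* ℂ)
    (x : EuclideanSpace ℝ (Fin n × Fin k)) :
    scale B m f (NumberField.ComplexEmbedding.conjugate σ) x = scale B m f σ x :=
  congrArg ENNReal.toReal (derivSize_conjugate B m f σ x)

end Scale

/-! ### Integration by parts -/

section IBP

open scoped Classical
open NumberField.ComplexEmbedding (conjugate)
open SymbolSetting

variable {K : Type*} [Field K] [NumberField K] {k n : ℕ}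

/-- A phase and an amplitude as in the theorem, with nonzero amplitude. -/
structure OscData (B : Module.Basis (Fin k) ℚ K) (n d : ℕ) (R : ℝ≥0) (S : Finset (K →+* ℂ)) where
  f : MvPolynomial (Fin n) (realAlg B)
  ψ : EuclideanSpace ℝ (Fin n × Fin k) → ℂ
  degree_le : f.totalDegree ≤ d
  contDiff : ContDiff ℝ ∞ ψ
  tsupport_subset : tsupport ψ ⊆ Metric.closedBall 0 1
  ne_zero : ψ ≠ 0
  le_pow : ∀ t ≤ 4 * k, ∀ σ ∈ S, ∀ x ∈ tsupport ψ,
    (R : ℝ≥0∞) * cNorm t ψ ≤ JPoint B f σ x ^ t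

theorem sum_eq_one_iff {α : Fin n → ℕ} : ∑ i, α i = 1 ↔ ∃ l, α = Pi.single l 1 := by
  constructor
  · intro h
    obtain ⟨l, hl⟩ : ∃ l, α l ≠ 0 := by
      by_contra! h0
      simp [h0] at h
    refine ⟨l, ?_⟩
    rw [← Finset.add_sum_erase _ _ (Finset.mem_univ l)] at h
    have h1 : ∑ i ∈ Finset.univ.erase l, α i = 0 := by omega
    ext i
    rcases eq_or_ne i l with rfl | hi
    · simp only [Pi.single_eq_same]
      omega
    · rw [Pi.single_eq_of_ne hi]
      exact (Finset.sum_eq_zero_iff.1 h1) i (Finset.mem_erase.2 ⟨hi, Finset.mem_univ i⟩)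
  · rintro ⟨l, rfl⟩
    simp

/-! ### Smooth weights comparable with powers of J and H -/

section Weights

variable (B : Module.Basis (Fin k) ℚ K) (d : ℕ) (f : MvPolynomial (Fin n) (realAlg B))
  (σ : K →+* ℂ)

/-- A polynomial substitute for the power `2 d!` of the functional `J`. -/
def weightJ (x : EuclideanSpace ℝ (Fin n × Fin k)) : ℂ :=
  ∑ α ∈ multiIndices n 2 d,
    (coeffAt B f σ α x * coeffAt B f (conjugate σ) α x) ^ (d.factorial / ∑ i, α i)

/-- The gradient part of `weightH`. -/
def weightGrad (x : EuclideanSpace ℝ (Fin n × Fin k)) : ℂ :=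
  ∑ l, (coeffAt B f σ (Pi.single l 1) x * coeffAt B f (conjugate σ) (Pi.single l 1) x) ^
    d.factorial

/-- A polynomial substitute for the power `2 d!` of the functional `H`. -/
def weightH (x : EuclideanSpace ℝ (Fin n × Fin k)) : ℂ :=
  weightJ B d f σ x + weightGrad B d f σ x

theorem coeffAt_mul_conjugate (α : Fin n → ℕ) (x : EuclideanSpace ℝ (Fin n × Fin k)) :
    coeffAt B f σ α x * coeffAt B f (conjugate σ) α x = ((‖coeffAt B f σ α x‖ ^ 2 : ℝ) : ℂ) := by
  rw [coeffAt_conjugate, Complex.mul_conj']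
  push_cast
  rfl

/-- Coefficients at σ and at its conjugate multiply to squared absolute values, so every summand is
nonnegative. The one attaining the maximum in H equals H^{2 d!}, since |α| divides d! for 1 ≤ |α| ≤
d. -/
theorem pow_scale_le_norm_weightH (hf : f.totalDegree ≤ d)
    (x : EuclideanSpace ℝ (Fin n × Fin k)) :
    scale B 1 f σ x ^ (2 * d.factorial) ≤ ‖weightH B d f σ x‖ := by
  have hnn : ∀ (α : Fin n → ℕ) (j : ℕ), 0 ≤ (‖coeffAt B f σ α x‖ ^ 2) ^ j := fun α j => by
    positivity
  have h1 : weightH B d f σ x =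
      ((∑ α ∈ multiIndices n 2 d, (‖coeffAt B f σ α x‖ ^ 2) ^ (d.factorial / ∑ i, α i) +
        ∑ l, (‖coeffAt B f σ (Pi.single l 1) x‖ ^ 2) ^ d.factorial : ℝ) : ℂ) := by
    simp only [weightH, weightJ, weightGrad, coeffAt_mul_conjugate]
    push_cast
    rfl
  have hs1 : 0 ≤ ∑ α ∈ multiIndices n 2 d,
      (‖coeffAt B f σ α x‖ ^ 2) ^ (d.factorial / ∑ i, α i) :=
    Finset.sum_nonneg fun α _ => hnn α _
  have hs2 : 0 ≤ ∑ l, (‖coeffAt B f σ (Pi.single l 1) x‖ ^ 2) ^ d.factorial :=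
    Finset.sum_nonneg fun l _ => hnn _ _
  rw [h1, Complex.norm_real, Real.norm_of_nonneg (add_nonneg hs1 hs2)]
  rcases (scale_nonneg B 1 f σ x).eq_or_lt with h0 | h0
  · rw [← h0, zero_pow (by positivity)]
    exact add_nonneg hs1 hs2
  obtain ⟨α, hα, hαx⟩ := exists_norm_coeffAt_eq B le_rfl hf σ x h0
  rw [mem_multiIndices] at hα
  by_cases h2 : ∑ i, α i = 1
  · obtain ⟨l, rfl⟩ := sum_eq_one_iff.1 h2
    rw [h2, pow_one] at hαx
    rw [← hαx, pow_mul]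
    refine le_add_of_nonneg_of_le hs1 ?_
    exact Finset.single_le_sum
      (f := fun l => (‖coeffAt B f σ (Pi.single l 1) x‖ ^ 2) ^ d.factorial)
      (fun l _ => hnn _ _) (Finset.mem_univ l)
  · have hα2 : α ∈ multiIndices n 2 d := mem_multiIndices.2 ⟨by omega, hα.2⟩
    refine le_add_of_le_of_nonneg ?_ hs2
    have h3 : (‖coeffAt B f σ α x‖ ^ 2) ^ (d.factorial / ∑ i, α i) =
        scale B 1 f σ x ^ (2 * d.factorial) := by
      rw [hαx, ← pow_mul, ← pow_mul]
      congr 1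
      have : (∑ i, α i) * (d.factorial / ∑ i, α i) = d.factorial :=
        Nat.mul_div_cancel' (Nat.dvd_factorial (by omega) hα.2)
      rw [mul_left_comm, this]
    rw [← h3]
    exact Finset.single_le_sum
      (f := fun α => (‖coeffAt B f σ α x‖ ^ 2) ^ (d.factorial / ∑ i, α i))
      (fun α _ => hnn _ _) hα2

theorem contDiff_weightJ : ContDiff ℝ ∞ (weightJ B d f σ) :=
  ContDiff.sum fun α _ => ((contDiff_coeffAt B f σ α).mul
    (contDiff_coeffAt B f (conjugate σ) α)).pow _

theorem contDiff_weightGrad : ContDiff ℝ ∞ (weightGrad B d f σ) :=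
  ContDiff.sum fun _ _ => ((contDiff_coeffAt B f σ _).mul
    (contDiff_coeffAt B f (conjugate σ) _)).pow _

theorem contDiff_weightH : ContDiff ℝ ∞ (weightH B d f σ) :=
  (contDiff_weightJ B d f σ).add (contDiff_weightGrad B d f σ)

end Weights

variable {B : Module.Basis (Fin k) ℚ K} {d : ℕ} {R : ℝ≥0} {S : Finset (K →+* ℂ)}

theorem OscData.scale_two_pos (hR : 0 < R) (p : OscData B n d R S) {σ : K →+* ℂ} (hσ : σ ∈ S)
    {x : EuclideanSpace ℝ (Fin n × Fin k)} (hx : x ∈ tsupport p.ψ) : 0 < scale B 2 p.f σ x := by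
  have hk : 0 < k := by
    rw [← card_embeddings B]
    exact Fintype.card_pos_iff.2 ⟨σ⟩
  refine (scale_nonneg B 2 p.f σ x).lt_of_ne fun h => p.ne_zero ?_
  have h1 : JPoint B p.f σ x = 0 := by
    change derivSize 2 _ _ = 0
    rw [← ofReal_scale B (by norm_num), ← h, ENNReal.ofReal_zero]
  -- The case t = 0 carries no information because J^0 = 1; t = 1 is available since k > 0, and J =
  -- 0 would make the C^1 norm of ψ vanish.
  have h2 := p.le_pow 1 (by omega) σ hσ x hx
  rw [h1, pow_one, nonpos_iff_eq_zero, mul_eq_zero] at h2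
  have h3 : cNorm 1 p.ψ = 0 := h2.resolve_left (by simpa using hR.ne')
  ext y
  have h4 : ‖iteratedFDeriv ℝ 0 p.ψ y‖ₑ ≤ 0 := by
    rw [← h3]
    exact le_iSup₂_of_le 0 (Nat.zero_le _) (le_iSup (fun y => ‖iteratedFDeriv ℝ 0 p.ψ y‖ₑ) y)
  rw [nonpos_iff_eq_zero, enorm_eq_zero] at h4
  have h5 := norm_iteratedFDeriv_zero (𝕜 := ℝ) (f := p.ψ) (x := y)
  rw [h4, norm_zero] at h5
  simpa using h5.symm

theorem OscData.scale_one_pos (hR : 0 < R) (p : OscData B n d R S) {σ : K →+* ℂ} (hσ : σ ∈ S)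
    {x : EuclideanSpace ℝ (Fin n × Fin k)} (hx : x ∈ tsupport p.ψ) : 0 < scale B 1 p.f σ x :=
  (p.scale_two_pos hR hσ hx).trans_le (scale_two_le_one B p.f σ x)

variable (B n d S) in
/-- The symbol calculus attached to the scales `1 / J_{f,σ}`. -/
def oscSetting (hR : 0 < R) (c : (K →+* ℂ) → Fin k → ℂ) :
    SymbolSetting (EuclideanSpace ℝ (Fin n × Fin k)) (OscData B n d R S) (S × Fin n) where
  X p := tsupport p.ψ
  U p := {x | ∀ σ : S, weightH B d p.f σ x ≠ 0}
  isOpen_U p := by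
    simp only [Set.ofPred_forall]
    exact isOpen_iInter_of_finite fun σ =>
      isOpen_ne_fun (contDiff_weightH B d p.f σ).continuous continuous_const
  X_subset p x hx σ h := by
    have h1 := pow_scale_le_norm_weightH B d p.f σ p.degree_le x
    rw [h, norm_zero] at h1
    have := pow_pos (p.scale_one_pos hR σ.2 hx) (2 * d.factorial)
    linarith
  dir i := dualDir c (i.1, i.2)
  J i p x := scale B 2 p.f i.1 x
  J_nonneg i p x _ := scale_nonneg B 2 p.f i.1 x

/-! ### Symbol estimates for Taylor coefficients, weights and their inverses -/

variable {hR : 0 < R} {c : (K →+* ℂ) → Fin k → ℂ}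

theorem smooth_coeffAt (σ : K →+* ℂ) (α : Fin n → ℕ) :
    (oscSetting n B d S hR c).Smooth fun p => coeffAt B p.f σ α :=
  fun p => (contDiff_coeffAt B p.f σ α).contDiffOn

theorem sym_coeffAt_two
    (hc : ∀ σ τ : K →+* ℂ, ∑ j, c σ j * τ (B j) = if σ = τ then 1 else 0)
    (σ : K →+* ℂ) (r : ℕ) : ∀ α : Fin n → ℕ, 2 ≤ ∑ i, α i →
    (oscSetting n B d S hR c).Sym r (fun p => coeffAt B p.f σ α)
      (fun p x => scale B 2 p.f σ x ^ ∑ i, α i) := by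
  induction r with
  | zero => exact fun α hα => ⟨1, fun p x _ => by
      rw [one_mul]
      exact norm_coeffAt_le B (by norm_num) p.f σ x hα⟩
  | succ r ih =>
    refine fun α hα => ⟨⟨1, fun p x _ => by
      rw [one_mul]
      exact norm_coeffAt_le B (by norm_num) p.f σ x hα⟩, fun i => ?_⟩
    by_cases hi : (i.1 : K →+* ℂ) = σ
    · have h1 := (ih (α + Pi.single i.2 1) (by rw [sum_add_single]; omega)).const_mul
        ((α i.2 + 1 : ℕ) : ℂ) (smooth_coeffAt σ _)
      rw [sum_add_single] at h1
      have e1 : (fun (p : OscData B n d R S) x => scale B 2 p.f σ x ^ (∑ i, α i + 1)) =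
          fun p x => scale B 2 p.f σ x ^ (∑ i, α i) * scale B 2 p.f i.1 x := by
        ext p x
        rw [hi, pow_succ]
      rw [e1] at h1
      refine h1.congr fun p x _ => ?_
      exact ((cDeriv_coeffAt B hc p.f (i.1, i.2) σ α x).trans (if_pos hi)).symm
    · refine Sym.zero.congr fun p x _ => ?_
      exact ((cDeriv_coeffAt B hc p.f (i.1, i.2) σ α x).trans (if_neg hi)).symm

/-- A first-order coefficient has size H, but its derivatives are coefficients of order at least 2.
Each derivative therefore costs J, and only the undifferentiated size involves H. -/
theorem sym_coeffAt_one
    (hc : ∀ σ τ : K →+* ℂ, ∑ j, c σ j * τ (B j) = if σ = τ then 1 else 0)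
    (σ : K →+* ℂ) (r : ℕ) (α : Fin n → ℕ) (hα : 1 ≤ ∑ i, α i) :
    (oscSetting n B d S hR c).Sym r (fun p => coeffAt B p.f σ α)
      (fun p x => scale B 1 p.f σ x ^ ∑ i, α i) := by
  by_cases h2 : 2 ≤ ∑ i, α i
  · refine (sym_coeffAt_two hc σ r α h2).mono fun p x _ => ?_
    have h0 := scale_nonneg B 2 p.f σ x
    exact ⟨by positivity, pow_le_pow_left₀ h0 (scale_two_le_one B p.f σ x) _⟩
  have base : ∃ C : ℝ, ∀ p : OscData B n d R S, ∀ x ∈ tsupport p.ψ,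
      ‖coeffAt B p.f σ α x‖ ≤ C * scale B 1 p.f σ x ^ ∑ i, α i :=
    ⟨1, fun p x _ => by
      rw [one_mul]
      exact norm_coeffAt_le B le_rfl p.f σ x hα⟩
  cases r with
  | zero => exact base
  | succ r =>
    refine ⟨base, fun i => ?_⟩
    by_cases hi : (i.1 : K →+* ℂ) = σ
    · have h1 := (sym_coeffAt_two (d := d) (S := S) (hR := hR) hc σ r (α + Pi.single i.2 1)
        (by rw [sum_add_single]; omega)).const_mul ((α i.2 + 1 : ℕ) : ℂ) (smooth_coeffAt σ _)
      refine Sym.mono (fun p x _ => ?_) (h1.congr fun p x _ =>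
        ((cDeriv_coeffAt B hc p.f (i.1, i.2) σ α x).trans (if_pos hi)).symm)
      have h0 := scale_nonneg B 2 p.f σ x
      refine ⟨by positivity, ?_⟩
      change _ ≤ _ * scale B 2 p.f i.1 x
      rw [sum_add_single, hi, pow_succ]
      exact mul_le_mul_of_nonneg_right
        (pow_le_pow_left₀ h0 (scale_two_le_one B p.f σ x) _) h0
    · refine Sym.zero.congr fun p x _ => ?_
      exact ((cDeriv_coeffAt B hc p.f (i.1, i.2) σ α x).trans (if_neg hi)).symm

theorem smooth_weightJ (σ : K →+* ℂ) :
    (oscSetting n B d S hR c).Smooth fun p => weightJ B d p.f σ :=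
  fun p => (contDiff_weightJ B d p.f σ).contDiffOn

theorem smooth_weightGrad (σ : K →+* ℂ) :
    (oscSetting n B d S hR c).Smooth fun p => weightGrad B d p.f σ :=
  fun p => (contDiff_weightGrad B d p.f σ).contDiffOn

theorem smooth_weightH (σ : K →+* ℂ) :
    (oscSetting n B d S hR c).Smooth fun p => weightH B d p.f σ :=
  fun p => (contDiff_weightH B d p.f σ).contDiffOn

/-- The exponents d!/|α| bring all the summands to the common weight J^{2 d!}. -/
theorem sym_weightJ
    (hc : ∀ σ τ : K →+* ℂ, ∑ j, c σ j * τ (B j) = if σ = τ then 1 else 0)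
    (σ : K →+* ℂ) (r : ℕ) :
    (oscSetting n B d S hR c).Sym r (fun p => weightJ B d p.f σ)
      (fun p x => scale B 2 p.f σ x ^ (2 * d.factorial)) := by
  refine Sym.sum _ (fun α _ => ((smooth_coeffAt σ α).mul
    (smooth_coeffAt (conjugate σ) α)).pow _) fun α hα => ?_
  rw [mem_multiIndices] at hα
  have h1 := ((sym_coeffAt_two (d := d) (S := S) (hR := hR) hc σ r α hα.1).mul
    (smooth_coeffAt σ α) (smooth_coeffAt _ α)
    (sym_coeffAt_two hc (conjugate σ) r α hα.1)).pow
      ((smooth_coeffAt σ α).mul (smooth_coeffAt (conjugate σ) α))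
      (d.factorial / ∑ i, α i)
  refine h1.mono fun p x _ => ?_
  have h0 := scale_nonneg B 2 p.f σ x
  rw [scale_conjugate]
  refine ⟨by positivity, le_of_eq ?_⟩
  have : (∑ i, α i) * (d.factorial / ∑ i, α i) = d.factorial :=
    Nat.mul_div_cancel' (Nat.dvd_factorial (by omega) hα.2)
  rw [← pow_add, ← pow_mul, ← two_mul, mul_assoc, this]

theorem sym_weightGrad
    (hc : ∀ σ τ : K →+* ℂ, ∑ j, c σ j * τ (B j) = if σ = τ then 1 else 0)
    (σ : K →+* ℂ) (r : ℕ) :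
    (oscSetting n B d S hR c).Sym r (fun p => weightGrad B d p.f σ)
      (fun p x => scale B 1 p.f σ x ^ (2 * d.factorial)) := by
  refine Sym.sum _ (fun l _ => ((smooth_coeffAt σ _).mul
    (smooth_coeffAt (conjugate σ) _)).pow _) fun l _ => ?_
  have hl : ∑ i, (Pi.single l 1 : Fin n → ℕ) i = 1 := sum_eq_one_iff.2 ⟨l, rfl⟩
  have h1 := ((sym_coeffAt_one (d := d) (S := S) (hR := hR) hc σ r (Pi.single l 1) hl.ge).mul
    (smooth_coeffAt σ _) (smooth_coeffAt _ _)
    (sym_coeffAt_one hc (conjugate σ) r (Pi.single l 1) hl.ge)).pow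
      ((smooth_coeffAt σ _).mul (smooth_coeffAt (conjugate σ) _)) d.factorial
  refine h1.mono fun p x _ => ?_
  have h0 := scale_nonneg B 1 p.f σ x
  rw [scale_conjugate, hl]
  refine ⟨by positivity, le_of_eq ?_⟩
  ring

theorem sym_weightH
    (hc : ∀ σ τ : K →+* ℂ, ∑ j, c σ j * τ (B j) = if σ = τ then 1 else 0)
    (σ : K →+* ℂ) (r : ℕ) :
    (oscSetting n B d S hR c).Sym r (fun p => weightH B d p.f σ)
      (fun p x => scale B 1 p.f σ x ^ (2 * d.factorial)) := by
  refine Sym.add (smooth_weightJ σ) (smooth_weightGrad σ)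
    ((sym_weightJ hc σ r).mono fun p x _ => ?_) (sym_weightGrad hc σ r)
  have h0 := scale_nonneg B 2 p.f σ x
  exact ⟨by positivity, pow_le_pow_left₀ h0 (scale_two_le_one B p.f σ x) _⟩

theorem smooth_inv_weightH (σ : S) :
    (oscSetting n B d S hR c).Smooth fun p x => (weightH B d p.f σ x)⁻¹ :=
  (smooth_weightH (σ : K →+* ℂ)).inv fun _ _ hx => hx σ

theorem sym_inv_weightH
    (hc : ∀ σ τ : K →+* ℂ, ∑ j, c σ j * τ (B j) = if σ = τ then 1 else 0)
    (σ : S) (r : ℕ) :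
    (oscSetting n B d S hR c).Sym r (fun p x => (weightH B d p.f σ x)⁻¹)
      (fun p x => (scale B 1 p.f σ x ^ (2 * d.factorial))⁻¹) :=
  (sym_weightH hc (σ : K →+* ℂ) r).inv (smooth_weightH (σ : K →+* ℂ)) (fun _ _ hx => hx σ)
    (fun p _ hx => pow_pos (p.scale_one_pos hR σ.2 hx) _)
    ⟨1, one_pos, fun p x _ => by
      rw [one_mul]
      exact pow_scale_le_norm_weightH B d p.f σ p.degree_le x⟩

/-! The two coefficients of the integration by parts operator. -/

variable (B d) in
/-- The zeroth order coefficient. -/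
def stayCoeff (σ : K →+* ℂ) (f : MvPolynomial (Fin n) (realAlg B))
    (x : EuclideanSpace ℝ (Fin n × Fin k)) : ℂ :=
  weightJ B d f σ x * (weightH B d f σ x)⁻¹

variable (B d) in
/-- The first order coefficients. -/
def moveCoeff (σ : K →+* ℂ) (l : Fin n) (f : MvPolynomial (Fin n) (realAlg B))
    (x : EuclideanSpace ℝ (Fin n × Fin k)) : ℂ :=
  (2 * Real.pi * Complex.I)⁻¹ * (coeffAt B f σ (Pi.single l 1) x ^ (d.factorial - 1) *
    coeffAt B f (conjugate σ) (Pi.single l 1) x ^ d.factorial * (weightH B d f σ x)⁻¹)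

theorem smooth_stayCoeff (σ : S) :
    (oscSetting n B d S hR c).Smooth fun p => stayCoeff B d σ p.f :=
  (smooth_weightJ (σ : K →+* ℂ)).mul (smooth_inv_weightH σ)

theorem smooth_moveCoeff (σ : S) (l : Fin n) :
    (oscSetting n B d S hR c).Smooth fun p => moveCoeff B d σ l p.f :=
  (Smooth.const _).mul ((((smooth_coeffAt _ _).pow _).mul ((smooth_coeffAt _ _).pow _)).mul
    (smooth_inv_weightH σ))

theorem sym_stayCoeff
    (hc : ∀ σ τ : K →+* ℂ, ∑ j, c σ j * τ (B j) = if σ = τ then 1 else 0)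
    (σ : S) (r : ℕ) :
    (oscSetting n B d S hR c).Sym r (fun p => stayCoeff B d σ p.f)
      (fun p x => scale B 2 p.f σ x / scale B 1 p.f σ x) := by
  refine Sym.mono (fun p x hx => ?_) ((sym_weightJ hc (σ : K →+* ℂ) r).mul
    (smooth_weightJ (σ : K →+* ℂ)) (smooth_inv_weightH σ) (sym_inv_weightH hc σ r))
  have h1 := p.scale_one_pos hR σ.2 hx
  have h2 := p.scale_two_pos hR σ.2 hx
  refine ⟨by positivity, ?_⟩
  rw [← div_eq_mul_inv, ← div_pow]
  -- The available factor is (J/H)^{2 d!}; only one power of J/H is kept, to match the gain of the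
  -- first-order terms.
  refine pow_le_of_le_one (by positivity) ((div_le_one h1).2 (scale_two_le_one B p.f σ x)) ?_
  positivity

theorem sym_moveCoeff
    (hc : ∀ σ τ : K →+* ℂ, ∑ j, c σ j * τ (B j) = if σ = τ then 1 else 0)
    (σ : S) (l : Fin n) (r : ℕ) :
    (oscSetting n B d S hR c).Sym r (fun p => moveCoeff B d σ l p.f)
      (fun p x => (scale B 1 p.f σ x)⁻¹) := by
  have hl : ∑ i, (Pi.single l 1 : Fin n → ℕ) i = 1 := sum_eq_one_iff.2 ⟨l, rfl⟩
  have s1 : (oscSetting n B d S hR c).Smooth fun p => coeffAt B p.f σ (Pi.single l 1) :=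
    smooth_coeffAt _ _
  have s2 : (oscSetting n B d S hR c).Smooth
      fun p => coeffAt B p.f (conjugate σ) (Pi.single l 1) := smooth_coeffAt _ _
  have h1 := (sym_coeffAt_one (d := d) (S := S) (hR := hR) hc σ r (Pi.single l 1) hl.ge).pow s1
    (d.factorial - 1)
  have h2 := (sym_coeffAt_one (d := d) (S := S) (hR := hR) hc (conjugate σ) r
    (Pi.single l 1) hl.ge).pow s2 d.factorial
  have h3 := ((h1.mul (s1.pow _) (s2.pow _) h2).mul ((s1.pow _).mul (s2.pow _))
    (smooth_inv_weightH σ) (sym_inv_weightH hc σ r)).const_mul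
      ((2 * Real.pi * Complex.I)⁻¹) (((s1.pow _).mul (s2.pow _)).mul (smooth_inv_weightH σ))
  refine Sym.mono (fun p x hx => ?_) h3
  have hp := p.scale_one_pos hR σ.2 hx
  rw [scale_conjugate, hl, pow_one]
  refine ⟨by positivity, le_of_eq ?_⟩
  -- Truncated subtraction is harmless as d! ≥ 1. The weight is then H^{d!-1} H^{d!} H^{-2 d!} =
  -- 1/H, one factor short because a gradient component was spent on the exponential.
  obtain ⟨j, hj⟩ : ∃ j, d.factorial = j + 1 := ⟨d.factorial - 1, by
    have := d.factorial_pos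
    omega⟩
  rw [hj, Nat.add_sub_cancel]
  field_simp
  ring

/-! ### The integration by parts operator and its iteration -/

theorem contDiff_mul_of_tsupport_subset {E : Type*} [NormedAddCommGroup E] [NormedSpace ℝ E]
    {U : Set E} (hU : IsOpen U) {g h : E → ℂ} (hg : ContDiffOn ℝ ∞ g U) (hh : ContDiff ℝ ∞ h)
    (hsupp : tsupport h ⊆ U) : ContDiff ℝ ∞ fun x => g x * h x := by
  rw [contDiff_iff_contDiffAt]
  intro x
  by_cases hx : x ∈ tsupport h
  · exact (hg.contDiffAt (hU.mem_nhds (hsupp hx))).mul hh.contDiffAt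
  · have h0 : (fun x => g x * h x) =ᶠ[nhds x] fun _ => 0 := by
      filter_upwards [(isClosed_tsupport h).isOpen_compl.mem_nhds hx] with y hy
      rw [image_eq_zero_of_notMem_tsupport hy, mul_zero]
    exact contDiffAt_const.congr_of_eventuallyEq h0

theorem tsupport_mul_subset_right' {E : Type*} [TopologicalSpace E] {g h : E → ℂ} :
    tsupport (fun x => g x * h x) ⊆ tsupport h :=
  closure_mono fun x hx h0 => hx (by simp [h0])

/-- A family of amplitudes with the same integrals as the original ones. -/
structure IsAmplitude (Ψ : OscData B n d R S → EuclideanSpace ℝ (Fin n × Fin k) → ℂ) : Prop where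
  contDiff : ∀ p, ContDiff ℝ ∞ (Ψ p)
  tsupport_subset : ∀ p, tsupport (Ψ p) ⊆ tsupport p.ψ
  integral_eq : ∀ p, oscIntegral B p.f (Ψ p) = oscIntegral B p.f p.ψ

variable (B d) in
/-- One integration by parts at the embedding `σ`. -/
def ibpStep (c : (K →+* ℂ) → Fin k → ℂ) (σ : K →+* ℂ) (f : MvPolynomial (Fin n) (realAlg B))
    (Ψ : EuclideanSpace ℝ (Fin n × Fin k) → ℂ) (x : EuclideanSpace ℝ (Fin n × Fin k)) : ℂ :=
  stayCoeff B d σ f x * Ψ x +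
    ∑ l, -1 * cDeriv (dualDir c (σ, l)) (fun y => moveCoeff B d σ l f y * Ψ y) x

/-- The integral is unchanged because the amplitude splits as (Q_J/Q + Q_∇/Q)Ψ, and in each term of
Q_∇ one gradient component times the exponential is a derivative of the exponential. The quotients
are smooth near the support of Ψ, where `weightH` does not vanish. -/
theorem IsAmplitude.ibpStep (hR : 0 < R)
    (hc : ∀ σ τ : K →+* ℂ, ∑ j, c σ j * τ (B j) = if σ = τ then 1 else 0) (σ : S)
    {Ψ : OscData B n d R S → EuclideanSpace ℝ (Fin n × Fin k) → ℂ} (hΨ : IsAmplitude Ψ) :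
    IsAmplitude fun p => ibpStep B d c σ p.f (Ψ p) := by
  have hsub : ∀ p : OscData B n d R S, tsupport (Ψ p) ⊆ (oscSetting n B d S hR c).U p :=
    fun p => (hΨ.tsupport_subset p).trans ((oscSetting n B d S hR c).X_subset p)
  have hstay : ∀ p, ContDiff ℝ ∞ fun x => stayCoeff B d σ p.f x * Ψ p x := fun p =>
    contDiff_mul_of_tsupport_subset ((oscSetting n B d S hR c).isOpen_U p)
      (smooth_stayCoeff (hR := hR) (c := c) σ p) (hΨ.contDiff p) (hsub p)
  have hmove : ∀ l p, ContDiff ℝ ∞ fun x => moveCoeff B d σ l p.f x * Ψ p x := fun l p =>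
    contDiff_mul_of_tsupport_subset ((oscSetting n B d S hR c).isOpen_U p)
      (smooth_moveCoeff (hR := hR) (c := c) σ l p) (hΨ.contDiff p) (hsub p)
  refine ⟨fun p => ?_, fun p => ?_, fun p => ?_⟩
  · exact (hstay p).add (ContDiff.sum fun l _ =>
      contDiff_const.mul (contDiff_cDeriv (hmove l p)))
  · refine closure_minimal (fun x hx => ?_) (isClosed_tsupport _)
    by_contra h
    apply hx
    have h1 : x ∉ tsupport (Ψ p) := fun h2 => h (hΨ.tsupport_subset p h2)
    have h2 : ∀ l, cDeriv (dualDir c ((σ : K →+* ℂ), l))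
        (fun y => moveCoeff B d σ l p.f y * Ψ p y) x = 0 := fun l =>
      image_eq_zero_of_notMem_tsupport fun h3 =>
        h1 (tsupport_mul_subset_right' (tsupport_cDeriv_subset h3))
    simp [NFOsc.ibpStep, h2, image_eq_zero_of_notMem_tsupport h1]
  · rw [← hΨ.integral_eq p]
    have hcs : HasCompactSupport (Ψ p) :=
      (isCompact_closedBall _ _).of_isClosed_subset (isClosed_tsupport _)
        ((hΨ.tsupport_subset p).trans p.tsupport_subset)
    set e : EuclideanSpace ℝ (Fin n × Fin k) → ℂ := fun x =>
      Complex.exp (2 * Real.pi * Complex.I * (phase B p.f x : ℂ)) with he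
    have hlin : ContDiff ℝ ∞ fun x : EuclideanSpace ℝ (Fin n × Fin k) =>
        2 * Real.pi * Complex.I * (phase B p.f x : ℂ) := contDiff_const.mul (contDiff_phase B p.f)
    have hesm : ContDiff ℝ ∞ e := hlin.cexp
    have hde : ∀ l x, cDeriv (dualDir c ((σ : K →+* ℂ), l)) e x =
        2 * Real.pi * Complex.I * coeffAt B p.f σ (Pi.single l 1) x * e x := by
      intro l x
      rw [he, cDeriv_exp (hlin.differentiable (by simp)).differentiableAt,
        cDeriv_mul (differentiableAt_const _)
          ((contDiff_phase B p.f).differentiable (by simp)).differentiableAt,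
        cDeriv_const, cDeriv_phase B hc, zero_mul, zero_add]
    have hcm : ∀ l, HasCompactSupport fun x => moveCoeff B d σ l p.f x * Ψ p x :=
      fun l => hcs.mul_left
    have hint1 : MeasureTheory.Integrable fun x => e x * (stayCoeff B d σ p.f x * Ψ p x) :=
      (hesm.continuous.mul (hstay p).continuous).integrable_of_hasCompactSupport
        (HasCompactSupport.mul_left (hcs.mul_left))
    have hint2 : ∀ l, MeasureTheory.Integrable fun x =>
        e x * (-1 * cDeriv (dualDir c ((σ : K →+* ℂ), l))
          (fun y => moveCoeff B d σ l p.f y * Ψ p y) x) := fun l =>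
      (hesm.continuous.mul (continuous_const.mul
        (contDiff_cDeriv (hmove l p)).continuous)).integrable_of_hasCompactSupport
        (HasCompactSupport.mul_left (HasCompactSupport.mul_left
          ((hcm l).of_isClosed_subset (isClosed_tsupport _) tsupport_cDeriv_subset)))
    have hint3 : ∀ l, MeasureTheory.Integrable fun x =>
        cDeriv (dualDir c ((σ : K →+* ℂ), l)) e x * (moveCoeff B d σ l p.f x * Ψ p x) := fun l =>
      ((contDiff_cDeriv hesm).continuous.mul
        (hmove l p).continuous).integrable_of_hasCompactSupport (hcm l).mul_left
    have hexp : ∀ x, e x * NFOsc.ibpStep B d c σ p.f (Ψ p) x =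
        e x * (stayCoeff B d σ p.f x * Ψ p x) + ∑ l, e x *
          (-1 * cDeriv (dualDir c ((σ : K →+* ℂ), l))
            (fun y => moveCoeff B d σ l p.f y * Ψ p y) x) := by
      intro x
      rw [NFOsc.ibpStep, mul_add, Finset.mul_sum]
    -- The partition 1 = Q_J/Q + Q_∇/Q, with the gradient part rewritten through derivatives of the
    -- exponential.
    have hexp2 : ∀ x, e x * Ψ p x = e x * (stayCoeff B d σ p.f x * Ψ p x) +
        ∑ l, cDeriv (dualDir c ((σ : K →+* ℂ), l)) e x *
          (moveCoeff B d σ l p.f x * Ψ p x) := by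
      intro x
      by_cases hx : x ∈ tsupport (Ψ p)
      · have hQ : weightH B d p.f σ x ≠ 0 := hsub p hx σ
        have hpi : (2 * Real.pi * Complex.I : ℂ) ≠ 0 := Complex.two_pi_I_ne_zero
        have h1 : ∀ l, cDeriv (dualDir c ((σ : K →+* ℂ), l)) e x *
            (moveCoeff B d σ l p.f x * Ψ p x) =
            (coeffAt B p.f σ (Pi.single l 1) x * coeffAt B p.f (conjugate σ)
              (Pi.single l 1) x) ^ d.factorial * ((weightH B d p.f σ x)⁻¹ * e x * Ψ p x) := by
          intro l
          rw [hde, moveCoeff]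
          obtain ⟨j, hj⟩ : ∃ j, d.factorial = j + 1 := ⟨d.factorial - 1, by
            have := d.factorial_pos
            omega⟩
          rw [hj, Nat.add_sub_cancel]
          field_simp
          ring
        simp only [h1]
        rw [← Finset.sum_mul]
        change _ = _ + weightGrad B d p.f σ x * _
        rw [stayCoeff]
        have h2 : weightJ B d p.f σ x + weightGrad B d p.f σ x = weightH B d p.f σ x := rfl
        field_simp
        rw [h2]
      · simp [image_eq_zero_of_notMem_tsupport hx]
    simp only [oscIntegral]
    change ∫ x, e x * NFOsc.ibpStep B d c σ p.f (Ψ p) x = ∫ x, e x * Ψ p x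
    simp only [hexp, hexp2]
    rw [MeasureTheory.integral_add hint1 (MeasureTheory.integrable_finsetSum _ fun l _ => hint2 l),
      MeasureTheory.integral_add hint1 (MeasureTheory.integrable_finsetSum _ fun l _ => hint3 l),
      MeasureTheory.integral_finsetSum _ fun l _ => hint2 l,
      MeasureTheory.integral_finsetSum _ fun l _ => hint3 l]
    congr 1
    refine Finset.sum_congr rfl fun l _ => ?_
    rw [integral_mul_cDeriv MeasureTheory.volume hesm (hmove l p) (hcm l),
      ← MeasureTheory.integral_neg]
    refine MeasureTheory.integral_congr_ae (Filter.Eventually.of_forall fun x => ?_)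
    ring

/-- Not differentiating gains J/H from `stayCoeff`; differentiating gains 1/H from `moveCoeff` and
loses J. Either way the weight acquires a factor J/H, at the price of one order of regularity. -/
theorem sym_ibpStep
    (hc : ∀ σ τ : K →+* ℂ, ∑ j, c σ j * τ (B j) = if σ = τ then 1 else 0) (σ : S)
    {Ψ : OscData B n d R S → EuclideanSpace ℝ (Fin n × Fin k) → ℂ} (hΨ : IsAmplitude Ψ) {r : ℕ}
    {m : OscData B n d R S → EuclideanSpace ℝ (Fin n × Fin k) → ℝ}
    (hm : (oscSetting n B d S hR c).Sym (r + 1) Ψ m) :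
    (oscSetting n B d S hR c).Sym r (fun p => ibpStep B d c σ p.f (Ψ p))
      (fun p x => m p x * (scale B 2 p.f σ x / scale B 1 p.f σ x)) := by
  have hsm : (oscSetting n B d S hR c).Smooth Ψ := fun p => (hΨ.contDiff p).contDiffOn
  have hmv : ∀ l, (oscSetting n B d S hR c).Smooth
      fun p x => moveCoeff B d σ l p.f x * Ψ p x := fun l => (smooth_moveCoeff σ l).mul hsm
  have h1 := (sym_stayCoeff hc σ r).mul (smooth_stayCoeff σ) hsm hm.of_succ
  have e1 : (fun (p : OscData B n d R S) x =>
      scale B 2 p.f σ x / scale B 1 p.f σ x * m p x) =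
      fun p x => m p x * (scale B 2 p.f σ x / scale B 1 p.f σ x) := by
    ext p x
    ring
  rw [e1] at h1
  refine Sym.add ((smooth_stayCoeff σ).mul hsm) (Smooth.sum _ fun l _ =>
    (Smooth.const _).mul ((hmv l).cDeriv _)) h1 (Sym.sum _ (fun l _ =>
    (Smooth.const _).mul ((hmv l).cDeriv _)) fun l _ => ?_)
  have h2 := ((sym_moveCoeff hc σ l (r + 1)).mul (smooth_moveCoeff σ l) hsm hm).2 (σ, l)
  have e2 : (fun (p : OscData B n d R S) x =>
      (scale B 1 p.f σ x)⁻¹ * m p x * (oscSetting n B d S hR c).J (σ, l) p x) =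
      fun p x => m p x * (scale B 2 p.f σ x / scale B 1 p.f σ x) := by
    ext p x
    change _ * scale B 2 p.f σ x = _
    ring
  rw [e2] at h2
  exact h2.const_mul (-1) ((hmv l).cDeriv _)

theorem isAmplitude_self : IsAmplitude fun p : OscData B n d R S => p.ψ :=
  ⟨fun p => p.contDiff, fun _ => subset_rfl, fun _ => rfl⟩

theorem exists_amplitude
    (hc : ∀ σ τ : K →+* ℂ, ∑ j, c σ j * τ (B j) = if σ = τ then 1 else 0) {T : ℕ}
    (hψ : (oscSetting n B d S hR c).Sym T (fun p => p.ψ) fun _ _ => 1) (L : List S) :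
    ∀ r, r + L.length = T → ∃ Ψ : OscData B n d R S → EuclideanSpace ℝ (Fin n × Fin k) → ℂ,
      IsAmplitude Ψ ∧ (oscSetting n B d S hR c).Sym r Ψ fun p x =>
        (L.map fun σ : S => scale B 2 p.f σ x / scale B 1 p.f σ x).prod := by
  induction L with
  | nil =>
    rintro r rfl
    exact ⟨_, isAmplitude_self, by simpa using hψ⟩
  | cons σ L ih =>
    intro r hr
    obtain ⟨Ψ, h1, h2⟩ := ih (r + 1) (by rw [List.length_cons] at hr; omega)
    refine ⟨_, h1.ibpStep hR hc σ, ?_⟩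
    have h3 := sym_ibpStep hc σ h1 h2
    have e1 : (fun (p : OscData B n d R S) x =>
        (L.map fun σ : S => scale B 2 p.f σ x / scale B 1 p.f σ x).prod *
          (scale B 2 p.f σ x / scale B 1 p.f σ x)) = fun p x =>
        ((σ :: L).map fun σ : S => scale B 2 p.f σ x / scale B 1 p.f σ x).prod := by
      ext p x
      rw [List.map_cons, List.prod_cons, mul_comm]
    rwa [e1] at h3

/-- The hypothesis holds for every σ in S, hence for the smallest J at the point, and
`Sym.of_iteratedFDeriv` applies with that minimum as common scale. The constant is 1/R. -/
theorem sym_psi (hS : S.Nonempty) :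
    (oscSetting n B d S hR c).Sym (4 * k) (fun p => p.ψ) fun _ _ => 1 := by
  have hS' : (Finset.univ : Finset S).Nonempty := by
    obtain ⟨σ, hσ⟩ := hS
    exact ⟨⟨σ, hσ⟩, Finset.mem_univ _⟩
  have h := Sym.of_iteratedFDeriv (s := oscSetting n B d S hR c)
    (J₀ := fun p x => Finset.univ.inf' hS' fun σ : S => scale B 2 p.f σ x)
    (fun p x _ => (Finset.le_inf'_iff hS' _).2 fun σ _ => scale_nonneg B 2 p.f σ x)
    (fun i p x _ => Finset.inf'_le _ (Finset.mem_univ i.1)) (4 * k) 0 (fun p => p.ψ)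
    (fun p => p.contDiff) ⟨(R : ℝ)⁻¹, fun p x hx t ht => ?_⟩
  · simpa using h
  · obtain ⟨σ, _, hσ⟩ := Finset.exists_mem_eq_inf' hS' fun σ : S => scale B 2 p.f σ x
    rw [hσ, zero_add]
    have h1 := p.le_pow t ht σ σ.2 x hx
    have h2 : ‖iteratedFDeriv ℝ t p.ψ x‖ₑ ≤ cNorm t p.ψ :=
      le_iSup₂_of_le t le_rfl (le_iSup (fun y => ‖iteratedFDeriv ℝ t p.ψ y‖ₑ) x)
    have h3 : (R : ℝ≥0∞) * ‖iteratedFDeriv ℝ t p.ψ x‖ₑ ≤ JPoint B p.f σ x ^ t :=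
      (mul_le_mul_right h2 _).trans h1
    have h4 := ENNReal.toReal_mono
      (ENNReal.pow_ne_top (derivSize_ne_top (by norm_num : 1 ≤ 2) _ _)) h3
    rw [ENNReal.toReal_mul, ENNReal.toReal_pow, toReal_enorm, ENNReal.coe_toReal] at h4
    have hR' : (0 : ℝ) < R := hR
    rw [inv_mul_eq_div, le_div_iff₀ hR', mul_comm]
    exact h4

/-- The bound obtained from repeated integration by parts. -/
theorem exists_oscIntegral_le_lintegral (hR : 0 < R) (hS : S.Nonempty) :
    ∃ C : ℝ≥0, ∀ p : OscData B n d R S,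
      ‖oscIntegral B p.f p.ψ‖ₑ ≤ C * ∫⁻ x in tsupport p.ψ,
        ∏ σ ∈ S, ENNReal.ofReal ((scale B 2 p.f σ x / scale B 1 p.f σ x) ^ 4) := by
  obtain ⟨c, hc⟩ := exists_dual_coeff B
  set L : List S := (Finset.univ : Finset S).toList with hL
  have hlen : L.length ≤ k := by
    rw [hL, Finset.length_toList, ← card_embeddings B, Finset.card_univ]
    exact Fintype.card_subtype_le _
  -- Each embedding of S is used four times. This consumes 4|S| ≤ 4k orders of regularity; only the
  -- bound on the resulting amplitude itself is needed afterwards.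
  obtain ⟨Ψ, hΨ, hsym⟩ := exists_amplitude hc (sym_psi (B := B) (n := n) (d := d) (hR := hR)
    (c := c) hS) (L ++ L ++ L ++ L) (4 * k - 4 * L.length) (by
      simp only [List.length_append]
      omega)
  obtain ⟨C, hC⟩ := hsym.bound
  refine ⟨C.toNNReal, fun p => ?_⟩
  rw [← hΨ.integral_eq p, oscIntegral]
  refine (MeasureTheory.enorm_integral_le_lintegral_enorm _).trans ?_
  rw [← MeasureTheory.lintegral_const_mul' _ _ ENNReal.coe_ne_top,
    ← MeasureTheory.lintegral_indicator (isClosed_tsupport p.ψ).measurableSet]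
  refine MeasureTheory.lintegral_mono fun x => ?_
  by_cases hx : x ∈ tsupport p.ψ
  · rw [Set.indicator_of_mem hx, enorm_mul]
    have h1 : ‖Complex.exp (2 * Real.pi * Complex.I * (phase B p.f x : ℂ))‖ₑ = 1 := by
      rw [← ofReal_norm, Complex.norm_exp]
      simp
    have h2 := hC p x hx
    have h3 : ((L ++ L ++ L ++ L).map
        fun σ : S => scale B 2 p.f σ x / scale B 1 p.f σ x).prod =
        ∏ σ ∈ S, (scale B 2 p.f σ x / scale B 1 p.f σ x) ^ 4 := by
      simp only [List.map_append, List.prod_append]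
      rw [hL, Finset.prod_map_toList, Finset.prod_pow,
        Finset.prod_coe_sort S fun σ => scale B 2 p.f σ x / scale B 1 p.f σ x]
      ring
    rw [h3] at h2
    rw [h1, one_mul, ← ENNReal.ofReal_prod_of_nonneg fun σ _ => by
        have h4 := scale_nonneg B 2 p.f σ x
        have h5 := scale_nonneg B 1 p.f σ x
        positivity,
      ← ofReal_norm, ← ENNReal.ofReal_coe_nnreal, ← ENNReal.ofReal_mul (by positivity)]
    refine ENNReal.ofReal_le_ofReal (h2.trans (mul_le_mul_of_nonneg_right
      (Real.le_coe_toNNReal C) (Finset.prod_nonneg fun σ _ => ?_)))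
    have h4 := scale_nonneg B 2 p.f σ x
    have h5 := scale_nonneg B 1 p.f σ x
    positivity
  · have h1 : Ψ p x = 0 :=
      image_eq_zero_of_notMem_tsupport fun h => hx (hΨ.tsupport_subset p h)
    rw [Set.indicator_of_notMem hx, h1, mul_zero, enorm_zero]

end IBP

/-! ### Points where the gradient is small are close to roots -/

section Sublevel

variable {K : Type*} [Field K] [NumberField K] {k n : ℕ} (B : Module.Basis (Fin k) ℚ K)

/-- The restriction of `P_{f,σ}` to the line through `x` with direction `v`. -/
def lineAt (f : MvPolynomial (Fin n) (realAlg B)) (σ : K →+* ℂ) (v : Fin n → ℝ)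
    (x : EuclideanSpace ℝ (Fin n × Fin k)) : Polynomial ℂ :=
  linePoly (embPoly B f σ) (sigmaVec B σ x) fun l => (v l : ℂ)

/-- The direction `v` detects the size of `J_{f,σ}` at the point `x`. -/
def GoodDir (d : ℕ) (c : ℝ) (f : MvPolynomial (Fin n) (realAlg B)) (σ : K →+* ℂ) (v : Fin n → ℝ)
    (x : EuclideanSpace ℝ (Fin n × Fin k)) : Prop :=
  ∃ j ∈ Finset.Icc 2 d, c * scale B 2 f σ x ^ j ≤ ‖(lineAt B f σ v x).coeff j‖

/-- For each σ take α attaining the maximum in J. The coefficient of index |α| along v is the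
homogeneous part of degree |α| of the translated polynomial evaluated at v, and that part has a
coefficient of size J^|α|. `exists_directions` then serves all σ with the same v. -/
theorem exists_goodDir (n d : ℕ) (S : Finset (K →+* ℂ)) :
    ∃ (V : Finset (Fin n → ℝ)) (c : ℝ), 0 < c ∧
      ∀ f : MvPolynomial (Fin n) (realAlg B), f.totalDegree ≤ d →
      ∀ x, (∀ σ ∈ S, 0 < scale B 2 f σ x) → ∃ v ∈ V, ∀ σ ∈ S, GoodDir B d c f σ v x := by
  obtain ⟨V, c, hc, hV⟩ := exists_directions S n d
  refine ⟨V, c, hc, fun f hf x hx => ?_⟩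
  have h1 : ∀ σ : S, ∃ α ∈ multiIndices n 2 d,
      ‖coeffAt B f σ α x‖ = scale B 2 f σ x ^ (∑ i, α i) := fun σ =>
    exists_norm_coeffAt_eq B (by norm_num) hf σ x (hx σ σ.2)
  choose α hα hαx using h1
  obtain ⟨v, hv, h⟩ := hV
    (fun σ => MvPolynomial.homogeneousComponent (∑ i, α σ i)
      (translate (sigmaVec B σ x) (embPoly B f σ)))
    (fun σ => (MvPolynomial.homogeneousComponent_isHomogeneous _ _).totalDegree_le.trans
      (mem_multiIndices.1 (hα σ)).2)
  refine ⟨v, hv, fun σ hσ => ⟨∑ i, α ⟨σ, hσ⟩ i,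
    Finset.mem_Icc.2 (mem_multiIndices.1 (hα ⟨σ, hσ⟩)), ?_⟩⟩
  have h2 := h ⟨σ, hσ⟩ (Finsupp.equivFunOnFinite.symm (α ⟨σ, hσ⟩))
  rw [MvPolynomial.coeff_homogeneousComponent, if_pos (by simp [Finsupp.degree_eq_sum]),
    coeff_translate] at h2
  have h3 := hαx ⟨σ, hσ⟩
  rw [coeffAt] at h3
  rw [h3] at h2
  rwa [lineAt, coeff_linePoly]

/-- At a point with good direction `v`, the derivative of `P_{f,σ}` along the line with direction
`v` has a root at distance at most a constant times `H / J²`. -/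
theorem exists_root_of_goodDir {d : ℕ} {c A : ℝ} (hc : 0 < c)
    {f : MvPolynomial (Fin n) (realAlg B)} (hf : f.totalDegree ≤ d) {σ : K →+* ℂ}
    {v : Fin n → ℝ} (hv : ∑ l, |v l| ≤ A) {x : EuclideanSpace ℝ (Fin n × Fin k)}
    (hx : 0 < scale B 2 f σ x) (hg : GoodDir B d c f σ v x) :
    ∃ ξ ∈ (Polynomial.derivative (lineAt B f σ v x)).roots,
      (scale B 2 f σ x / scale B 1 f σ x) ^ 2 * (scale B 1 f σ x * ‖ξ‖) ≤
        max 1 (2 ^ d * A / c) := by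
  obtain ⟨j, hj, hjc⟩ := hg
  rw [Finset.mem_Icc] at hj
  set J := scale B 2 f σ x with hJ
  set H := scale B 1 f σ x with hH
  have hJH : J ≤ H := scale_two_le_one B f σ x
  have hH0 : 0 < H := hx.trans_le hJH
  -- Differentiation moves the index j ≥ 2 to i = j - 1 ≥ 1, as required to produce a root.
  obtain ⟨i, rfl⟩ : ∃ i, j = i + 1 := ⟨j - 1, by omega⟩
  set q := Polynomial.derivative (lineAt B f σ v x) with hq
  have hqi : q.coeff i = (lineAt B f σ v x).coeff (i + 1) * (i + 1) :=
    Polynomial.coeff_derivative _ _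
  have hqn : c * J ^ (i + 1) ≤ ‖q.coeff i‖ := by
    rw [hqi, norm_mul]
    refine hjc.trans (le_mul_of_one_le_right (norm_nonneg _) ?_)
    have : ((i : ℂ) + 1) = ((i + 1 : ℕ) : ℂ) := by push_cast; rfl
    rw [this, Complex.norm_natCast]
    exact_mod_cast Nat.succ_pos i
  have hq0 : ‖q.coeff 0‖ ≤ A * H := by
    have h1 : q.coeff 0 = (lineAt B f σ v x).coeff 1 := by
      rw [hq, Polynomial.coeff_derivative]
      simp
    rw [h1, lineAt, coeff_one_linePoly]
    refine (norm_sum_le _ _).trans ((Finset.sum_le_sum (g := fun l => |v l| * H)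
      fun l _ => ?_).trans ?_)
    · rw [norm_mul, Complex.norm_real, Real.norm_eq_abs]
      refine mul_le_mul_of_nonneg_left ?_ (abs_nonneg _)
      have hl : ∑ i, (Pi.single l 1 : Fin n → ℕ) i = 1 := sum_eq_one_iff.2 ⟨l, rfl⟩
      have := norm_coeffAt_le B le_rfl f σ x hl.ge
      rwa [hl, pow_one] at this
    · rw [← Finset.sum_mul]
      exact mul_le_mul_of_nonneg_right hv hH0.le
  have hdeg : q.natDegree ≤ d :=
    (Polynomial.natDegree_derivative_le _).trans ((Nat.sub_le _ _).trans
      ((natDegree_linePoly_le _ _ _).trans ((totalDegree_embPoly_le B σ f).trans hf)))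
  have hpos : 0 < ‖q.coeff i‖ := lt_of_lt_of_le (by positivity) hqn
  obtain ⟨ξ, hξ, hb⟩ := exists_root_norm_pow_le d q hdeg i (by omega) (norm_pos_iff.1 hpos)
  refine ⟨ξ, hξ, ?_⟩
  set C := max 1 (2 ^ d * A / c) with hC
  have hC1 : 1 ≤ C := le_max_left _ _
  have hC2 : 2 ^ d * A ≤ C * c := by
    rw [← div_le_iff₀ hc]
    exact le_max_right _ _
  have h2 : (J * ‖ξ‖) ^ i * (c * J) ≤ C * c * H :=
    calc (J * ‖ξ‖) ^ i * (c * J) = ‖ξ‖ ^ i * (c * J ^ (i + 1)) := by ring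
      _ ≤ ‖ξ‖ ^ i * ‖q.coeff i‖ := by gcongr
      _ ≤ 2 ^ d * ‖q.coeff 0‖ := hb
      _ ≤ 2 ^ d * (A * H) := by gcongr
      _ = 2 ^ d * A * H := by ring
      _ ≤ C * c * H := by gcongr
  -- The preceding bound says (J‖ξ‖)^i ≤ C H/J. If J‖ξ‖ ≥ 1 the power dominates J‖ξ‖; otherwise H/J
  -- ≥ 1 and C ≥ 1 suffice.
  have h3 : J * ‖ξ‖ ≤ C * (H / J) := by
    have hl1 : 1 ≤ H / J := (one_le_div hx).2 hJH
    have hl2 : 1 ≤ C * (H / J) := one_le_mul_of_one_le_of_one_le hC1 hl1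
    rcases le_total (J * ‖ξ‖) 1 with h4 | h4
    · exact h4.trans hl2
    · calc J * ‖ξ‖ ≤ (J * ‖ξ‖) ^ i := le_self_pow₀ h4 (by omega)
        _ ≤ C * c * H / (c * J) := (le_div_iff₀ (by positivity)).2 h2
        _ = C * (H / J) := by field_simp
  calc (J / H) ^ 2 * (H * ‖ξ‖) = (J / H) * (J * ‖ξ‖) := by field_simp
    _ ≤ (J / H) * (C * (H / J)) := by gcongr
    _ = C := by field_simp

/-- Applied with r = J/H. One square of r pays for 1 + m y; squaring once more gives kernel exponent
2, which makes the kernel integrable on the line. Hence the fourth power. -/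
theorem pow_four_le_of_root {r h y C m : ℝ} (hr0 : 0 ≤ r) (hr : r ≤ 1) (hy : 0 ≤ y) (hm0 : 0 ≤ m)
    (hm : m ≤ h) (hb : r ^ 2 * (h * y) ≤ C) : r ^ 4 ≤ (1 + C) ^ 2 * ((1 + m * y) ^ 2)⁻¹ := by
  have hmy : 0 ≤ m * y := mul_nonneg hm0 hy
  have h1 : r ^ 2 * (1 + m * y) ≤ 1 + C := by
    have h2 : r ^ 2 * (m * y) ≤ r ^ 2 * (h * y) := by gcongr
    have h3 : r ^ 2 ≤ 1 := pow_le_one₀ hr0 hr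
    linarith
  rw [← div_eq_mul_inv, le_div_iff₀ (by positivity)]
  calc r ^ 4 * (1 + m * y) ^ 2 = (r ^ 2 * (1 + m * y)) ^ 2 := by ring
    _ ≤ (1 + C) ^ 2 := by gcongr

/-! ### Translations along a direction -/

/-- The translation `y ↦ (y v_1, …, y v_n)` in `ℝ^{kn}`. -/
def shift (v : Fin n → ℝ) : (Fin k → ℝ) →ₗ[ℝ] EuclideanSpace ℝ (Fin n × Fin k) where
  toFun y := WithLp.toLp 2 fun a => y a.2 * v a.1
  map_add' y y' := by ext a; simp [add_mul]
  map_smul' r y := by ext a; simp [mul_assoc]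

theorem sigmaVec_add_shift (σ : K →+* ℂ) (v : Fin n → ℝ) (x : EuclideanSpace ℝ (Fin n × Fin k))
    (y : Fin k → ℝ) :
    sigmaVec B σ (x + shift v y) =
      fun l => sigmaVec B σ x l + sigmaStarStar B σ y * (v l : ℂ) := by
  ext l
  simp only [sigmaVec, sigmaStarStar_eq, block, shift, Finset.sum_mul, ← Finset.sum_add_distrib]
  refine Finset.sum_congr rfl fun j _ => ?_
  simp
  ring

theorem lineAt_add_shift (f : MvPolynomial (Fin n) (realAlg B)) (σ : K →+* ℂ) (v : Fin n → ℝ)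
    (x : EuclideanSpace ℝ (Fin n × Fin k)) (y : Fin k → ℝ) :
    lineAt B f σ v (x + shift v y) =
      (lineAt B f σ v x).comp (Polynomial.X + Polynomial.C (sigmaStarStar B σ y)) := by
  rw [lineAt, sigmaVec_add_shift, linePoly_comp, lineAt]

theorem mem_roots_of_mem_roots_shift {f : MvPolynomial (Fin n) (realAlg B)} {σ : K →+* ℂ}
    {v : Fin n → ℝ} {x : EuclideanSpace ℝ (Fin n × Fin k)} {y : Fin k → ℝ} {ξ : ℂ}
    (h : ξ ∈ (Polynomial.derivative (lineAt B f σ v (x + shift v y))).roots) :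
    ξ + sigmaStarStar B σ y ∈ (Polynomial.derivative (lineAt B f σ v x)).roots := by
  have h1 : Polynomial.derivative (lineAt B f σ v (x + shift v y)) =
      (Polynomial.derivative (lineAt B f σ v x)).comp
        (Polynomial.X + Polynomial.C (sigmaStarStar B σ y)) := by
    rw [lineAt_add_shift, Polynomial.derivative_comp]
    simp
  rw [h1] at h
  have hne := Polynomial.ne_zero_of_mem_roots h
  have hroot := Polynomial.isRoot_of_mem_roots h
  rw [Polynomial.mem_roots']
  refine ⟨fun h0 => hne (by rw [h0, Polynomial.zero_comp]), ?_⟩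
  rw [Polynomial.IsRoot.def, Polynomial.eval_comp] at hroot
  simpa using hroot

theorem card_roots_lineAt_le {d : ℕ} {f : MvPolynomial (Fin n) (realAlg B)}
    (hf : f.totalDegree ≤ d) (σ : K →+* ℂ) (v : Fin n → ℝ)
    (x : EuclideanSpace ℝ (Fin n × Fin k)) :
    (Polynomial.derivative (lineAt B f σ v x)).roots.toFinset.card ≤ d :=
  (Multiset.toFinset_card_le _).trans ((Polynomial.card_roots' _).trans
    ((Polynomial.natDegree_derivative_le _).trans ((Nat.sub_le _ _).trans
      ((natDegree_linePoly_le _ _ _).trans ((totalDegree_embPoly_le B σ f).trans hf)))))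

/-! ### Measurability -/

theorem continuous_coeff_lineAt (f : MvPolynomial (Fin n) (realAlg B)) (σ : K →+* ℂ)
    (v : Fin n → ℝ) (j : ℕ) : Continuous fun x => (lineAt B f σ v x).coeff j := by
  unfold lineAt linePoly
  generalize embPoly B f σ = P
  induction P using MvPolynomial.induction_on generalizing j with
  | C a => simpa using continuous_const
  | add p q hp hq =>
    simp only [map_add, Polynomial.coeff_add]
    exact (hp j).add (hq j)
  | mul_X p l hp =>
    have hs := (contDiff_sigmaVec B σ l).continuous
    simp only [map_mul, MvPolynomial.aeval_X, mul_add, Polynomial.coeff_add,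
      Polynomial.coeff_mul_C, ← mul_assoc]
    rcases j with _ | j
    · simp only [Polynomial.coeff_mul_X_zero, add_zero]
      exact (hp 0).mul hs
    · simp only [Polynomial.coeff_mul_X, Polynomial.coeff_mul_C]
      exact ((hp (j + 1)).mul hs).add ((hp j).mul continuous_const)

theorem measurable_scale (m : ℕ) (f : MvPolynomial (Fin n) (realAlg B)) (σ : K →+* ℂ) :
    Measurable (scale B m f σ) := by
  refine ENNReal.measurable_toReal.comp ?_
  refine Measurable.iSup fun α => Measurable.iSup fun _ => Measurable.pow_const ?_ _
  exact (contDiff_coeffAt B f σ α).continuous.measurable.enorm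

theorem measurableSet_goodDir (d : ℕ) (c : ℝ) (f : MvPolynomial (Fin n) (realAlg B))
    (σ : K →+* ℂ) (v : Fin n → ℝ) : MeasurableSet {x | GoodDir B d c f σ v x} := by
  have h1 : {x | GoodDir B d c f σ v x} = ⋃ j ∈ Finset.Icc 2 d,
      {x | c * scale B 2 f σ x ^ j ≤ ‖(lineAt B f σ v x).coeff j‖} := by
    ext x
    simp only [GoodDir, Set.mem_ofPred_eq, Set.mem_iUnion, exists_prop]
  rw [h1]
  exact Finset.measurableSet_biUnion _ fun j _ =>
    measurableSet_le (((measurable_scale B 2 f σ).pow_const j).const_mul c)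
      (continuous_coeff_lineAt B f σ v j).measurable.norm

end Sublevel

/-! ### Integrals of products of kernels -/

section Kernels

open MeasureTheory

theorem lintegral_pi_prod_ofReal {ι E : Type*} [Fintype ι] [MeasureSpace E]
    [SigmaFinite (volume : Measure E)] (g : ι → E → ℝ) (hg : ∀ i, Integrable (g i))
    (h0 : ∀ i x, 0 ≤ g i x) :
    ∫⁻ x : ι → E, ∏ i, ENNReal.ofReal (g i (x i)) = ∏ i, ENNReal.ofReal (∫ x, g i x) := by
  have hint : Integrable fun x : ι → E => ∏ i, g i (x i) := Integrable.fintype_prod hg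
  rw [← ENNReal.ofReal_prod_of_nonneg fun i _ => integral_nonneg (h0 i),
    ← integral_fintype_prod_volume_eq_prod,
    ofReal_integral_eq_lintegral_ofReal hint
      (Filter.Eventually.of_forall fun x => Finset.prod_nonneg fun i _ => h0 i (x i))]
  refine lintegral_congr fun x => ?_
  rw [ENNReal.ofReal_prod_of_nonneg fun i _ => h0 i (x i)]

/-- Translation and dilation reduce to the case m = 1, a = 0; the exponent exceeds the dimension. -/
theorem kernel_integral {E : Type*} [NormedAddCommGroup E] [NormedSpace ℝ E]
    [FiniteDimensional ℝ E] [MeasureSpace E] [BorelSpace E]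
    [(volume : Measure E).IsAddHaarMeasure] {r : ℕ} (hr : Module.finrank ℝ E < r) {m : ℝ}
    (hm : 0 < m) (a : E) :
    Integrable (fun x : E => ((1 + m * ‖x - a‖) ^ r)⁻¹) ∧
      ∫ x : E, ((1 + m * ‖x - a‖) ^ r)⁻¹ =
        (m ^ Module.finrank ℝ E)⁻¹ * ∫ x : E, ((1 + ‖x‖) ^ r)⁻¹ := by
  have h1 : Integrable fun x : E => ((1 + ‖x‖) ^ r)⁻¹ := by
    have := integrable_one_add_norm (E := E) (μ := volume) (r := (r : ℝ)) (by exact_mod_cast hr)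
    refine this.congr (Filter.Eventually.of_forall fun x => ?_)
    change (1 + ‖x‖) ^ (-(r : ℝ)) = ((1 + ‖x‖) ^ r)⁻¹
    rw [Real.rpow_neg (by positivity), Real.rpow_natCast]
  have h2 : Integrable fun x : E => ((1 + ‖m • x‖) ^ r)⁻¹ := h1.comp_smul hm.ne'
  have e1 : ∀ x : E, ((1 + m * ‖x - a‖) ^ r)⁻¹ = ((1 + ‖m • (x - a)‖) ^ r)⁻¹ := fun x => by
    rw [norm_smul, Real.norm_of_nonneg hm.le]
  simp only [e1]
  refine ⟨h2.comp_sub_right a, ?_⟩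
  rw [integral_sub_right_eq_self (fun x : E => ((1 + ‖m • x‖) ^ r)⁻¹) a,
    Measure.integral_comp_smul volume (fun x : E => ((1 + ‖x‖) ^ r)⁻¹) m, smul_eq_mul,
    abs_of_pos (by positivity)]

theorem kernel_sum_integral {E : Type*} [NormedAddCommGroup E] [NormedSpace ℝ E]
    [FiniteDimensional ℝ E] [MeasureSpace E] [BorelSpace E]
    [(volume : Measure E).IsAddHaarMeasure] {r : ℕ} (hr : Module.finrank ℝ E < r) {m : ℝ}
    (hm : 0 < m) {ι : Type*} (t : Finset ι) (a : ι → E) :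
    Integrable (fun x : E => ∑ i ∈ t, ((1 + m * ‖x - a i‖) ^ r)⁻¹) ∧
      ∫ x : E, ∑ i ∈ t, ((1 + m * ‖x - a i‖) ^ r)⁻¹ =
        t.card * (∫ x : E, ((1 + ‖x‖) ^ r)⁻¹) * (m ^ Module.finrank ℝ E)⁻¹ := by
  refine ⟨integrable_finsetSum _ fun i _ => (kernel_integral hr hm (a i)).1, ?_⟩
  rw [integral_finsetSum _ fun i _ => (kernel_integral hr hm (a i)).1]
  simp only [(kernel_integral hr hm _).2, Finset.sum_const, nsmul_eq_mul]
  ring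

/-- Average over the displacements: by Tonelli and translation invariance, the integral of F times
the volume of the unit ball of Y is the integral over x of the inner integrals. These vanish for x
outside a bounded ball. No injectivity of `L` is needed. -/
theorem exists_lintegral_le_of_shift {Y E : Type*} [NormedAddCommGroup Y] [NormedSpace ℝ Y]
    [FiniteDimensional ℝ Y] [MeasureSpace Y] [BorelSpace Y]
    [(volume : Measure Y).IsAddHaarMeasure]
    [NormedAddCommGroup E] [NormedSpace ℝ E] [FiniteDimensional ℝ E] [MeasureSpace E]
    [BorelSpace E] [(volume : Measure E).IsAddHaarMeasure] (L : Y →ₗ[ℝ] E) :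
    ∃ C : ℝ≥0, ∀ F : E → ℝ≥0∞, Measurable F → (∀ x, F x ≠ 0 → x ∈ Metric.closedBall 0 1) →
      ∀ A : ℝ≥0∞, (∀ x, ∫⁻ y in Metric.ball 0 1, F (x + L y) ≤ A) → ∫⁻ x, F x ≤ C * A := by
  set T : Y →L[ℝ] E := LinearMap.toContinuousLinearMap L with hT
  have hTL : ∀ y, L y = T y := fun y => rfl
  set b := (volume : Measure Y) (Metric.ball 0 1) with hb
  set b' := (volume : Measure E) (Metric.closedBall 0 (1 + ‖T‖)) with hb'
  have hb0 : b ≠ 0 := (Metric.measure_ball_pos _ _ one_pos).ne'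
  have hbt : b ≠ ⊤ := measure_ball_lt_top.ne
  have hbt' : b' ≠ ⊤ := measure_closedBall_lt_top.ne
  have hfin : b⁻¹ * b' ≠ ⊤ := ENNReal.mul_ne_top (ENNReal.inv_ne_top.2 hb0) hbt'
  refine ⟨(b⁻¹ * b').toNNReal, fun F hF hsupp A hA => ?_⟩
  rw [ENNReal.coe_toNNReal hfin]
  have hmeas : Measurable fun q : Y × E => F (q.2 + L q.1) := by
    refine hF.comp ?_
    simp only [hTL]
    fun_prop
  have h1 : b * ∫⁻ x, F x = ∫⁻ x, ∫⁻ y in Metric.ball 0 1, F (x + L y) := by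
    rw [lintegral_lintegral_swap
      (f := fun (x : E) (y : Y) => F (x + L y)) (hmeas.comp measurable_swap).aemeasurable]
    simp only [lintegral_add_right_eq_self]
    rw [setLIntegral_const, mul_comm]
  have h2 : ∫⁻ x, ∫⁻ y in Metric.ball 0 1, F (x + L y) ≤ A * b' := by
    rw [hb', ← setLIntegral_const, ← lintegral_indicator measurableSet_closedBall]
    refine lintegral_mono fun x => ?_
    by_cases hx : x ∈ Metric.closedBall (0 : E) (1 + ‖T‖)
    · rw [Set.indicator_of_mem hx]
      exact hA x
    · rw [Set.indicator_of_notMem hx, nonpos_iff_eq_zero]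
      refine (setLIntegral_congr_fun measurableSet_ball fun y hy => ?_).trans lintegral_zero
      by_contra h0
      apply hx
      have h3 := hsupp _ h0
      rw [mem_closedBall_zero_iff] at h3 ⊢
      rw [mem_ball_zero_iff] at hy
      calc ‖x‖ = ‖(x + T y) - T y‖ := by rw [add_sub_cancel_right]
        _ ≤ ‖x + T y‖ + ‖T y‖ := norm_sub_le _ _
        _ ≤ 1 + ‖T‖ * 1 := add_le_add h3 ((T.le_opNorm y).trans (by gcongr))
        _ = 1 + ‖T‖ := by rw [mul_one]
  calc ∫⁻ x, F x = b⁻¹ * (b * ∫⁻ x, F x) := by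
        rw [← mul_assoc, ENNReal.inv_mul_cancel hb0 hbt, one_mul]
    _ ≤ b⁻¹ * (A * b') := by
        rw [h1]
        gcongr
    _ = b⁻¹ * b' * A := by ring

end Kernels

/-! ### Integrals over the product of the infinite places -/

section Places

open MeasureTheory NumberField NumberField.InfinitePlace NumberField.mixedEmbedding
open scoped Classical

variable {K : Type*} [Field K] [NumberField K] {k : ℕ} (B : Module.Basis (Fin k) ℚ K)

theorem sigmaStarStar_add (σ : K →+* ℂ) (y y' : Fin k → ℝ) :
    sigmaStarStar B σ (y + y') = sigmaStarStar B σ y + sigmaStarStar B σ y' := by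
  simp [sigmaStarStar_eq, add_mul, Finset.sum_add_distrib]

theorem sigmaStarStar_smul (σ : K →+* ℂ) (r : ℝ) (y : Fin k → ℝ) :
    sigmaStarStar B σ (r • y) = r • sigmaStarStar B σ y := by
  simp [sigmaStarStar_eq, Finset.mul_sum, mul_assoc]

/-- The map `ℝ^k → ℝ^{r₁} × ℂ^{r₂}` given by the infinite places. -/
def placeMap : (Fin k → ℝ) →ₗ[ℝ] mixedSpace K where
  toFun y := (fun w => (sigmaStarStar B w.1.embedding y).re,
    fun w => sigmaStarStar B w.1.embedding y)
  map_add' y y' := by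
    ext w <;> simp [sigmaStarStar_add]
  map_smul' r y := by
    ext w <;> simp [sigmaStarStar_smul]

/-- Vanishing at one embedding of each place gives vanishing at all embeddings by conjugation. At a
real place the value is real, so the real part determines it. -/
theorem placeMap_injective : Function.Injective (placeMap B) := by
  rw [injective_iff_map_eq_zero]
  intro y hy
  apply eq_zero_of_sigmaStarStar_eq_zero B
  have h1 : ∀ w : InfinitePlace K, sigmaStarStar B w.embedding y = 0 := by
    intro w
    rcases isReal_or_isComplex w with hw | hw
    · have h2 : (sigmaStarStar B w.embedding y).re = 0 :=
        congrFun (congrArg Prod.fst hy) ⟨w, hw⟩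
      have h3 := sigmaStarStar_conjugate B w.embedding y
      rw [conjugate_embedding_eq_of_isReal hw] at h3
      have h4 := Complex.conj_eq_iff_im.1 h3.symm
      exact Complex.ext h2 h4
    · exact congrFun (congrArg Prod.snd hy) ⟨w, hw⟩
  intro σ
  rcases embedding_mk_eq σ with h | h
  · rw [← h]
    exact h1 _
  · have h2 := h1 (InfinitePlace.mk σ)
    rw [h, sigmaStarStar_conjugate] at h2
    simpa using h2

/-- `placeMap` as an equivalence. -/
def placeEquiv : (Fin k → ℝ) ≃L[ℝ] mixedSpace K :=
  (LinearMap.linearEquivOfInjective (placeMap B) (placeMap_injective B) (by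
    rw [mixedEmbedding.finrank, Module.finrank_eq_card_basis B]
    simp)).toContinuousLinearEquiv

/-- In the coordinates of the infinite places the integrand is bounded by a product of functions of
separate variables. The exponents 2 on ℝ and 4 on ℂ exceed the dimensions, and scaling gives m⁻¹ and
m⁻². -/
theorem exists_lintegral_places_le (D : ℕ) : ∃ C : ℝ≥0, ∀ m : InfinitePlace K → ℝ,
    (∀ w, 0 < m w) → ∀ Z : InfinitePlace K → Finset ℂ, (∀ w, (Z w).card ≤ D) →
      ∫⁻ y : Fin k → ℝ, ∏ w : InfinitePlace K, ENNReal.ofReal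
        (∑ ζ ∈ Z w, ((1 + m w * ‖sigmaStarStar B w.embedding y - ζ‖) ^ (2 * mult w))⁻¹) ≤
      C * ∏ w, ENNReal.ofReal ((m w ^ mult w)⁻¹) := by
  set I₁ := ∫ x : ℝ, ((1 + ‖x‖) ^ 2)⁻¹ with hI₁
  set I₂ := ∫ x : ℂ, ((1 + ‖x‖) ^ 4)⁻¹ with hI₂
  have hI₁0 : 0 ≤ I₁ := integral_nonneg fun x => by positivity
  have hI₂0 : 0 ≤ I₂ := integral_nonneg fun x => by positivity
  set T := placeEquiv B with hT
  have hTy : ∀ y, T y = placeMap B y := fun y => rfl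
  set μ : Measure (mixedSpace K) := Measure.map T volume with hμ
  have : μ.IsAddHaarMeasure := T.isAddHaarMeasure_map volume
  set s := μ.addHaarScalarFactor (volume : Measure (mixedSpace K)) with hs
  -- The change of variables is linear, so the pushforward of Lebesgue measure is a Haar measure and
  -- its Jacobian is the constant `s`.
  have hμs : μ = s • (volume : Measure (mixedSpace K)) :=
    Measure.isAddLeftInvariant_eq_smul μ volume
  refine ⟨s * ((∏ _w : {w : InfinitePlace K // IsReal w}, (D * I₁).toNNReal) *
    ∏ _w : {w : InfinitePlace K // IsComplex w}, (D * I₂).toNNReal), fun m hm Z hZ => ?_⟩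
  set g₁ : {w : InfinitePlace K // IsReal w} → ℝ → ℝ := fun w x =>
    ∑ ζ ∈ Z w, ((1 + m w * ‖x - ζ.re‖) ^ 2)⁻¹ with hg₁
  set g₂ : {w : InfinitePlace K // IsComplex w} → ℂ → ℝ := fun w x =>
    ∑ ζ ∈ Z w, ((1 + m w * ‖x - ζ‖) ^ 4)⁻¹ with hg₂
  have hr1 : Module.finrank ℝ ℝ < 2 := by simp
  have hr2 : Module.finrank ℝ ℂ < 4 := by simp [Complex.finrank_real_complex]
  have hg₁i : ∀ w, Integrable (g₁ w) ∧ ∫ x, g₁ w x ≤ D * I₁ * (m w)⁻¹ := by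
    intro w
    obtain ⟨h1, h2⟩ := kernel_sum_integral (E := ℝ) hr1 (hm w) (Z w) fun ζ => ζ.re
    refine ⟨h1, h2.le.trans ?_⟩
    rw [Module.finrank_self, pow_one]
    have := (hm w).le
    have h3 : ((Z w).card : ℝ) ≤ D := by exact_mod_cast hZ w
    gcongr
  have hg₂i : ∀ w, Integrable (g₂ w) ∧ ∫ x, g₂ w x ≤ D * I₂ * (m w ^ 2)⁻¹ := by
    intro w
    obtain ⟨h1, h2⟩ := kernel_sum_integral (E := ℂ) hr2 (hm w) (Z w) fun ζ => ζ
    refine ⟨h1, h2.le.trans ?_⟩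
    rw [Complex.finrank_real_complex]
    have := (hm w).le
    have h3 : ((Z w).card : ℝ) ≤ D := by exact_mod_cast hZ w
    gcongr
  have hg₁0 : ∀ w x, 0 ≤ g₁ w x := fun w x => Finset.sum_nonneg fun ζ _ => by
    have := (hm w).le
    positivity
  have hg₂0 : ∀ w x, 0 ≤ g₂ w x := fun w x => Finset.sum_nonneg fun ζ _ => by
    have := (hm w).le
    positivity
  set h : mixedSpace K → ℝ≥0∞ := fun z =>
    (∏ w, ENNReal.ofReal (g₁ w (z.1 w))) * ∏ w, ENNReal.ofReal (g₂ w (z.2 w)) with hh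
  have hg₁m : ∀ w, Measurable (g₁ w) := fun w => Finset.measurable_fun_sum _ fun ζ _ => by
    fun_prop
  have hg₂m : ∀ w, Measurable (g₂ w) := fun w => Finset.measurable_fun_sum _ fun ζ _ => by
    fun_prop
  have hp₁ : Measurable fun a : {w : InfinitePlace K // IsReal w} → ℝ =>
      ∏ w, ENNReal.ofReal (g₁ w (a w)) := Finset.measurable_fun_prod _ fun w _ =>
    ((hg₁m w).comp (measurable_pi_apply w)).ennreal_ofReal
  have hp₂ : Measurable fun a : {w : InfinitePlace K // IsComplex w} → ℂ =>
      ∏ w, ENNReal.ofReal (g₂ w (a w)) := Finset.measurable_fun_prod _ fun w _ =>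
    ((hg₂m w).comp (measurable_pi_apply w)).ennreal_ofReal
  have hhm : Measurable h := (hp₁.comp measurable_fst).mul (hp₂.comp measurable_snd)
  have hle : ∀ y, ∏ w : InfinitePlace K, ENNReal.ofReal (∑ ζ ∈ Z w,
      ((1 + m w * ‖sigmaStarStar B w.embedding y - ζ‖) ^ (2 * mult w))⁻¹) ≤ h (T y) := by
    intro y
    rw [prod_eq_prod_mul_prod]
    refine mul_le_mul' (Finset.prod_le_prod' fun w _ => ?_) (Finset.prod_le_prod' fun w _ => ?_)
    · refine ENNReal.ofReal_le_ofReal (Finset.sum_le_sum fun ζ _ => ?_)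
      have hw := (hm w).le
      rw [mult_isReal]
      -- At a real place the root may be complex; replacing it by its real part only shortens the
      -- distance and so increases the kernel.
      have h1 : ‖(sigmaStarStar B w.1.embedding y).re - ζ.re‖ ≤
          ‖sigmaStarStar B w.1.embedding y - ζ‖ := by
        rw [← Complex.sub_re, Real.norm_eq_abs]
        exact Complex.abs_re_le_norm _
      change _ ≤ ((1 + m w * ‖(sigmaStarStar B w.1.embedding y).re - ζ.re‖) ^ 2)⁻¹
      gcongr
    · refine ENNReal.ofReal_le_ofReal (Finset.sum_le_sum fun ζ _ => ?_)
      rw [mult_isComplex]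
      exact le_rfl
  have hint : ∫⁻ z, h z = (∏ w, ENNReal.ofReal (∫ x, g₁ w x)) *
      ∏ w, ENNReal.ofReal (∫ x, g₂ w x) := by
    rw [← lintegral_pi_prod_ofReal g₁ (fun w => (hg₁i w).1) hg₁0,
      ← lintegral_pi_prod_ofReal g₂ (fun w => (hg₂i w).1) hg₂0]
    exact lintegral_prod_mul hp₁.aemeasurable hp₂.aemeasurable
  calc _ ≤ ∫⁻ y, h (T y) := lintegral_mono hle
    _ = ∫⁻ z, h z ∂μ := (lintegral_map hhm T.continuous.measurable).symm
    _ = s * ∫⁻ z, h z := by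
        rw [hμs, lintegral_smul_measure]
        rfl
    _ ≤ s * ((∏ w : {w : InfinitePlace K // IsReal w},
          ((D * I₁).toNNReal * ENNReal.ofReal ((m w ^ mult w.1)⁻¹))) *
        ∏ w : {w : InfinitePlace K // IsComplex w},
          ((D * I₂).toNNReal * ENNReal.ofReal ((m w ^ mult w.1)⁻¹))) := by
        rw [hint]
        refine mul_le_mul_right (mul_le_mul' (Finset.prod_le_prod' fun w _ => ?_)
          (Finset.prod_le_prod' fun w _ => ?_)) _
        · rw [mult_isReal, pow_one]
          refine (ENNReal.ofReal_le_ofReal (hg₁i w).2).trans (le_of_eq ?_)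
          rw [ENNReal.ofReal_mul (by positivity)]
          rfl
        · rw [mult_isComplex]
          refine (ENNReal.ofReal_le_ofReal (hg₂i w).2).trans (le_of_eq ?_)
          rw [ENNReal.ofReal_mul (by positivity)]
          rfl
    _ = _ := by
        rw [prod_eq_prod_mul_prod (fun w => ENNReal.ofReal ((m w ^ mult w)⁻¹)),
          Finset.prod_mul_distrib, Finset.prod_mul_distrib]
        push_cast
        ring

end Places

/-! ### The bound in terms of `H` -/

section Final

open MeasureTheory NumberField NumberField.InfinitePlace
open NumberField.ComplexEmbedding (conjugate)
open scoped Classical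

variable {K : Type*} [Field K] [NumberField K] {k n : ℕ} {B : Module.Basis (Fin k) ℚ K}

theorem scale_embedding_mk (m : ℕ) (f : MvPolynomial (Fin n) (realAlg B)) (σ : K →+* ℂ)
    (x : EuclideanSpace ℝ (Fin n × Fin k)) :
    scale B m f (InfinitePlace.mk σ).embedding x = scale B m f σ x := by
  rcases embedding_mk_eq σ with h | h
  · rw [h]
  · rw [h, scale_conjugate]

theorem HUnif_embedding_mk (f : MvPolynomial (Fin n) (realAlg B)) (σ : K →+* ℂ)
    (ψ : EuclideanSpace ℝ (Fin n × Fin k) → ℂ) :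
    HUnif B f (InfinitePlace.mk σ).embedding ψ = HUnif B f σ ψ := by
  rcases embedding_mk_eq σ with h | h
  · rw [h]
  · rw [h]
    exact iInf_congr fun x => iInf_congr fun _ => derivSize_conjugate B 1 f σ x

theorem embedding_mk_mem {K : Type*} [Field K] {S : Finset (K →+* ℂ)} (hS : ∀ σ ∈ S, conjugate σ ∈ S) {σ : K →+* ℂ}
    (hσ : σ ∈ S) : (InfinitePlace.mk σ).embedding ∈ S := by
  rcases embedding_mk_eq σ with h | h
  · rwa [h]
  · rw [h]
    exact hS σ hσ

/-- As S is stable under conjugation, it contains the whole fibre over each place that it meets, and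
that fibre has `mult w` elements. -/
theorem prod_embeddings_eq {M : Type*} [CommMonoid M] {S : Finset (K →+* ℂ)}
    (hS : ∀ σ ∈ S, conjugate σ ∈ S) (g : InfinitePlace K → M) :
    ∏ σ ∈ S, g (InfinitePlace.mk σ) =
      ∏ w, if w ∈ S.image InfinitePlace.mk then g w ^ mult w else 1 := by
  rw [Finset.prod_comp, ← Finset.prod_filter, Finset.filter_univ_mem]
  refine Finset.prod_congr rfl fun w hw => ?_
  congr 1
  rw [← card_filter_mk_eq w]
  congr 1
  ext σ
  simp only [Finset.mem_filter, Finset.mem_univ, true_and, and_iff_right_iff_imp]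
  rintro rfl
  obtain ⟨τ, hτ, h⟩ := Finset.mem_image.1 hw
  rcases mk_eq_iff.1 h with rfl | rfl
  · exact hτ
  · exact hS τ hτ

/-! ### Domination of the decay by kernels at the infinite places -/

variable {d : ℕ} {R : ℝ≥0} {S : Finset (K →+* ℂ)}

theorem OscData.tsupport_nonempty (p : OscData B n d R S) : (tsupport p.ψ).Nonempty := by
  by_contra h
  rw [Set.not_nonempty_iff_eq_empty, tsupport_eq_empty_iff] at h
  exact p.ne_zero h

theorem OscData.HUnif_ne_top (p : OscData B n d R S) (σ : K →+* ℂ) :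
    HUnif B p.f σ p.ψ ≠ ⊤ := by
  obtain ⟨x, hx⟩ := p.tsupport_nonempty
  exact ne_top_of_le_ne_top (derivSize_ne_top le_rfl _ _) (iInf₂_le x hx)

theorem OscData.HUnif_toReal_le (p : OscData B n d R S) (σ : K →+* ℂ)
    {x : EuclideanSpace ℝ (Fin n × Fin k)} (hx : x ∈ tsupport p.ψ) :
    (HUnif B p.f σ p.ψ).toReal ≤ scale B 1 p.f σ x :=
  ENNReal.toReal_mono (derivSize_ne_top le_rfl _ _) (iInf₂_le x hx)

/-- The integrand of the bound obtained by integration by parts. -/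
def decay (S : Finset (K →+* ℂ)) (f : MvPolynomial (Fin n) (realAlg B))
    (x : EuclideanSpace ℝ (Fin n × Fin k)) : ℝ≥0∞ :=
  ∏ σ ∈ S, ENNReal.ofReal ((scale B 2 f σ x / scale B 1 f σ x) ^ 4)

theorem measurable_decay (S : Finset (K →+* ℂ)) (f : MvPolynomial (Fin n) (realAlg B)) :
    Measurable (decay S f) :=
  Finset.measurable_fun_prod _ fun σ _ =>
    (((measurable_scale B 2 f σ).div (measurable_scale B 1 f σ)).pow_const 4).ennreal_ofReal

/-- The points of the support at which `v` is a good direction for all embeddings in `S`. -/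
def goodSet (c : ℝ) (p : OscData B n d R S) (v : Fin n → ℝ) :
    Set (EuclideanSpace ℝ (Fin n × Fin k)) :=
  tsupport p.ψ ∩ ⋂ σ ∈ S, {x | GoodDir B d c p.f σ v x}

theorem measurableSet_goodSet (c : ℝ) (p : OscData B n d R S) (v : Fin n → ℝ) :
    MeasurableSet (goodSet c p v) :=
  (isClosed_tsupport p.ψ).measurableSet.inter
    (Finset.measurableSet_biInter _ fun σ _ => measurableSet_goodDir B d c p.f σ v)

/-- Lower bounds for `H` at all the infinite places. -/
def placeScale (p : OscData B n d R S) (w : InfinitePlace K) : ℝ :=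
  if w ∈ S.image InfinitePlace.mk then (HUnif B p.f w.embedding p.ψ).toReal else 1

/-- Finite sets of roots at all the infinite places. -/
def placeRoots (p : OscData B n d R S) (v : Fin n → ℝ) (x : EuclideanSpace ℝ (Fin n × Fin k))
    (w : InfinitePlace K) : Finset ℂ :=
  if w ∈ S.image InfinitePlace.mk then
    (Polynomial.derivative (lineAt B p.f w.embedding v x)).roots.toFinset else {0}

theorem card_placeRoots_le (p : OscData B n d R S) (v : Fin n → ℝ)
    (x : EuclideanSpace ℝ (Fin n × Fin k)) (w : InfinitePlace K) :
    (placeRoots p v x w).card ≤ d + 1 := by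
  rw [placeRoots]
  split_ifs
  · exact (card_roots_lineAt_le B p.degree_le _ v x).trans (Nat.le_succ d)
  · simp

theorem HUnif_ne_zero {p : OscData B n d R S} (h0 : HSet B p.f S p.ψ ≠ 0)
    {w : InfinitePlace K} (hw : w ∈ S.image InfinitePlace.mk) :
    HUnif B p.f w.embedding p.ψ ≠ 0 := by
  obtain ⟨σ, hσ, rfl⟩ := Finset.mem_image.1 hw
  rw [HUnif_embedding_mk]
  exact Finset.prod_ne_zero_iff.1 h0 σ hσ

theorem placeScale_pos {p : OscData B n d R S} (h0 : HSet B p.f S p.ψ ≠ 0)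
    (w : InfinitePlace K) : 0 < placeScale p w := by
  rw [placeScale]
  split_ifs with hw
  · exact ENNReal.toReal_pos (HUnif_ne_zero h0 hw) (p.HUnif_ne_top _)
  · exact one_pos

theorem prod_placeScale (hS : ∀ σ ∈ S, conjugate σ ∈ S) {p : OscData B n d R S}
    (h0 : HSet B p.f S p.ψ ≠ 0) :
    ∏ w, ENNReal.ofReal ((placeScale p w ^ mult w)⁻¹) = (HSet B p.f S p.ψ)⁻¹ := by
  have h1 : (HSet B p.f S p.ψ)⁻¹ = ∏ σ ∈ S, (HUnif B p.f σ p.ψ)⁻¹ := by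
    rw [HSet]
    exact ENNReal.prod_inv_distrib fun σ _ τ _ _ => Or.inr (p.HUnif_ne_top _)
  have h2 : ∀ σ, (HUnif B p.f σ p.ψ)⁻¹ =
      (fun w : InfinitePlace K => (HUnif B p.f w.embedding p.ψ)⁻¹) (InfinitePlace.mk σ) :=
    fun σ => by simp only [HUnif_embedding_mk]
  rw [h1, Finset.prod_congr rfl fun σ _ => h2 σ,
    prod_embeddings_eq hS fun w : InfinitePlace K => (HUnif B p.f w.embedding p.ψ)⁻¹]
  refine Finset.prod_congr rfl fun w _ => ?_
  have hpos := placeScale_pos h0 w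
  rw [ENNReal.ofReal_inv_of_pos (by positivity), ENNReal.ofReal_pow hpos.le, placeScale]
  split_ifs with hw
  · rw [ENNReal.ofReal_toReal (p.HUnif_ne_top _), ENNReal.inv_pow]
  · simp

variable (B) in
/-- The constants by which the kernels dominate the decay at each infinite place. -/
def placeConst (C : ℝ) (w : InfinitePlace K) : ℝ :=
  (1 + C + ∑ j, ‖w.embedding (B j)‖) ^ 4

theorem norm_sigmaStarStar_le (σ : K →+* ℂ) {y : Fin k → ℝ} (hy : ‖y‖ ≤ 1) :
    ‖sigmaStarStar B σ y‖ ≤ ∑ j, ‖σ (B j)‖ := by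
  rw [sigmaStarStar_eq]
  refine (norm_sum_le _ _).trans (Finset.sum_le_sum fun j _ => ?_)
  rw [norm_mul, Complex.norm_real]
  exact mul_le_of_le_one_left (norm_nonneg _) ((norm_le_pi_norm y j).trans hy)

theorem two_mul_mult_le {K : Type*} [Field K] (w : InfinitePlace K) : 2 * mult w ≤ 4 := by
  unfold mult
  split_ifs <;> norm_num

/-- The root ξ found at the displaced point corresponds to the root ξ + σ(y) at the fixed point x,
so ‖ξ‖ is the distance of σ(y) to a point of a finite set independent of y. The sum over that set
covers whichever root occurs. -/
theorem decay_shift_le (hR : 0 < R) (hS : ∀ σ ∈ S, conjugate σ ∈ S) {c A : ℝ} (hc : 0 < c)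
    {v : Fin n → ℝ} (hv : ∑ l, |v l| ≤ A) (p : OscData B n d R S)
    (x : EuclideanSpace ℝ (Fin n × Fin k)) {y : Fin k → ℝ} (hy : ‖y‖ ≤ 1)
    (hxy : x + shift v y ∈ goodSet c p v) :
    decay S p.f (x + shift v y) ≤
      ∏ w, (ENNReal.ofReal (placeConst B (max 1 (2 ^ d * A / c)) w) *
        ENNReal.ofReal (∑ ζ ∈ placeRoots p v x w,
          ((1 + placeScale p w * ‖sigmaStarStar B w.embedding y - ζ‖) ^ (2 * mult w))⁻¹)) := by
  set C := max 1 (2 ^ d * A / c) with hC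
  have hC1 : 1 ≤ C := le_max_left _ _
  set x' := x + shift v y with hx'
  have hx't : x' ∈ tsupport p.ψ := hxy.1
  have h2 : ∀ σ, ENNReal.ofReal ((scale B 2 p.f σ x' / scale B 1 p.f σ x') ^ 4) =
      (fun w : InfinitePlace K => ENNReal.ofReal
        ((scale B 2 p.f w.embedding x' / scale B 1 p.f w.embedding x') ^ 4))
          (InfinitePlace.mk σ) := fun σ => by simp only [scale_embedding_mk]
  rw [decay, Finset.prod_congr rfl fun σ _ => h2 σ,
    prod_embeddings_eq hS fun w : InfinitePlace K => ENNReal.ofReal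
      ((scale B 2 p.f w.embedding x' / scale B 1 p.f w.embedding x') ^ 4)]
  refine Finset.prod_le_prod' fun w _ => ?_
  have hN : 0 ≤ ∑ j, ‖w.embedding (B j)‖ := Finset.sum_nonneg fun _ _ => norm_nonneg _
  have hconst : 0 ≤ placeConst B C w := by
    unfold placeConst
    positivity
  rw [← ENNReal.ofReal_mul hconst]
  by_cases hw : w ∈ S.image InfinitePlace.mk
  · obtain ⟨σ, hσ, hσw⟩ := Finset.mem_image.1 hw
    have hwS : w.embedding ∈ S := hσw ▸ embedding_mk_mem hS hσ
    have hJ := p.scale_two_pos hR hwS hx't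
    have hH := p.scale_one_pos hR hwS hx't
    have hJH := scale_two_le_one B p.f w.embedding x'
    have hgood : GoodDir B d c p.f w.embedding v x' := by
      have := Set.mem_iInter₂.1 hxy.2 w.embedding hwS
      exact this
    obtain ⟨ξ, hξ, hb⟩ := exists_root_of_goodDir B hc p.degree_le hv hJ hgood
    have hm : placeScale p w ≤ scale B 1 p.f w.embedding x' := by
      rw [placeScale, if_pos hw]
      exact p.HUnif_toReal_le _ hx't
    have hm0 : 0 ≤ placeScale p w := by
      rw [placeScale, if_pos hw]
      exact ENNReal.toReal_nonneg
    have h3 := pow_four_le_of_root (by positivity) ((div_le_one hH).2 hJH) (norm_nonneg ξ) hm0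
      hm hb
    rw [if_pos hw, ← ENNReal.ofReal_pow (by positivity)]
    refine ENNReal.ofReal_le_ofReal ?_
    have hmem : ξ + sigmaStarStar B w.embedding y ∈ placeRoots p v x w := by
      rw [placeRoots, if_pos hw, Multiset.mem_toFinset]
      exact mem_roots_of_mem_roots_shift B hξ
    calc ((scale B 2 p.f w.embedding x' / scale B 1 p.f w.embedding x') ^ 4) ^ mult w
        ≤ ((1 + C) ^ 2 * ((1 + placeScale p w * ‖ξ‖) ^ 2)⁻¹) ^ mult w := by gcongr
      _ = (1 + C) ^ (2 * mult w) * ((1 + placeScale p w * ‖sigmaStarStar B w.embedding y -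
            (ξ + sigmaStarStar B w.embedding y)‖) ^ (2 * mult w))⁻¹ := by
          rw [mul_pow, ← pow_mul, inv_pow, ← pow_mul, sub_add_cancel_right, norm_neg]
      _ ≤ placeConst B C w * ∑ ζ ∈ placeRoots p v x w,
          ((1 + placeScale p w * ‖sigmaStarStar B w.embedding y - ζ‖) ^ (2 * mult w))⁻¹ := by
          refine mul_le_mul ?_ ?_ (by positivity) hconst
          · calc (1 + C) ^ (2 * mult w) ≤ (1 + C) ^ 4 :=
                  pow_le_pow_right₀ (by linarith) (two_mul_mult_le w)
              _ ≤ placeConst B C w := pow_le_pow_left₀ (by linarith) (by linarith) 4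
          · exact Finset.single_le_sum (f := fun ζ => ((1 + placeScale p w *
              ‖sigmaStarStar B w.embedding y - ζ‖) ^ (2 * mult w))⁻¹)
              (fun ζ _ => by positivity) hmem
  -- A place outside S contributes a factor 1. It is dominated by a kernel centred at 0 with m = 1,
  -- since σ(y) is bounded for ‖y‖ ≤ 1; such kernels keep the integral over all of ℝ^k finite.
  · rw [if_neg hw, placeRoots, if_neg hw, placeScale, if_neg hw, Finset.sum_singleton, sub_zero,
      one_mul, ENNReal.one_le_ofReal, ← div_eq_mul_inv, one_le_div (by positivity)]
    calc (1 + ‖sigmaStarStar B w.embedding y‖) ^ (2 * mult w)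
        ≤ (1 + ‖sigmaStarStar B w.embedding y‖) ^ 4 :=
          pow_le_pow_right₀ (by linarith [norm_nonneg (sigmaStarStar B w.embedding y)])
            (two_mul_mult_le w)
      _ ≤ placeConst B C w := pow_le_pow_left₀ (by positivity)
          (by linarith [norm_sigmaStarStar_le (B := B) w.embedding hy]) 4

/-- Cover the support by the good sets of the finitely many directions. On each of them, average
along that direction and integrate the dominating kernels over all y, which gives a bound uniform in
x. -/
theorem exists_lintegral_decay_le (B : Module.Basis (Fin k) ℚ K) (n d : ℕ) (hR : 0 < R)
    (hS : ∀ σ ∈ S, conjugate σ ∈ S) :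
    ∃ C : ℝ≥0, ∀ p : OscData B n d R S, HSet B p.f S p.ψ ≠ 0 →
      ∫⁻ x in tsupport p.ψ, decay S p.f x ≤ C * (HSet B p.f S p.ψ)⁻¹ := by
  obtain ⟨V, c, hc, hV⟩ := exists_goodDir B n d S
  set A : ℝ := ∑ v ∈ V, ∑ l, |v l| with hA
  have hAv : ∀ v ∈ V, ∑ l, |v l| ≤ A := fun v hv =>
    Finset.single_le_sum (f := fun v : Fin n → ℝ => ∑ l, |v l|)
      (fun v _ => Finset.sum_nonneg fun _ _ => abs_nonneg _) hv
  obtain ⟨C₁, hC₁⟩ := exists_lintegral_places_le B (d + 1)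
  choose C₂ hC₂ using fun v : Fin n → ℝ =>
    exists_lintegral_le_of_shift (shift (k := k) v)
  set C₀ : ℝ≥0 := ∏ w : InfinitePlace K,
    (placeConst B (max 1 (2 ^ d * A / c)) w).toNNReal with hC₀
  refine ⟨∑ v ∈ V, C₂ v * (C₀ * C₁), fun p h0 => ?_⟩
  have hpoint : ∀ x, (tsupport p.ψ).indicator (decay S p.f) x ≤
      ∑ v ∈ V, (goodSet c p v).indicator (decay S p.f) x := by
    intro x
    by_cases hx : x ∈ tsupport p.ψ
    · obtain ⟨v, hv, hvx⟩ := hV p.f p.degree_le x fun σ hσ => p.scale_two_pos hR hσ hx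
      rw [Set.indicator_of_mem hx]
      have hmem : x ∈ goodSet c p v := ⟨hx, Set.mem_iInter₂.2 hvx⟩
      refine le_trans ?_ (Finset.single_le_sum
        (f := fun v => (goodSet c p v).indicator (decay S p.f) x) (fun _ _ => zero_le) hv)
      rw [Set.indicator_of_mem hmem]
    · rw [Set.indicator_of_notMem hx]
      exact zero_le
  have hmeas : ∀ v, Measurable ((goodSet c p v).indicator (decay S p.f)) := fun v =>
    (measurable_decay S p.f).indicator (measurableSet_goodSet c p v)
  have hone : ∀ v ∈ V, ∫⁻ x, (goodSet c p v).indicator (decay S p.f) x ≤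
      C₂ v * (C₀ * (C₁ * (HSet B p.f S p.ψ)⁻¹)) := by
    intro v hv
    refine hC₂ v _ (hmeas v) (fun x hx => ?_) _ fun x => ?_
    · exact p.tsupport_subset (Set.mem_of_indicator_ne_zero hx).1
    · calc ∫⁻ y in Metric.ball 0 1, (goodSet c p v).indicator (decay S p.f) (x + shift v y)
          ≤ ∫⁻ y in Metric.ball 0 1,
            C₀ * ∏ w, ENNReal.ofReal (∑ ζ ∈ placeRoots p v x w, ((1 + placeScale p w *
              ‖sigmaStarStar B w.embedding y - ζ‖) ^ (2 * mult w))⁻¹) := by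
            refine setLIntegral_mono' measurableSet_ball fun y hy => ?_
            by_cases hxy : x + shift v y ∈ goodSet c p v
            · rw [Set.indicator_of_mem hxy]
              refine (decay_shift_le hR hS hc (hAv v hv) p x
                (mem_ball_zero_iff.1 hy).le hxy).trans (le_of_eq ?_)
              rw [Finset.prod_mul_distrib, hC₀]
              push_cast
              rfl
            · rw [Set.indicator_of_notMem hxy]
              exact zero_le
        _ ≤ ∫⁻ y, C₀ * ∏ w, ENNReal.ofReal (∑ ζ ∈ placeRoots p v x w, ((1 + placeScale p w *
              ‖sigmaStarStar B w.embedding y - ζ‖) ^ (2 * mult w))⁻¹) :=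
            setLIntegral_le_lintegral _ _
        _ = C₀ * ∫⁻ y, ∏ w, ENNReal.ofReal (∑ ζ ∈ placeRoots p v x w, ((1 + placeScale p w *
              ‖sigmaStarStar B w.embedding y - ζ‖) ^ (2 * mult w))⁻¹) :=
            lintegral_const_mul' _ _ ENNReal.coe_ne_top
        _ ≤ C₀ * (C₁ * (HSet B p.f S p.ψ)⁻¹) := by
            rw [← prod_placeScale hS h0]
            exact mul_le_mul_right (hC₁ _ (placeScale_pos h0) _ (card_placeRoots_le p v x)) _
  calc ∫⁻ x in tsupport p.ψ, decay S p.f x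
      = ∫⁻ x, (tsupport p.ψ).indicator (decay S p.f) x :=
        (lintegral_indicator (isClosed_tsupport p.ψ).measurableSet _).symm
    _ ≤ ∫⁻ x, ∑ v ∈ V, (goodSet c p v).indicator (decay S p.f) x := lintegral_mono hpoint
    _ = ∑ v ∈ V, ∫⁻ x, (goodSet c p v).indicator (decay S p.f) x :=
        lintegral_finsetSum _ fun v _ => hmeas v
    _ ≤ ∑ v ∈ V, C₂ v * (C₀ * (C₁ * (HSet B p.f S p.ψ)⁻¹)) := Finset.sum_le_sum hone
    _ = _ := by
        rw [← Finset.sum_mul]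
        push_cast
        rw [← Finset.sum_mul]
        ring

theorem exists_oscIntegral_le (B : Module.Basis (Fin k) ℚ K) (n d : ℕ) (hR : 0 < R)
    (hne : S.Nonempty) (hS : ∀ σ ∈ S, conjugate σ ∈ S) :
    ∃ C : ℝ≥0, ∀ p : OscData B n d R S, HSet B p.f S p.ψ ≠ 0 →
      ‖oscIntegral B p.f p.ψ‖ₑ ≤ C * (HSet B p.f S p.ψ)⁻¹ := by
  obtain ⟨C, hC⟩ := exists_oscIntegral_le_lintegral (B := B) (n := n) (d := d) hR hne
  obtain ⟨C', hC'⟩ := exists_lintegral_decay_le B n d hR hS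
  refine ⟨C * C', fun p h0 => (hC p).trans ?_⟩
  rw [ENNReal.coe_mul, mul_assoc]
  exact mul_le_mul_right (hC' p h0) _

end Final

end NFOsc

end

/-! ### Degenerate cases and uniformity in the set of embeddings -/

theorem mainTheorem2 {K : Type*} [Field K] [NumberField K] {k : ℕ}
    (B : Module.Basis (Fin k) ℚ K) (n d : ℕ) (R : ℝ≥0) (hR : 0 < R) :
    ∃ C : ℝ≥0, 0 < C ∧
      ∀ (f : MvPolynomial (Fin n) (NFOsc.realAlg B)), f.totalDegree ≤ d →
      ∀ (S : Finset (K →+* ℂ)), S.Nonempty →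
        (∀ σ ∈ S, NumberField.ComplexEmbedding.conjugate σ ∈ S) →
      ∀ (ψ : EuclideanSpace ℝ (Fin n × Fin k) → ℂ), ContDiff ℝ ∞ ψ →
        tsupport ψ ⊆ Metric.closedBall 0 1 →
        (∃ N : ℕ, 4 ≤ N ∧ ∀ t : ℕ, t ≤ k * N → ∀ σ ∈ S, ∀ x ∈ tsupport ψ,
          (R : ℝ≥0∞) * NFOsc.cNorm t ψ ≤ NFOsc.JPoint B f σ x ^ t) →
        ‖NFOsc.oscIntegral B f ψ‖ₑ ≤ (C : ℝ≥0∞) * (NFOsc.HSet B f S ψ)⁻¹ := by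
  classical
  have key : ∀ S : Finset (K →+* ℂ), ∃ C : ℝ≥0, S.Nonempty →
      (∀ σ ∈ S, NumberField.ComplexEmbedding.conjugate σ ∈ S) →
      ∀ p : NFOsc.OscData B n d R S, NFOsc.HSet B p.f S p.ψ ≠ 0 →
        ‖NFOsc.oscIntegral B p.f p.ψ‖ₑ ≤ C * (NFOsc.HSet B p.f S p.ψ)⁻¹ := by
    intro S
    by_cases h : S.Nonempty ∧ ∀ σ ∈ S, NumberField.ComplexEmbedding.conjugate σ ∈ S
    · obtain ⟨C, hC⟩ := NFOsc.exists_oscIntegral_le B n d hR h.1 h.2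
      exact ⟨C, fun _ _ => hC⟩
    · exact ⟨0, fun h1 h2 => absurd ⟨h1, h2⟩ h⟩
  choose C hC using key
  -- There are finitely many sets S of embeddings, so the sum of their constants works for all. The
  -- added 1 makes the constant positive, so that the right side is ∞ when `HSet` is 0.
  refine ⟨1 + ∑ S, C S, by positivity, fun f hf S hS hconj ψ hψ hsupp hJ => ?_⟩
  by_cases h0 : NFOsc.HSet B f S ψ = 0
  · rw [h0, ENNReal.inv_zero, ENNReal.mul_top]
    · exact le_top
    · exact_mod_cast (by positivity : (0 : ℝ≥0) < 1 + ∑ S, C S).ne'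
  by_cases hψ0 : ψ = 0
  · simp [hψ0, NFOsc.oscIntegral]
  obtain ⟨N, hN, hJ⟩ := hJ
  refine (hC S hS hconj ⟨f, ψ, hf, hψ, hsupp, hψ0, fun t ht => hJ t (ht.trans ?_)⟩ h0).trans ?_
  · rw [mul_comm]
    exact Nat.mul_le_mul_left k hN
  · refine mul_le_mul_left ?_ _
    rw [ENNReal.coe_le_coe]
    exact (Finset.single_le_sum (f := C) (fun _ _ => zero_le) (Finset.mem_univ S)).trans
      (le_add_of_nonneg_left zero_le)
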